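/- **Setting.** Let $F_0/\mathbb{Q}_2$ be a finite extension and $F/F_0$ a ramified quadratic extension, with rings of integers $\mathcal{O}_{F_0}\subset\mathcal{O}_F$ and nontrivial automorphism $x\mapsto\bar x$. Fix uniformizers $\pi\in F$ and $\pi_0\in F_0$ with $\pi\bar\pi=\pi_0$ and put $t=\pi+\bar\pi\in\mathcal{O}_{F_0}$, so that $\pi^2-t\pi+\pi_0=0$; they are chosen such that either (R-U) $\pi_0\mid t\mid 2$, or (R-P) $t=0$. Put $\varepsilon=t$, $\lambda=\bar\pi/t$ in case (R-U), and $\varepsilon=2$, $\lambda=1/2$ in case (R-P). In both cases $t/\pi_0\in\mathcal{O}_{F_0}$ and $\bar\pi/\pi\in\mathcal{O}_F$. Let $R$ be an $\mathcal{O}_{F_0}$-algebra and write $a\mapsto\bar a$ and $N(a)=a\bar a$ for the induced conjugation and norm of $\mathcal{O}_F\otimes_{\mathcal{O}_{F_0}}R$. **Hermitian quadratic modules with $\phi$.** A hermitian quadratic module with $\phi$ of rank $d$ over $R$ is a tuple $(M,q,\mathscr{L},\phi)$ where $M$ is a locally free $\mathcal{O}_F\otimes_{\mathcal{O}_{F_0}}R$-module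 of rank $d$, $\mathscr{L}$ is an invertible $R$-module, $q:M\to\mathscr{L}$ is an $R$-quadratic form with polar form $f(x,y)=q(x+y)-q(x)-q(y)$, and $\phi:M\times M\to\mathscr{L}$ is an $R$-bilinear form, such that for all $a\in\mathcal{O}_F\otimes R$ and $x,y\in M$ $$q(ax)=N(a)q(x),\quad f(ax,y)=f(x,\bar a y),\quad \phi(x,\pi y)=f(x,y),\quad \phi(\pi x,y)=\phi(x,\bar\pi y),\quad \phi(x,y)=\phi\big(\tfrac{\bar\pi}{\pi}y,x\big),\quad \phi(x,x)=\tfrac{t}{\pi_0}q(x).$$ A similitude isomorphism preserving $\phi$, from $(M,q,\mathscr{L},\phi)$ to $(M',q',\mathscr{L}',\phi')$, is a pair of an $\mathcal{O}_F\otimes R$-linear isomorphism $f:M\to M'$ and an $R$-linear isomorphism $\gamma:\mathscr{L}\to\mathscr{L}'$ with $q'(f(x))=\gamma(q(x))$ and $\phi'(f(x),f(y))=\gamma(\phi(x,y))$. Two such tuples over $R$ are étale locally similar, preserving $\phi$, if such a pair exists after base change along some faithfully flat étale ring map $R\to S$. **Type $\Lambda_0$.** Let $d=2m+1$ be odd.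 Locally choose a basis $e_1,\dots,e_d$ of $M$ over $\mathcal{O}_F\otimes R$ and a generator of $\mathscr{L}$. The discriminant of $\phi$ is the determinant of the matrix of $\phi$ in the $R$-basis $e_1,\dots,e_d,\pi e_1,\dots,\pi e_d$; by the identities above it is a universal polynomial over $\mathcal{O}_{F_0}$ in the values $q(e_i)$ and $\phi(e_i,e_j),\ \phi(e_i,\pi e_j)$ ($i<j$). This polynomial is divisible by $\frac{4\pi_0-t^2}{\pi_0}$, and evaluating the quotient polynomial gives the divided discriminant $\mathrm{disc}'(\phi)$, which is compatible with base change and defines a homomorphism $\wedge_R^{2d}M\to\wedge_R^{2d}(M^\vee)\otimes\mathscr{L}^{2d}\otimes(\frac{4\pi_0-t^2}{\pi_0})$ of invertible $R$-modules. The tuple $(M,q,\mathscr{L},\phi)$ is of type $\Lambda_0$ if $\mathrm{disc}'(\phi)$ is an isomorphism, i.e. is given by a unit wherever $M$ and $\mathscr{L}$ are trivialized. **Standard module.** Let $N_{std,2}$ be free over $\mathcal{O}_F\otimes R$ on $e_1,e_2$, with the $R$-valued forms determined by $q(e_1)=q(e_2)=0$, $\phi(e_1,e_2)=0$, $\phi(e_1,\pi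 e_2)=1$. Let $N_{std,1}$ be free on one generator $e$, with $q(e)=1$, $\phi(e,e)=t/\pi_0$, $\phi(e,\pi e)=2$. For $n=2m+1$ let $(N_{std,n},q_{std,n},R,\phi_{std,n})$ be the orthogonal direct sum $N_{std,2}^{\oplus m}\oplus N_{std,1}$. **Lattice.** Let $(V,h)$ be a split $F/F_0$-hermitian space of dimension $n=2m+1$, with basis $e_1,\dots,e_n$ such that $h(e_i,e_j)=\delta_{i,n+1-j}$. Let $\Lambda_0\subset V$ be the $\mathcal{O}_F$-span of $e_1,\dots,e_{m+1},\lambda e_{m+2},\dots,\lambda e_n$, with the $\varepsilon^{-1}\mathcal{O}_{F_0}$-valued forms $q(x)=\tfrac12\varepsilon^{-1}\mathrm{Tr}_{F/F_0}h(x,x)$ and $\phi(x,y)=\varepsilon^{-1}\mathrm{Tr}_{F/F_0}h(x,\pi^{-1}y)$. **Theorem.** Let $m\ge 0$, $n=2m+1$, and let $(M,q,\mathscr{L},\phi)$ be a hermitian quadratic module with $\phi$ of rank $n$ over $R$ which is of type $\Lambda_0$. Then $(M,q,\mathscr{L},\phi)$ is étale locally similar, preserving $\phi$, to $(N_{std,n},q_{std,n},R,\phi_{std,n})$.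 Moreover, it is étale locally similar, preserving $\phi$, to $(\Lambda_0,q,\varepsilon^{-1}\mathcal{O}_{F_0},\phi)\otimes_{\mathcal{O}_{F_0}}R$. -/

import Mathlib

open scoped TensorProduct

namespace QuadraticMap

variable {R : Type*} [CommRing R] {M L : Type*} [AddCommGroup M] [Module R M]
  [AddCommGroup L] [Module R L] (S : Type*) [CommRing S] [Algebra R S]

theorem exists_scalarExtension_of_bilin {P : Type*} [AddCommGroup P] [Module R P]
    (q : QuadraticMap R M L) (p : P →ₗ[R] M) (hp : Function.Surjective p)
    (B : LinearMap.BilinMap R P L) (hBq : ∀ x, B x x = q (p x)) :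
    ∃ Q : QuadraticMap S (S ⊗[R] M) (S ⊗[R] L),
      ∀ (s : S) (m : M), Q (s ⊗ₜ[R] m) = (s * s) ⊗ₜ[R] q m := by
  let BS : LinearMap.BilinMap S (S ⊗[R] P) (S ⊗[R] L) := B.baseChange S
  let f : LinearMap.BilinMap S (S ⊗[R] M) (S ⊗[R] L) :=
    LinearMap.BilinMap.baseChange S q.polarBilin
  let pS : S ⊗[R] P →ₗ[S] S ⊗[R] M := p.baseChange S
  have hpS : Function.Surjective pS := LinearMap.lTensor_surjective S hp
  have hpol : ∀ x y, BS x y + BS y x = f (pS x) (pS y) := by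
    intro x y
    induction x with
    | zero => simp
    | add x x' hx hx' =>
      simp only [map_add, LinearMap.add_apply, ← hx, ← hx']; abel
    | tmul s a =>
      induction y with
      | zero => simp
      | add y y' hy hy' =>
        simp only [map_add, LinearMap.add_apply, ← hy, ← hy']; abel
      | tmul s' b =>
        have h1 : B a b + B b a = QuadraticMap.polar q (p a) (p b) := by
          have := hBq (a + b)
          simp only [map_add, LinearMap.add_apply, hBq] at this
          rw [QuadraticMap.polar, ← this]; abel
        simp only [BS, f, pS, LinearMap.BilinMap.baseChange_tmul, LinearMap.baseChange_tmul,
          QuadraticMap.polarBilin_apply_apply, ← h1, TensorProduct.tmul_add, mul_comm s' s]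
  let iS : S ⊗[R] (LinearMap.ker p) →ₗ[S] S ⊗[R] P :=
    (LinearMap.ker p).subtype.baseChange S
  have hpi : ∀ z, pS (iS z) = 0 := by
    intro z
    induction z with
    | zero => simp
    | add x y hx hy => rw [map_add, map_add, hx, hy, add_zero]
    | tmul s a =>
      have : p a = 0 := a.2
      simp only [pS, iS, LinearMap.baseChange_tmul, Submodule.subtype_apply, this,
        TensorProduct.tmul_zero]
  have hi : ∀ z, BS (iS z) (iS z) = 0 := by
    intro z
    induction z with
    | zero => simp
    | add x y hx hy =>
      have h2 := hpol (iS x) (iS y)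
      rw [hpi, map_zero, LinearMap.zero_apply] at h2
      simp only [map_add, LinearMap.add_apply, hx, hy, zero_add, add_zero]
      rw [add_comm]; exact h2
    | tmul s a =>
      have : B a a = 0 := by rw [hBq, LinearMap.mem_ker.1 a.2, map_zero]
      simp only [BS, iS, LinearMap.baseChange_tmul, Submodule.subtype_apply,
        LinearMap.BilinMap.baseChange_tmul, this, TensorProduct.tmul_zero]
  have hker : ∀ k, pS k = 0 → BS k k = 0 := by
    intro k hk
    have hex : Function.Exact (LinearMap.lTensor S (LinearMap.ker p).subtype)
        (LinearMap.lTensor S p) :=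
      lTensor_exact S (f := (LinearMap.ker p).subtype) (g := p)
        (LinearMap.exact_iff.2 (Submodule.range_subtype _).symm) hp
    obtain ⟨z, hz⟩ := (hex k).1 hk
    have hz' : iS z = k := hz
    rw [← hz']; exact hi z
  have hwd : ∀ x y, pS x = pS y → BS x x = BS y y := by
    intro x y hxy
    have h0 : pS (x - y) = 0 := by rw [map_sub, hxy, sub_self]
    have h1 := hker _ h0
    have h2 := hpol (x - y) y
    rw [h0, map_zero, LinearMap.zero_apply] at h2
    have h3 : BS x x = BS (x - y) (x - y) + (BS (x - y) y + BS y (x - y)) + BS y y := by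
      simp only [map_sub, LinearMap.sub_apply]; abel
    rw [h3, h1, h2]; simp
  let g := Function.surjInv hpS
  have hg : ∀ z, pS (g z) = z := Function.surjInv_eq hpS
  refine ⟨⟨fun z => BS (g z) (g z), fun a z => ?_, f, fun x y => ?_⟩, fun s m => ?_⟩
  · rw [hwd (g (a • z)) (a • g z) (by rw [map_smul, hg, hg])]
    simp [smul_smul]
  · rw [hwd (g (x + y)) (g x + g y) (by rw [map_add, hg, hg, hg])]
    have := hpol (g x) (g y)
    rw [hg, hg] at this
    rw [← this]
    simp only [map_add, LinearMap.add_apply]; abel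
  · obtain ⟨x, rfl⟩ := hp m
    change BS _ _ = _
    rw [hwd (g (s ⊗ₜ p x)) (s ⊗ₜ x) (by rw [hg]; simp [pS])]
    simp [BS, hBq]

/-- Every quadratic map extends to the scalar extension of its source and target. -/
theorem exists_scalarExtension (q : QuadraticMap R M L) :
    ∃ Q : QuadraticMap S (S ⊗[R] M) (S ⊗[R] L),
      ∀ (s : S) (m : M), Q (s ⊗ₜ[R] m) = (s * s) ⊗ₜ[R] q m := by
  obtain ⟨B, hB⟩ := LinearMap.BilinMap.toQuadraticMap_surjective
    (q.comp (Finsupp.linearCombination R (id : M → M)))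
  exact exists_scalarExtension_of_bilin S q (Finsupp.linearCombination R (id : M → M))
    (fun m => ⟨Finsupp.single m 1, by simp⟩) B (fun x => by simpa using congrArg (fun Q => Q x) hB)

/-- The scalar extension `S ⊗ M → S ⊗ L` of a quadratic map `q : M → L`. No assumption on `2` and
no projectivity assumption is made. By `QuadraticMap.baseChange_ext`, it is the only quadratic map
over `S` with the property `scalarExtension_tmul`. -/
noncomputable def scalarExtension (q : QuadraticMap R M L) :
    QuadraticMap S (S ⊗[R] M) (S ⊗[R] L) :=
  Classical.choose (exists_scalarExtension S q)

theorem scalarExtension_tmul (q : QuadraticMap R M L) (s : S) (m : M) :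
    q.scalarExtension S (s ⊗ₜ[R] m) = (s * s) ⊗ₜ[R] q m :=
  Classical.choose_spec (exists_scalarExtension S q) s m

end QuadraticMap

namespace HermQuad

universe uO uA uR uS uM uL uM' uL'

/-- A quadratic extension `A = O ⊕ O π` of commutative rings, with conjugation `a ↦ conj a`, such
that `π` is a root of `X² - t X + π₀` with `t = π₀ τ`. -/
structure QuadDatum (O : Type uO) (A : Type uA) [CommRing O] [CommRing A] [Algebra O A] where
  conj : A ≃ₐ[O] A
  π : A
  π₀ : O
  τ : O
  basis : Module.Basis (Fin 2) O A
  basis_zero : basis 0 = 1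
  basis_one : basis 1 = π
  add_conj : π + conj π = algebraMap O A (π₀ * τ)
  mul_conj : π * conj π = algebraMap O A π₀

namespace QuadDatum

variable {O : Type uO} {A : Type uA} [CommRing O] [CommRing A] [Algebra O A] (D : QuadDatum O A)

/-- The trace `t = π + conj π = π₀ τ`; thus `τ` is `t / π₀`. -/
def t : O := D.π₀ * D.τ

/-- The constant `4 - t τ`, that is `(4 π₀ - t²) / π₀`. -/
def c : O := 4 - D.t * D.τ

theorem π₀_mul_c : D.π₀ * D.c = 4 * D.π₀ - D.t ^ 2 := by
  simp only [c, t]; ring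

/-- The element `conj π / π` of `A`, see `ratio_mul_π`. -/
def ratio : A := algebraMap O A D.τ * D.conj D.π - 1

theorem ratio_mul_π : D.ratio * D.π = D.conj D.π := by
  have h1 := D.add_conj
  have h2 := D.mul_conj
  rw [map_mul] at h1
  simp only [ratio]
  linear_combination (algebraMap O A D.τ) * h2 - h1

section

variable (R : Type uR) [CommRing R] [Algebra O R]

/-- The conjugation `r ⊗ a ↦ r ⊗ conj a` of `R ⊗ A`. -/
noncomputable def conjR : R ⊗[O] A →ₐ[R] R ⊗[O] A :=
  Algebra.TensorProduct.map (AlgHom.id R R) (D.conj : A →ₐ[O] A)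

/-- The coordinates of an element of `R ⊗ A = R ⊕ R π`. -/
noncomputable def coord (i : Fin 2) : R ⊗[O] A →ₗ[R] R :=
  (Algebra.TensorProduct.basis R D.basis).coord i

/-- The norm `N : R ⊗ A → R`, `N(a) = a * conj a`, see `algebraMap_normR`. -/
noncomputable def normR (a : R ⊗[O] A) : R := D.coord R 0 (a * D.conjR R a)

theorem eq_coord (a : R ⊗[O] A) :
    a = D.coord R 0 a • 1 + D.coord R 1 a • ((1 : R) ⊗ₜ[O] D.π) := by
  have := (Algebra.TensorProduct.basis R D.basis).sum_repr a
  rw [Fin.sum_univ_two, Algebra.TensorProduct.basis_apply, Algebra.TensorProduct.basis_apply,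
    D.basis_zero, D.basis_one] at this
  exact this.symm

theorem coord_zero_one : D.coord R 0 1 = 1 := by
  have : (1 : R ⊗[O] A) = Algebra.TensorProduct.basis R D.basis 0 := by
    rw [Algebra.TensorProduct.basis_apply, D.basis_zero]; rfl
  rw [coord, this]; simp

theorem coord_one_one : D.coord R 1 1 = 0 := by
  have : (1 : R ⊗[O] A) = Algebra.TensorProduct.basis R D.basis 0 := by
    rw [Algebra.TensorProduct.basis_apply, D.basis_zero]; rfl
  rw [coord, this]; simp

theorem coord_zero_π : D.coord R 0 (1 ⊗ₜ[O] D.π) = 0 := by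
  have : (1 : R) ⊗ₜ[O] D.π = Algebra.TensorProduct.basis R D.basis 1 := by
    rw [Algebra.TensorProduct.basis_apply, D.basis_one]
  rw [coord, this]; simp

theorem coord_one_π : D.coord R 1 (1 ⊗ₜ[O] D.π) = 1 := by
  have : (1 : R) ⊗ₜ[O] D.π = Algebra.TensorProduct.basis R D.basis 1 := by
    rw [Algebra.TensorProduct.basis_apply, D.basis_one]
  rw [coord, this]; simp

theorem algebraMap_normR (a : R ⊗[O] A) :
    algebraMap R (R ⊗[O] A) (D.normR R a) = a * D.conjR R a := by
  have key : ∃ r : R, algebraMap R (R ⊗[O] A) r = a * D.conjR R a := by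
    obtain ⟨x, y, hxy⟩ : ∃ x y : R,
        a = algebraMap R _ x + algebraMap R _ y * ((1 : R) ⊗ₜ[O] D.π) :=
      ⟨_, _, by
        have := D.eq_coord R a
        rwa [Algebra.smul_def, Algebra.smul_def, mul_one] at this⟩
    have hs : ((1 : R) ⊗ₜ[O] D.π) + (1 : R) ⊗ₜ[O] D.conj D.π
        = algebraMap R (R ⊗[O] A) (algebraMap O R D.t) := by
      rw [← TensorProduct.tmul_add, D.add_conj, ← IsScalarTower.algebraMap_apply O R (R ⊗[O] A),
        ← Algebra.TensorProduct.algebraMap_apply']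
      rfl
    have hp : ((1 : R) ⊗ₜ[O] D.π) * (1 : R) ⊗ₜ[O] D.conj D.π
        = algebraMap R (R ⊗[O] A) (algebraMap O R D.π₀) := by
      rw [Algebra.TensorProduct.tmul_mul_tmul, D.mul_conj, one_mul,
        ← IsScalarTower.algebraMap_apply O R (R ⊗[O] A),
        ← Algebra.TensorProduct.algebraMap_apply']
    have hc : D.conjR R a
        = algebraMap R _ x + algebraMap R _ y * ((1 : R) ⊗ₜ[O] D.conj D.π) := by
      rw [hxy, map_add, map_mul, AlgHom.commutes, AlgHom.commutes]
      rfl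
    refine ⟨x * x + x * y * algebraMap O R D.t + y * y * algebraMap O R D.π₀, ?_⟩
    rw [hc, hxy]
    simp only [map_add, map_mul]
    rw [← hs, ← hp]
    ring
  obtain ⟨r, hr⟩ := key
  have : D.normR R a = r := by
    rw [normR, ← hr, Algebra.algebraMap_eq_smul_one, map_smul, D.coord_zero_one]; simp
  rw [this, hr]

end

end QuadDatum

/-- A module `M` over `R ⊗ A` and a module `L` over `R`, with a quadratic map `q : M → L` and a
bilinear map `φ : M × M → L` over `R`; no axioms are imposed. -/
structure FormModule (O : Type uO) (A : Type uA) (R : Type uR) [CommRing O] [CommRing A]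
    [Algebra O A] [CommRing R] [Algebra O R] where
  M : Type uM
  L : Type uL
  [addCommGroupM : AddCommGroup M]
  [moduleM : Module R M]
  [moduleAM : Module (R ⊗[O] A) M]
  [towerM : IsScalarTower R (R ⊗[O] A) M]
  [addCommGroupL : AddCommGroup L]
  [moduleL : Module R L]
  q : QuadraticMap R M L
  φ : M →ₗ[R] M →ₗ[R] L

attribute [instance] FormModule.addCommGroupM FormModule.moduleM FormModule.moduleAM
  FormModule.towerM FormModule.addCommGroupL FormModule.moduleL

namespace FormModule

variable {O : Type uO} {A : Type uA} [CommRing O] [CommRing A] [Algebra O A]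
variable {R : Type uR} [CommRing R] [Algebra O R]

/-- `X = (M, q, L, φ)` is a hermitian quadratic module with `φ`, of rank `d` over `R`. -/
structure IsHermitian (D : QuadDatum O A) (d : ℕ) (X : FormModule.{uO, uA, uR, uM, uL} O A R) :
    Prop where
  /-- `M` is locally free of rank `d` over `R ⊗ A`. -/
  finite : Module.Finite (R ⊗[O] A) X.M
  projective : Module.Projective (R ⊗[O] A) X.M
  rank : ∀ p : PrimeSpectrum (R ⊗[O] A), Module.rankAtStalk X.M p = d
  invertible : Module.Invertible R X.L
  q_smul : ∀ (a : R ⊗[O] A) (x : X.M), X.q (a • x) = D.normR R a • X.q x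
  polar_smul : ∀ (a : R ⊗[O] A) (x y : X.M),
    QuadraticMap.polar X.q (a • x) y = QuadraticMap.polar X.q x (D.conjR R a • y)
  φ_π_right : ∀ x y : X.M, X.φ x (((1 : R) ⊗ₜ[O] D.π) • y) = X.q (x + y) - X.q x - X.q y
  φ_π_left : ∀ x y : X.M,
    X.φ (((1 : R) ⊗ₜ[O] D.π) • x) y = X.φ x (((1 : R) ⊗ₜ[O] D.conj D.π) • y)
  φ_swap : ∀ x y : X.M, X.φ x y = X.φ (((1 : R) ⊗ₜ[O] D.ratio) • y) x
  φ_self : ∀ x : X.M, X.φ x x = algebraMap O R D.τ • X.q x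

/-- A similitude isomorphism preserving `φ` exists between `X` and `Y`. -/
def Similar (X : FormModule.{uO, uA, uR, uM, uL} O A R)
    (Y : FormModule.{uO, uA, uR, uM', uL'} O A R) : Prop :=
  ∃ (f : X.M ≃ₗ[R ⊗[O] A] Y.M) (γ : X.L ≃ₗ[R] Y.L),
    (∀ x, Y.q (f x) = γ (X.q x)) ∧ ∀ x y, Y.φ (f x) (f y) = γ (X.φ x y)

section BaseChange

variable (S : Type uS) [CommRing S] [Algebra R S] [Algebra O S] [IsScalarTower O R S]

/-- The action of `A` on `S ⊗ M` through the second factor. -/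
noncomputable def scalarAction (X : FormModule.{uO, uA, uR, uM, uL} O A R) :
    A →ₐ[O] Module.End S (S ⊗[R] X.M) where
  toFun a := LinearMap.baseChange S (Module.toModuleEnd R (S := R ⊗[O] A) X.M (1 ⊗ₜ[O] a))
  map_one' := by
    have h : Module.toModuleEnd R (S := R ⊗[O] A) X.M ((1 : R) ⊗ₜ[O] (1 : A)) = LinearMap.id :=
      map_one (Module.toModuleEnd R (S := R ⊗[O] A) X.M)
    rw [h, LinearMap.baseChange_id]
    rfl
  map_mul' a b := by
    have h : (1 : R) ⊗ₜ[O] (a * b) = ((1 : R) ⊗ₜ[O] a) * ((1 : R) ⊗ₜ[O] b) := by simp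
    rw [h, map_mul]
    ext m
    rfl
  map_zero' := by
    ext m
    simp
  map_add' a b := by
    ext m
    simp [TensorProduct.tmul_add, add_smul]
  commutes' r := by
    ext m
    have : (1 : R) ⊗ₜ[O] algebraMap O A r = algebraMap R (R ⊗[O] A) (algebraMap O R r) := by
      rw [← IsScalarTower.algebraMap_apply O R (R ⊗[O] A),
        ← Algebra.TensorProduct.algebraMap_apply']
    simp [this, -Algebra.TensorProduct.algebraMap_apply]

/-- The action of `S ⊗ A` on `S ⊗ M`. -/
noncomputable def tensorAction (X : FormModule.{uO, uA, uR, uM, uL} O A R) :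
    S ⊗[O] A →ₐ[S] Module.End S (S ⊗[R] X.M) :=
  Algebra.TensorProduct.lift (Algebra.ofId S _) (X.scalarAction S)
    (fun s _ => Algebra.commutes s _)

/-- The base change `(M, q, L, φ) ⊗ S` of `X = (M, q, L, φ)` along `R → S`. -/
noncomputable def baseChange (X : FormModule.{uO, uA, uR, uM, uL} O A R) :
    FormModule.{uO, uA, uS, max uS uM, max uS uL} O A S :=
  letI : Module (S ⊗[O] A) (S ⊗[R] X.M) :=
    Module.compHom (S ⊗[R] X.M) (X.tensorAction S).toRingHom
  haveI : IsScalarTower S (S ⊗[O] A) (S ⊗[R] X.M) :=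
    ⟨fun s a x => by
      change X.tensorAction S (s • a) x = s • X.tensorAction S a x
      rw [map_smul, LinearMap.smul_apply]⟩
  { M := S ⊗[R] X.M
    L := S ⊗[R] X.L
    q := X.q.scalarExtension S
    φ := LinearMap.BilinMap.baseChange S X.φ }

end BaseChange

/-- `X` and `Y` become similar, compatibly with `φ`, over an étale covering `Spec S → Spec R`. -/
def EtaleLocallySimilar (X : FormModule.{uO, uA, uR, uM, uL} O A R)
    (Y : FormModule.{uO, uA, uR, uM', uL'} O A R) : Prop :=
  ∃ (S : Type uR) (_ : CommRing S) (_ : Algebra R S) (_ : Algebra O S) (_ : IsScalarTower O R S),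
    Algebra.Etale R S ∧ Module.FaithfullyFlat R S ∧ (X.baseChange S).Similar (Y.baseChange S)

end FormModule

end HermQuad

namespace HermQuad

universe uO uA uR uM uL

section Discriminant

variable {T : Type*} [CommRing T] {d : ℕ}

/-- For elements `e₁, …, e_d` of a hermitian quadratic module with `φ`, the values `φ(eᵢ, eⱼ)`
expressed through `qv i = q(eᵢ)`, `av i j = φ(eᵢ, eⱼ)` and `bv i j = φ(eᵢ, π eⱼ)` for `i < j`. -/
def gramA (τ : T) (qv : Fin d → T) (av bv : Fin d → Fin d → T) : Matrix (Fin d) (Fin d) T :=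
  Matrix.of fun i j => if i = j then τ * qv i else if i < j then av i j else τ * bv j i - av j i

/-- The values `φ(eᵢ, π eⱼ)` expressed through the same data. -/
def gramB (qv : Fin d → T) (bv : Fin d → Fin d → T) : Matrix (Fin d) (Fin d) T :=
  Matrix.of fun i j => if i = j then 2 * qv i else if i < j then bv i j else bv j i

/-- The matrix of `φ` in `e₁, …, e_d, π e₁, …, π e_d` expressed through the same data. -/
def gram (π₀ τ : T) (qv : Fin d → T) (av bv : Fin d → Fin d → T) :
    Matrix (Fin d ⊕ Fin d) (Fin d ⊕ Fin d) T :=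
  Matrix.fromBlocks (gramA τ qv av bv) (gramB qv bv)
    ((π₀ * τ) • gramA τ qv av bv - gramB qv bv) (π₀ • gramA τ qv av bv)

theorem det_eq_zero_of_alternating_of_odd (hd : Odd d) (H : Matrix (Fin d) (Fin d) T)
    (h0 : ∀ i, H i i = 0) (h1 : ∀ i j, H j i = - H i j) : H.det = 0 := by
  classical
  rw [Matrix.det_apply]
  refine Finset.sum_involution (fun s _ => s⁻¹) ?_ ?_ (fun _ _ => Finset.mem_univ _)
    (fun s _ => inv_inv s)
  · intro s _
    have : ∏ i, H (s⁻¹ i) i = - ∏ i, H (s i) i := by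
      calc ∏ i, H (s⁻¹ i) i = ∏ i, H (s⁻¹ (s i)) (s i) :=
            (Equiv.prod_comp s (fun i => H (s⁻¹ i) i)).symm
        _ = ∏ i, - H (s i) i := Finset.prod_congr rfl fun i _ => by simp [h1 (s i) i]
        _ = - ∏ i, H (s i) i := by rw [Finset.prod_neg]; simp [hd.neg_one_pow]
    rw [this, Equiv.Perm.sign_inv]; simp
  · intro s _ hs hss
    apply hs
    obtain ⟨i, hi⟩ : ∃ i, s i = i := by
      have hd2 : ¬ 2 ∣ Fintype.card (Fin d) := by
        rw [Fintype.card_fin]; exact hd.not_two_dvd_nat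
      refine Equiv.Perm.exists_fixed_point_of_prime (p := 2) (n := 1) hd2 ?_
      rw [pow_one, sq]
      nth_rewrite 2 [← hss]
      exact mul_inv_cancel s
    rw [Finset.prod_eq_zero (Finset.mem_univ i) (by rw [hi, h0]), smul_zero]

/-- If `w` is a root of `X² - π₀ τ X + π₀` and `s` is a ring endomorphism that exchanges the two
roots, then `det (gram)` is `4 - π₀ τ²` times the norm of some element. -/
theorem exists_det_gram_eq {K : Type*} [CommRing K] (ι : T →+* K) (s : K →+* K) (w : K)
    (hd : Odd d) (π₀ τ : T) (qv : Fin d → T) (av bv : Fin d → Fin d → T)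
    (hw : w * w = ι (π₀ * τ) * w - ι π₀) (hs : s w = ι (π₀ * τ) - w) (hι : ∀ x, s (ι x) = ι x) :
    ∃ κ : K, ι (gram π₀ τ qv av bv).det = ι (4 - π₀ * τ * τ) * (κ * s κ) := by
  classical
  have h2 : ι 2 = 2 := map_ofNat ι 2
  let η : K := 2 - ι τ * w
  let a : Matrix (Fin d) (Fin d) K := (gramA τ qv av bv).map ι
  let b : Matrix (Fin d) (Fin d) K := (gramB qv bv).map ι
  let H : Matrix (Fin d) (Fin d) K := b - w • a
  let H' : Matrix (Fin d) (Fin d) K := s.mapMatrix H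
  have hH' : H' = b - (ι (π₀ * τ) - w) • a := by
    ext1 i j
    simp [H', H, hs, a, b, hι]
  have hη : η * s η = ι (4 - π₀ * τ * τ) := by
    simp only [η, map_sub, map_mul, map_ofNat, hs, hι] at hw ⊢
    linear_combination (-(ι τ) ^ 2) * hw
  have hdvd : η ∣ H.det := by
    rw [← Ideal.mem_span_singleton, ← Ideal.Quotient.eq_zero_iff_mem, RingHom.map_det]
    apply det_eq_zero_of_alternating_of_odd hd
    · intro i
      rw [RingHom.mapMatrix_apply, Matrix.map_apply, Ideal.Quotient.eq_zero_iff_mem,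
        Ideal.mem_span_singleton]
      refine ⟨ι (qv i), ?_⟩
      simp [H, a, b, gramA, gramB, η, h2]
      ring
    · have key : ∀ i j, i < j → η ∣ H i j + H j i := by
        intro i j hij
        refine ⟨ι (bv i j), ?_⟩
        simp [H, a, b, gramA, gramB, η, hij.ne, hij.ne', hij, not_lt.2 hij.le]
        ring
      intro i j
      rw [RingHom.mapMatrix_apply, Matrix.map_apply, Matrix.map_apply, ← sub_eq_zero, ← map_neg,
        ← map_sub, Ideal.Quotient.eq_zero_iff_mem, Ideal.mem_span_singleton, sub_neg_eq_add]
      rcases lt_trichotomy i j with h | h | h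
      · rw [add_comm]; exact key i j h
      · subst h
        refine ⟨2 * ι (qv i), ?_⟩
        simp [H, a, b, gramA, gramB, η, h2]
        ring
      · exact key j i h
  obtain ⟨κ, hκ⟩ := hdvd
  have hG : ι (gram π₀ τ qv av bv).det = H.det * H'.det := by
    let P : Matrix (Fin d ⊕ Fin d) (Fin d ⊕ Fin d) K := Matrix.fromBlocks 1 0 (-(w • 1)) 1
    let Q₁ : Matrix (Fin d ⊕ Fin d) (Fin d ⊕ Fin d) K :=
      Matrix.fromBlocks 1 (-(w • 1) - 1) 0 1
    let Q₂ : Matrix (Fin d ⊕ Fin d) (Fin d ⊕ Fin d) K := Matrix.fromBlocks 1 0 1 1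
    let Q₃ : Matrix (Fin d ⊕ Fin d) (Fin d ⊕ Fin d) K := Matrix.fromBlocks 1 (-1) 0 1
    have hmul : P * (ι.mapMatrix (gram π₀ τ qv av bv)) * (Q₁ * Q₂ * Q₃)
        = Matrix.fromBlocks H (-a) 0 H' := by
      have hg : ι.mapMatrix (gram π₀ τ qv av bv)
          = Matrix.fromBlocks a b (ι (π₀ * τ) • a - b) (ι π₀ • a) := by
        rw [gram, RingHom.mapMatrix_apply, Matrix.fromBlocks_map]
        congr 1
        · ext1 i j; simp [a, b]
        · ext1 i j; simp [a]
      have hQ : Q₁ * Q₂ * Q₃ = Matrix.fromBlocks (-(w • 1)) (-1) 1 0 := by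
        simp [Q₁, Q₂, Q₃, Matrix.fromBlocks_multiply]
        abel
      rw [hg, hQ, hH']
      simp only [P, Matrix.fromBlocks_multiply]
      congr 1
      · ext1 i j; simp [H]; ring
      · ext1 i j; simp
      · ext1 i j
        rw [map_mul] at hw
        simp
        linear_combination (a i j) * hw
      · ext1 i j; simp; ring
    have := congrArg Matrix.det hmul
    rw [RingHom.map_det]
    simpa [Matrix.det_mul, P, Q₁, Q₂, Q₃, Matrix.det_fromBlocks_zero₁₂,
      Matrix.det_fromBlocks_zero₂₁] using this
  refine ⟨κ, ?_⟩
  rw [hG, show H'.det = s H.det from (RingHom.map_det s H).symm, hκ, map_mul, ← hη]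
  ring

theorem c_dvd_det_gram (hd : Odd d) (π₀ τ : T) (qv : Fin d → T) (av bv : Fin d → Fin d → T) :
    (4 - π₀ * τ * τ) ∣ (gram π₀ τ qv av bv).det := by
  let ι : T →+* QuadraticAlgebra T (-π₀) (π₀ * τ) := algebraMap _ _
  let s : QuadraticAlgebra T (-π₀) (π₀ * τ) →+* QuadraticAlgebra T (-π₀) (π₀ * τ) := starRingEnd _
  have hι : Function.Injective ι := QuadraticAlgebra.algebraMap_injective
  obtain ⟨κ, hκ⟩ := exists_det_gram_eq ι s (QuadraticAlgebra.omega) hd π₀ τ qv av bv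
    (by ext <;> simp [ι, -map_mul, QuadraticAlgebra.algebraMap_eq])
    (by ext <;> simp [s, ι, starRingEnd_apply, -map_mul, QuadraticAlgebra.algebraMap_eq])
    (fun x => by ext <;> simp [s, ι, starRingEnd_apply, QuadraticAlgebra.algebraMap_eq])
  refine ⟨QuadraticAlgebra.norm κ, hι ?_⟩
  rw [hκ, map_mul ι, show s κ = star κ from rfl]
  congr 1
  exact (QuadraticAlgebra.algebraMap_norm_eq_mul_star κ).symm

end Discriminant

namespace QuadDatum

variable {O : Type uO} {A : Type uA} [CommRing O] [CommRing A] [Algebra O A] (D : QuadDatum O A)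

/-- Indices of the coordinates `q(eᵢ)`, `φ(eᵢ, eⱼ)` and `φ(eᵢ, π eⱼ)` on the space of all pairs
`(q, φ)` on a free module with basis `e₁, …, e_d` (only the last two with `i < j` are used). -/
abbrev CoordIndex (d : ℕ) : Type := Fin d ⊕ (Fin d × Fin d) ⊕ (Fin d × Fin d)

/-- The discriminant of the universal `φ`, a polynomial in the coordinates. -/
noncomputable def discPoly (d : ℕ) : MvPolynomial (CoordIndex d) O :=
  (gram (MvPolynomial.C D.π₀) (MvPolynomial.C D.τ) (fun i => MvPolynomial.X (Sum.inl i))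
    (fun i j => MvPolynomial.X (Sum.inr (Sum.inl (i, j))))
    (fun i j => MvPolynomial.X (Sum.inr (Sum.inr (i, j))))).det

theorem C_c_dvd_discPoly (m : ℕ) : MvPolynomial.C D.c ∣ D.discPoly (2 * m + 1) := by
  have := c_dvd_det_gram (d := 2 * m + 1) ⟨m, rfl⟩ (MvPolynomial.C D.π₀ : MvPolynomial
      (CoordIndex (2 * m + 1)) O) (MvPolynomial.C D.τ) (fun i => MvPolynomial.X (Sum.inl i))
    (fun i j => MvPolynomial.X (Sum.inr (Sum.inl (i, j))))
    (fun i j => MvPolynomial.X (Sum.inr (Sum.inr (i, j))))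
  have hc : (MvPolynomial.C D.c : MvPolynomial (CoordIndex (2 * m + 1)) O)
      = 4 - MvPolynomial.C D.π₀ * MvPolynomial.C D.τ * MvPolynomial.C D.τ := by
    simp only [c, t, map_sub, map_mul]
    rfl
  rw [hc]
  exact this

/-- The divided discriminant of the universal `φ` in odd rank `2 m + 1`: the quotient of the
discriminant by `(4 π₀ - t²) / π₀`. It is unique when `O` is a domain and `4 π₀ ≠ t²`. -/
noncomputable def dividedDiscPoly (m : ℕ) : MvPolynomial (CoordIndex (2 * m + 1)) O :=
  Classical.choose (D.C_c_dvd_discPoly m)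

theorem C_c_mul_dividedDiscPoly (m : ℕ) :
    MvPolynomial.C D.c * D.dividedDiscPoly m = D.discPoly (2 * m + 1) :=
  (Classical.choose_spec (D.C_c_dvd_discPoly m)).symm

end QuadDatum

namespace FormModule

variable {O : Type uO} {A : Type uA} [CommRing O] [CommRing A] [Algebra O A]
variable {R : Type uR} [CommRing R] [Algebra O R]

/-- The divided discriminant of `φ`, viewed as an element of `R` by means of a basis `e` of `M`
over `R ⊗ A` (hence the basis `e, π e` of `M` over `R`) and a generator of `L`, given as an
isomorphism `ℓ : L ≃ R`. -/
noncomputable def dividedDisc (D : QuadDatum O A) {m : ℕ}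
    (X : FormModule.{uO, uA, uR, uM, uL} O A R)
    (e : Module.Basis (Fin (2 * m + 1)) (R ⊗[O] A) X.M) (ℓ : X.L ≃ₗ[R] R) : R :=
  MvPolynomial.aeval
    (Sum.elim (fun i => ℓ (X.q (e i)))
      (Sum.elim (fun ij => ℓ (X.φ (e ij.1) (e ij.2)))
        (fun ij => ℓ (X.φ (e ij.1) (((1 : R) ⊗ₜ[O] D.π) • e ij.2)))))
    (D.dividedDiscPoly m)

/-- `X` is a hermitian quadratic module with `φ`, of rank `2 m + 1` and of type `Λ₀`: the divided
discriminant, a homomorphism of invertible modules, is an isomorphism. That is, wherever `M` and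
`L` are trivialized, it is given by a unit. -/
def IsTypeLambdaZero (D : QuadDatum O A) (m : ℕ) (X : FormModule.{uO, uA, uR, uM, uL} O A R) :
    Prop :=
  X.IsHermitian D (2 * m + 1) ∧
    ∀ (S : Type uR) [CommRing S] [Algebra R S] [Algebra O S] [IsScalarTower O R S]
      (e : Module.Basis (Fin (2 * m + 1)) (S ⊗[O] A) (X.baseChange S).M)
      (ℓ : (X.baseChange S).L ≃ₗ[S] S), IsUnit ((X.baseChange S).dividedDisc D e ℓ)

end FormModule

section Standard

variable {O : Type uO} {A : Type uA} [CommRing O] [CommRing A] [Algebra O A] (D : QuadDatum O A)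
variable (R : Type uR) [CommRing R] [Algebra O R] (m : ℕ)

/-- The underlying module `N_{std,2}^m ⊕ (R ⊗ A) e_n` of the standard module; the `i`-th pair
`(a, b)` stands for `a e₁ + b e₂` in the `i`-th copy of `N_{std,2}`. -/
abbrev StdCarrier (O : Type uO) (A : Type uA) [CommRing O] [CommRing A] [Algebra O A]
    (R : Type uR) [CommRing R] [Algebra O R] (m : ℕ) : Type (max uR uA) :=
  (Fin m → (R ⊗[O] A) × (R ⊗[O] A)) × (R ⊗[O] A)

/-- The `R`-bilinear map `(a, b) ↦ conj a * b` on `R ⊗ A`. -/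
noncomputable def sesq : R ⊗[O] A →ₗ[R] R ⊗[O] A →ₗ[R] R ⊗[O] A :=
  (LinearMap.mul R (R ⊗[O] A)).comp (D.conjR R).toLinearMap

/-- The bilinear form with `q_{std}(x) = stdBilin x x`. -/
noncomputable def stdBilin : LinearMap.BilinMap R (StdCarrier O A R m) R :=
  LinearMap.mk₂ R
    (fun x y => ∑ i, D.coord R 1 ((1 ⊗ₜ[O] D.π) * sesq D R (x.1 i).1 (y.1 i).2)
      + D.coord R 0 (sesq D R x.2 y.2))
    (fun x x' y => by
      simp only [Prod.fst_add, Prod.snd_add, Pi.add_apply, map_add, LinearMap.add_apply, mul_add,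
        Finset.sum_add_distrib]
      ring)
    (fun c x y => by
      simp only [Prod.smul_fst, Prod.smul_snd, Pi.smul_apply, map_smul, LinearMap.smul_apply,
        mul_smul_comm, smul_add, Finset.smul_sum])
    (fun x y y' => by
      simp only [Prod.fst_add, Prod.snd_add, Pi.add_apply, map_add, mul_add,
        Finset.sum_add_distrib]
      ring)
    (fun c x y => by
      simp only [Prod.smul_fst, Prod.smul_snd, Pi.smul_apply, map_smul,
        mul_smul_comm, smul_add, Finset.smul_sum])

/-- The form `φ_{std}`: the orthogonal sum of `m` copies of `φ_{std,2}`, for which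
`φ(a e₁ + b e₂, a' e₁ + b' e₂) = φ(e₁, conj a b' e₂) + φ(e₁, conj(ratio a') b e₂)`
with `φ(e₁, e₂) = 0` and `φ(e₁, π e₂) = 1`, and of `φ_{std,1}`, for which
`φ(a e, a' e) = φ(e, conj a a' e)` with `φ(e, e) = t / π₀` and `φ(e, π e) = 2`. -/
noncomputable def stdφ : LinearMap.BilinMap R (StdCarrier O A R m) R :=
  LinearMap.mk₂ R
    (fun x y => ∑ i, (D.coord R 1 (sesq D R (x.1 i).1 (y.1 i).2)
        + D.coord R 1 (sesq D R ((1 ⊗ₜ[O] D.ratio) * (y.1 i).1) (x.1 i).2))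
      + (algebraMap O R D.τ * D.coord R 0 (sesq D R x.2 y.2)
        + 2 * D.coord R 1 (sesq D R x.2 y.2)))
    (fun x x' y => by
      simp only [Prod.fst_add, Prod.snd_add, Pi.add_apply, map_add, LinearMap.add_apply, mul_add,
        Finset.sum_add_distrib]
      ring)
    (fun c x y => by
      simp only [Prod.smul_fst, Prod.smul_snd, Pi.smul_apply, map_smul, LinearMap.smul_apply,
        mul_smul_comm, smul_add, Finset.smul_sum])
    (fun x y y' => by
      simp only [Prod.fst_add, Prod.snd_add, Pi.add_apply, map_add, LinearMap.add_apply, mul_add,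
        Finset.sum_add_distrib]
      ring)
    (fun c x y => by
      simp only [Prod.smul_fst, Prod.smul_snd, Pi.smul_apply, map_smul, LinearMap.smul_apply,
        mul_smul_comm, smul_add, Finset.smul_sum])

/-- The standard module `(N_{std,n}, q_{std,n}, R, φ_{std,n})` for `n = 2 m + 1`. Its quadratic form
is the orthogonal sum of `m` copies of `q_{std,2}(a e₁ + b e₂) = φ(e₁, π conj a b e₂)` and of
`q_{std,1}(a e) = N(a)`. -/
noncomputable def stdModule : FormModule.{uO, uA, uR, max uR uA, uR} O A R where
  M := StdCarrier O A R m
  L := R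
  q := (stdBilin D R m).toQuadraticMap
  φ := stdφ D R m

end Standard

end HermQuad

namespace HermQuad

/-- `p` is a uniformizer of the discrete valuation ring `B`: it is nonzero and generates the ideal
of non-units. -/
def IsUniformizer {B : Type*} [CommRing B] (p : B) : Prop :=
  p ≠ 0 ∧ ∀ x : B, p ∣ x ↔ ¬ IsUnit x

section LocalField

universe u v w

variable (F₀ : Type u) (F : Type v) [Field F₀] [Field F] [Algebra ℤ_[2] F₀] [Algebra F₀ F]

/-- The ring of integers of a finite extension `F₀` of `ℚ₂`. -/
noncomputable abbrev IntBase : Subalgebra ℤ_[2] F₀ := integralClosure ℤ_[2] F₀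

/-- The ring of integers of a finite extension `F` of `F₀`, as an algebra over that of `F₀`. -/
noncomputable abbrev IntExt : Subalgebra (IntBase F₀) F := integralClosure (IntBase F₀) F

/-- The choice of uniformizers `π` of `F` and `π₀` of `F₀` for a ramified quadratic extension `F` of
a finite extension `F₀` of `ℚ₂` with nontrivial automorphism `σ`, so that `π² - t π + π₀ = 0` where
`t = π + σ π`. Either `t = 0` (type R-P), or `π₀ ∣ t ∣ 2` (type R-U; then `F = F₀(√θ)` with the unit
`θ = 1 - 4 π₀ / t²` and `√θ = 1 - 2 π / t`). -/
structure UniformizerDatum where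
  σ : F ≃ₐ[F₀] F
  σ_ne_one : σ ≠ 1
  π : IntExt F₀ F
  π₀ : IntBase F₀
  t : IntBase F₀
  isUniformizer_π : IsUniformizer π
  isUniformizer_π₀ : IsUniformizer π₀
  add_conj : (π : F) + σ π = algebraMap (IntBase F₀) F t
  mul_conj : (π : F) * σ π = algebraMap (IntBase F₀) F π₀
  type : t = 0 ∨ (π₀ ∣ t ∧ t ∣ 2)

namespace UniformizerDatum

variable {F₀ F} (U : UniformizerDatum F₀ F)

theorem π₀_dvd_t : U.π₀ ∣ U.t := by
  rcases U.type with h | h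
  · rw [h]; exact dvd_zero _
  · exact h.1

/-- The quotient `t / π₀`. -/
noncomputable def τ : IntBase F₀ := Classical.choose U.π₀_dvd_t

theorem t_eq : U.t = U.π₀ * U.τ := Classical.choose_spec U.π₀_dvd_t

/-- The conjugation of the ring of integers of `F`. -/
noncomputable def conj : IntExt F₀ F ≃ₐ[IntBase F₀] IntExt F₀ F :=
  (U.σ.restrictScalars (IntBase F₀)).mapIntegralClosure

theorem coe_conj (x : IntExt F₀ F) : (U.conj x : F) = U.σ x := rfl

theorem add_conj' : U.π + U.conj U.π = algebraMap (IntBase F₀) (IntExt F₀ F) U.t :=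
  Subtype.ext U.add_conj

theorem mul_conj' : U.π * U.conj U.π = algebraMap (IntBase F₀) (IntExt F₀ F) U.π₀ :=
  Subtype.ext U.mul_conj

/-- An element of `F₀` that is integral over the ring of integers belongs to it. -/
theorem exists_int_of_isIntegral (x : F₀) (hx : IsIntegral (IntBase F₀) (algebraMap F₀ F x)) :
    ∃ n : IntBase F₀, (n : F₀) = x := by
  have h1 : IsIntegral (IntBase F₀) x :=
    (isIntegral_algebraMap_iff (algebraMap F₀ F).injective).1 hx
  have h2 : IsIntegral ℤ_[2] x := isIntegral_trans (R := ℤ_[2]) (A := IntBase F₀) x h1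
  exact ⟨⟨x, h2⟩, rfl⟩

theorem π₀_dvd_of_dvd_mul_self {a : IntBase F₀} (h : U.π₀ ∣ a * a) : U.π₀ ∣ a := by
  rw [U.isUniformizer_π₀.2] at h ⊢
  exact fun ha => h (ha.mul ha)

theorem π_not_mem (x : F₀) : algebraMap F₀ F x ≠ U.π := by
  intro hx
  obtain ⟨n, rfl⟩ := exists_int_of_isIntegral (F := F) x (by rw [hx]; exact U.π.2)
  have h := U.mul_conj
  rw [← hx, AlgEquiv.commutes, ← map_mul] at h
  have h' : n * n = U.π₀ := by
    apply Subtype.ext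
    exact (algebraMap F₀ F).injective h
  obtain ⟨s, rfl⟩ := U.π₀_dvd_of_dvd_mul_self (Dvd.intro_left 1 (by rw [one_mul, h']))
  have h2 : U.π₀ * (U.π₀ * (s * s)) = U.π₀ * 1 := by rw [mul_one]; nth_rewrite 3 [← h']; ring
  have h3 := mul_left_cancel₀ U.isUniformizer_π₀.1 h2
  exact (U.isUniformizer_π₀.2 U.π₀).1 dvd_rfl (IsUnit.of_mul_eq_one _ h3)

theorem exists_field_coords (hF : Module.finrank F₀ F = 2) (x : F) :
    ∃ a b : F₀, x = algebraMap F₀ F a + algebraMap F₀ F b * U.π := by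
  have hli : LinearIndependent F₀ ![(1 : F), (U.π : F)] := by
    rw [LinearIndependent.pair_iff]
    intro a b hab
    rw [Algebra.smul_def, Algebra.smul_def, mul_one] at hab
    by_cases hb : b = 0
    · subst hb
      simpa using hab
    · exfalso
      apply U.π_not_mem (-a / b)
      have : algebraMap F₀ F b ≠ 0 := by simpa using hb
      rw [map_div₀, map_neg, div_eq_iff this]
      linear_combination -hab
  have hspan := hli.span_eq_top_of_card_eq_finrank (by simp [hF])
  have hx : x ∈ Submodule.span F₀ (Set.range ![(1 : F), (U.π : F)]) := by rw [hspan]; trivial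
  rw [Matrix.range_cons, Matrix.range_cons, Matrix.range_empty, Set.union_empty,
    Set.singleton_union, Submodule.mem_span_pair] at hx
  obtain ⟨a, b, rfl⟩ := hx
  exact ⟨a, b, by rw [Algebra.smul_def, Algebra.smul_def, mul_one]⟩

/-- `x` has integral coordinates with respect to `1, π`. -/
def HasCoords (x : IntExt F₀ F) : Prop :=
  ∃ a b : IntBase F₀, x = algebraMap _ (IntExt F₀ F) a + algebraMap _ (IntExt F₀ F) b * U.π

theorem hasCoords_of_π₀_mul (y : IntExt F₀ F)
    (h : U.HasCoords (algebraMap _ (IntExt F₀ F) U.π₀ * y)) : U.HasCoords y := by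
  obtain ⟨a, b, hab⟩ := h
  have h0 : (algebraMap (IntBase F₀) (IntExt F₀ F) U.π₀) ≠ 0 := by
    intro h0
    apply U.isUniformizer_π₀.1
    apply Subtype.ext
    exact (algebraMap F₀ F).injective (by simpa using congrArg Subtype.val h0)
  have hinj : Function.Injective (algebraMap (IntBase F₀) (IntExt F₀ F)) := by
    intro x y hxy
    exact Subtype.ext ((algebraMap F₀ F).injective (congrArg Subtype.val hxy))
  have hconj : algebraMap _ (IntExt F₀ F) U.π₀ * U.conj y
      = algebraMap _ (IntExt F₀ F) a + algebraMap _ (IntExt F₀ F) b * U.conj U.π := by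
    have := congrArg U.conj hab
    simpa using this
  have hnorm : algebraMap _ (IntExt F₀ F) (U.π₀ * U.π₀) * (y * U.conj y)
      = algebraMap _ (IntExt F₀ F) (a * a + a * b * U.t + b * b * U.π₀) := by
    simp only [map_add, map_mul]
    linear_combination hconj * (algebraMap _ (IntExt F₀ F) U.π₀ * y)
      + (algebraMap _ (IntExt F₀ F) a + algebraMap _ (IntExt F₀ F) b * U.conj U.π) * hab
      + (algebraMap _ (IntExt F₀ F) a) * (algebraMap _ (IntExt F₀ F) b) * U.add_conj'
      + (algebraMap _ (IntExt F₀ F) b) * (algebraMap _ (IntExt F₀ F) b) * U.mul_conj'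
  obtain ⟨n, hn⟩ : ∃ n : IntBase F₀,
      U.π₀ * U.π₀ * n = a * a + a * b * U.t + b * b * U.π₀ := by
    have hπ : (U.π₀ : F₀) ≠ 0 := fun h => U.isUniformizer_π₀.1 (Subtype.ext h)
    have hπ' : algebraMap F₀ F (U.π₀ : F₀) ≠ 0 := by simpa using hπ
    obtain ⟨n, hn⟩ := exists_int_of_isIntegral (F := F)
      (((a * a + a * b * U.t + b * b * U.π₀ : IntBase F₀) : F₀) / ((U.π₀ : F₀) * U.π₀)) (by
        have : algebraMap F₀ F
            (((a * a + a * b * U.t + b * b * U.π₀ : IntBase F₀) : F₀) / ((U.π₀ : F₀) * U.π₀))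
            = ((y * U.conj y : IntExt F₀ F) : F) := by
          have h1 := congrArg Subtype.val hnorm
          rw [map_div₀, map_mul, div_eq_iff (mul_ne_zero hπ' hπ'), ← map_mul]
          exact h1.symm.trans (mul_comm _ _)
        rw [this]
        exact (y * U.conj y).2)
    refine ⟨n, Subtype.ext ?_⟩
    rw [eq_div_iff (mul_ne_zero hπ hπ)] at hn
    rw [← hn]
    push_cast
    ring
  rw [U.t_eq] at hn
  obtain ⟨a', rfl⟩ : U.π₀ ∣ a := U.π₀_dvd_of_dvd_mul_self
    ⟨U.π₀ * n - a * b * U.τ - b * b, by linear_combination -hn⟩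
  have hn' : U.π₀ * (b * b) = U.π₀ * (U.π₀ * (n - a' * a' - a' * b * U.τ)) := by
    linear_combination -hn
  obtain ⟨b', rfl⟩ : U.π₀ ∣ b := U.π₀_dvd_of_dvd_mul_self
    ⟨_, mul_left_cancel₀ U.isUniformizer_π₀.1 hn'⟩
  refine ⟨a', b', mul_left_cancel₀ h0 ?_⟩
  rw [hab]
  simp only [map_mul]
  ring

variable [Algebra ℚ_[2] F₀] [IsScalarTower ℤ_[2] ℚ_[2] F₀] [FiniteDimensional ℚ_[2] F₀]

theorem hasCoords (hF : Module.finrank F₀ F = 2) (x : IntExt F₀ F) : U.HasCoords x := by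
  classical
  have : IsNoetherianRing (IntBase F₀) := integralClosure.isNoetherianRing (K := ℚ_[2]) F₀
  have : IsFractionRing (IntBase F₀) F₀ :=
    integralClosure.isFractionRing_of_finite_extension (A := ℤ_[2]) ℚ_[2] F₀
  obtain ⟨a, b, hab⟩ := U.exists_field_coords hF x
  obtain ⟨⟨d, hd⟩, hd'⟩ := IsLocalization.exist_integer_multiples_of_finset
    (nonZeroDivisors (IntBase F₀)) ({a, b} : Finset F₀)
  obtain ⟨a', ha'⟩ := hd' a (by simp)
  obtain ⟨b', hb'⟩ := hd' b (by simp)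
  have hdx : U.HasCoords (algebraMap _ (IntExt F₀ F) d * x) := by
    refine ⟨a', b', Subtype.ext ?_⟩
    have ha2 : algebraMap F₀ F (a' : F₀) = algebraMap F₀ F (d : F₀) * algebraMap F₀ F a := by
      rw [← map_mul]; exact congrArg (algebraMap F₀ F) ha'
    have hb2 : algebraMap F₀ F (b' : F₀) = algebraMap F₀ F (d : F₀) * algebraMap F₀ F b := by
      rw [← map_mul]; exact congrArg (algebraMap F₀ F) hb'
    change algebraMap F₀ F (d : F₀) * (x : F)
      = algebraMap F₀ F (a' : F₀) + algebraMap F₀ F (b' : F₀) * (U.π : F)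
    rw [hab, ha2, hb2]
    ring
  have key : ∀ d : IntBase F₀, d ≠ 0 → ∀ x : IntExt F₀ F,
      U.HasCoords (algebraMap _ (IntExt F₀ F) d * x) → U.HasCoords x := by
    intro d
    induction d using (wellFounded_dvdNotUnit (α := IntBase F₀)).induction with
    | _ d ih =>
      intro hd x hx
      by_cases hu : IsUnit d
      · obtain ⟨c, hc⟩ := hu.exists_left_inv
        obtain ⟨a, b, hab⟩ := hx
        refine ⟨c * a, c * b, ?_⟩
        have hc' := congrArg (algebraMap (IntBase F₀) (IntExt F₀ F)) hc
        simp only [map_mul, map_one] at hc' ⊢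
        linear_combination (algebraMap _ (IntExt F₀ F) c) * hab - x * hc'
      · obtain ⟨d', rfl⟩ := (U.isUniformizer_π₀.2 d).2 hu
        have hd0 : d' ≠ 0 := right_ne_zero_of_mul hd
        refine ih d' ⟨hd0, U.π₀, (U.isUniformizer_π₀.2 _).1 dvd_rfl, mul_comm _ _⟩ hd0 x
          (U.hasCoords_of_π₀_mul _ ?_)
        rwa [map_mul, mul_assoc] at hx
  exact key d (nonZeroDivisors.ne_zero hd) x hdx

end UniformizerDatum

end LocalField

end HermQuad

namespace HermQuad

section LocalField

universe u v w

variable {F₀ : Type u} {F : Type v} [Field F₀] [Field F] [Algebra ℤ_[2] F₀] [Algebra F₀ F]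

namespace UniformizerDatum

variable (U : UniformizerDatum F₀ F)

theorem algebraMap_int_injective :
    Function.Injective (algebraMap (IntBase F₀) (IntExt F₀ F)) := fun _ _ hxy =>
  Subtype.ext ((algebraMap F₀ F).injective (congrArg Subtype.val hxy))

theorem π_ne_zero : (U.π : F) ≠ 0 := fun h => U.isUniformizer_π.1 (Subtype.ext h)

theorem linearIndependent_int : LinearIndependent (IntBase F₀) ![(1 : IntExt F₀ F), U.π] := by
  rw [LinearIndependent.pair_iff]
  intro a b hab
  have hab' : algebraMap F₀ F (a : F₀) + algebraMap F₀ F (b : F₀) * (U.π : F) = 0 := by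
    rw [Algebra.smul_def, Algebra.smul_def, mul_one] at hab
    exact congrArg Subtype.val hab
  have hb : (b : F₀) = 0 := by
    by_contra hb
    apply U.π_not_mem (-a / b)
    have : algebraMap F₀ F (b : F₀) ≠ 0 := by simpa using hb
    rw [map_div₀, map_neg, div_eq_iff this]
    linear_combination -hab'
  have ha : (a : F₀) = 0 := by
    rw [hb, map_zero, zero_mul, add_zero] at hab'
    exact (map_eq_zero _).1 hab'
  exact ⟨Subtype.ext ha, Subtype.ext hb⟩

/-- The constant `ε`: it is `2` in the case (R-P) and `t` in the case (R-U). -/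
noncomputable def ε : F₀ :=
  open Classical in if U.t = 0 then 2 else (U.t : F₀)

/-- The constant `λ`: it is `1 / 2` in the case (R-P) and `σ π / t` in the case (R-U). -/
noncomputable def lam : F :=
  open Classical in if U.t = 0 then 1 / 2 else U.σ U.π / algebraMap (IntBase F₀) F U.t

/-- The coefficient of the `i`-th generator of `Λ₀`, `i = 0, …, 2 m`. -/
noncomputable def coeff (m : ℕ) (i : Fin (2 * m + 1)) : F := if (i : ℕ) ≤ m then 1 else U.lam

/-- The invertible module `ε⁻¹ O` over the ring of integers `O` of `F₀`. -/
noncomputable abbrev lineL : Submodule (IntBase F₀) F₀ := Submodule.span (IntBase F₀) {U.ε⁻¹}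

theorem conj_mem {x : F} (hx : x ∈ IntExt F₀ F) : U.σ x ∈ IntExt F₀ F := (U.conj ⟨x, hx⟩).2

variable [Algebra ℚ_[2] F₀] [IsScalarTower ℤ_[2] ℚ_[2] F₀] [FiniteDimensional ℚ_[2] F₀]

/-- The basis `1, π` of the ring of integers of `F` over that of `F₀`. -/
noncomputable def intBasis (hF : Module.finrank F₀ F = 2) :
    Module.Basis (Fin 2) (IntBase F₀) (IntExt F₀ F) :=
  Module.Basis.mk U.linearIndependent_int (by
    rintro x -
    obtain ⟨a, b, rfl⟩ := U.hasCoords hF x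
    rw [Matrix.range_cons, Matrix.range_cons, Matrix.range_empty, Set.union_empty,
      Set.singleton_union, Submodule.mem_span_pair]
    exact ⟨a, b, by rw [Algebra.smul_def, Algebra.smul_def, mul_one]⟩)

/-- The extension of rings of integers of `F / F₀` together with `π`, `π₀` and the conjugation. -/
noncomputable def toQuadDatum (hF : Module.finrank F₀ F = 2) :
    QuadDatum (IntBase F₀) (IntExt F₀ F) where
  conj := U.conj
  π := U.π
  π₀ := U.π₀
  τ := U.τ
  basis := U.intBasis hF
  basis_zero := by simp [intBasis]
  basis_one := by simp [intBasis]
  add_conj := by rw [← U.t_eq, U.add_conj']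
  mul_conj := U.mul_conj'


end UniformizerDatum
end LocalField
end HermQuad

namespace HermQuad

theorem two_ne_zero_ext (F₀ : Type*) (F : Type*) [Field F₀] [Field F] [Algebra ℚ_[2] F₀]
    [Algebra F₀ F] : (2 : F) ≠ 0 := by
  have h : (2 : F₀) ≠ 0 := by
    have := (map_ne_zero (algebraMap ℚ_[2] F₀)).2 (two_ne_zero : (2 : ℚ_[2]) ≠ 0)
    rwa [map_ofNat] at this
  have := (map_ne_zero (algebraMap F₀ F)).2 h
  rwa [map_ofNat] at this

section LocalField

universe u v w

variable {F₀ : Type u} {F : Type v} [Field F₀] [Field F] [Algebra ℤ_[2] F₀] [Algebra F₀ F]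

namespace UniformizerDatum

variable (U : UniformizerDatum F₀ F)

theorem algebraMap_trace (hF : Module.finrank F₀ F = 2) (z : F) :
    algebraMap F₀ F (Algebra.trace F₀ F z) = z + U.σ z := by
  classical
  have hfd : FiniteDimensional F₀ F := Module.finite_of_finrank_pos (by omega)
  have hle : Fintype.card (F ≃ₐ[F₀] F) ≤ 2 := hF ▸ AlgEquiv.card_le
  have hpair : ({1, U.σ} : Finset (F ≃ₐ[F₀] F)).card = 2 := Finset.card_pair U.σ_ne_one.symm
  have huniv : ({1, U.σ} : Finset (F ≃ₐ[F₀] F)) = Finset.univ :=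
    (Finset.card_eq_iff_eq_univ _).1
      (le_antisymm (Finset.card_le_univ _) (by rw [hpair]; exact hle))
  have hgal : IsGalois F₀ F := IsGalois.of_card_aut_eq_finrank F₀ F (by
    rw [Nat.card_eq_fintype_card, hF, ← hpair, huniv, Finset.card_univ])
  rw [trace_eq_sum_automorphisms, ← huniv, Finset.sum_pair U.σ_ne_one.symm]
  rfl

theorem σ_π : U.σ U.π = algebraMap (IntBase F₀) F U.t - U.π := by
  rw [← U.add_conj]; ring

theorem σ_σ (hF : Module.finrank F₀ F = 2) (z : F) : U.σ (U.σ z) = z := by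
  have h1 := U.algebraMap_trace hF z
  have h2 := congrArg U.σ h1
  rw [AlgEquiv.commutes, h1, map_add] at h2
  linear_combination -h2

theorem σ_int (n : IntBase F₀) : U.σ (algebraMap (IntBase F₀) F n) = algebraMap (IntBase F₀) F n :=
  U.σ.commutes (n : F₀)

/-- The trace of every integral multiple of `w` is integral. -/
def Good (w : F) : Prop := ∀ a ∈ IntExt F₀ F, a * w + U.σ (a * w) ∈ IntExt F₀ F

variable {U}

theorem Good.add {w w' : F} (h : U.Good w) (h' : U.Good w') : U.Good (w + w') := by
  intro a ha
  have := add_mem (h a ha) (h' a ha)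
  rw [mul_add, map_add]
  convert this using 1
  ring

theorem Good.mul {w a : F} (h : U.Good w) (ha : a ∈ IntExt F₀ F) : U.Good (a * w) := by
  intro b hb
  have := h (b * a) (mul_mem hb ha)
  rwa [mul_assoc] at this

theorem Good.neg {w : F} (h : U.Good w) : U.Good (-w) := by
  have := h.mul (neg_mem (one_mem (IntExt F₀ F)))
  simpa using this

theorem good_zero : U.Good 0 := by
  intro a _
  simp

variable (U)

theorem σπ_ne_zero : U.σ U.π ≠ 0 := (map_ne_zero U.σ).2 U.π_ne_zero

theorem π₀_ne_zero_F : algebraMap (IntBase F₀) F U.π₀ ≠ 0 := by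
  rw [← U.mul_conj]; exact mul_ne_zero U.π_ne_zero U.σπ_ne_zero

theorem t_ne_zero_F (ht : U.t ≠ 0) : algebraMap (IntBase F₀) F U.t ≠ 0 := by
  intro h
  exact ht (Subtype.ext ((algebraMap F₀ F).injective (h.trans (map_zero _).symm)))

theorem τ_mem : algebraMap (IntBase F₀) F U.τ ∈ IntExt F₀ F := Subalgebra.algebraMap_mem _ _

/-- A split hermitian space: `h` is linear in the first and `σ`-linear in the second variable and
`e₀, …, e_{2m}` is a basis with `h (eᵢ, eⱼ) = δ_{i, 2m - j}`. -/
structure SplitHermitianSpace (U : UniformizerDatum F₀ F) (m : ℕ) (V : Type w) [AddCommGroup V]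
    [Module F V] where
  h : V →ₗ[F] V →ₛₗ[(U.σ : F →+* F)] F
  h_conj : ∀ x y, h y x = U.σ (h x y)
  e : Module.Basis (Fin (2 * m + 1)) F V
  h_e : ∀ i j, h (e i) (e j) = if j = Fin.rev i then 1 else 0

namespace SplitHermitianSpace

variable {U} {m : ℕ} {V : Type w} [AddCommGroup V] [Module F V] (W : U.SplitHermitianSpace m V)

/-- The lattice `Λ₀` with generators `e₁, …, e_{m+1}, λ e_{m+2}, …, λ e_n`, `n = 2 m + 1`. -/
noncomputable def lattice : Submodule (IntExt F₀ F) V :=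
  Submodule.span (IntExt F₀ F) (Set.range fun i => U.coeff m i • W.e i)

/-- The form `φ(x, y) = ε⁻¹ Tr h(x, π⁻¹ y)` on `V`. -/
noncomputable def φV (x y : V) : F₀ :=
  U.ε⁻¹ * Algebra.trace F₀ F (W.h x ((U.π : F)⁻¹ • y))

/-- The quadratic form `q(x) = (1 / 2) ε⁻¹ Tr h(x, x)` on `V`. -/
noncomputable def qV (x : V) : F₀ := 1 / 2 * (U.ε⁻¹ * Algebra.trace F₀ F (W.h x x))

theorem h_smul_left (a : F) (x y : V) : W.h (a • x) y = a * W.h x y := by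
  rw [map_smul]; rfl

theorem h_smul_right (a : F) (x y : V) : W.h x (a • y) = U.σ a * W.h x y := by
  rw [LinearMap.map_smulₛₗ]; rfl

theorem mem_lineL {x : F₀} (hx : algebraMap F₀ F x ∈ IntExt F₀ F) : U.ε⁻¹ * x ∈ U.lineL := by
  obtain ⟨n, rfl⟩ := exists_int_of_isIntegral (F := F) x hx
  exact Submodule.mem_span_singleton.2 ⟨n, mul_comm _ _⟩

end SplitHermitianSpace

variable [Algebra ℚ_[2] F₀] [IsScalarTower ℤ_[2] ℚ_[2] F₀] [FiniteDimensional ℚ_[2] F₀]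

theorem good_of (hF : Module.finrank F₀ F = 2) {w : F} (h0 : w + U.σ w ∈ IntExt F₀ F)
    (h1 : U.π * w + U.σ (U.π * w) ∈ IntExt F₀ F) : U.Good w := by
  intro x hx
  obtain ⟨a, b, hab⟩ := U.hasCoords hF ⟨x, hx⟩
  have hab' : x = algebraMap (IntBase F₀) F a + algebraMap (IntBase F₀) F b * U.π :=
    congrArg Subtype.val hab
  have ha : algebraMap (IntBase F₀) F a ∈ IntExt F₀ F := Subalgebra.algebraMap_mem _ _
  have hb : algebraMap (IntBase F₀) F b ∈ IntExt F₀ F := Subalgebra.algebraMap_mem _ _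
  have := add_mem (mul_mem ha h0) (mul_mem hb h1)
  convert this using 1
  rw [hab']
  simp only [map_add, map_mul, U.σ_int]
  ring

theorem good_inv_σπ (hF : Module.finrank F₀ F = 2) : U.Good (U.σ U.π)⁻¹ := by
  have hp := U.π₀_ne_zero_F
  have h1 : (U.σ U.π)⁻¹ = U.π / algebraMap (IntBase F₀) F U.π₀ := by
    rw [← U.mul_conj]; field_simp [U.π_ne_zero, U.σπ_ne_zero]
  have ht : algebraMap (IntBase F₀) F U.t
      = algebraMap (IntBase F₀) F U.π₀ * algebraMap (IntBase F₀) F U.τ := by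
    rw [← map_mul, ← U.t_eq]
  have hm := U.mul_conj
  have ha := U.add_conj
  apply U.good_of hF
  · convert U.τ_mem using 1
    rw [h1, map_div₀, U.σ_int, ← add_div, ha, ht]
    field_simp
  · have h2 : algebraMap (IntBase F₀) F (U.t * U.τ - 2) ∈ IntExt F₀ F :=
      Subalgebra.algebraMap_mem _ _
    convert h2 using 1
    rw [h1, map_mul, map_div₀, U.σ_int, map_sub, map_mul, map_ofNat]
    field_simp
    linear_combination (↑U.π + U.σ ↑U.π + algebraMap (IntBase F₀) F U.t) * ha - 2 * hm
      + algebraMap (IntBase F₀) F U.t * ht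

theorem good_inv_t (hF : Module.finrank F₀ F = 2) (ht : U.t ≠ 0) :
    U.Good (algebraMap (IntBase F₀) F U.t)⁻¹ := by
  have ht' := U.t_ne_zero_F ht
  obtain ⟨k, hk⟩ := (U.type.resolve_left ht).2
  have hk' : (2 : F) = algebraMap (IntBase F₀) F U.t * algebraMap (IntBase F₀) F k := by
    rw [← map_mul, ← hk, map_ofNat]
  apply U.good_of hF
  · have h2 : algebraMap (IntBase F₀) F k ∈ IntExt F₀ F := Subalgebra.algebraMap_mem _ _
    convert h2 using 1
    rw [map_inv₀, U.σ_int]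
    field_simp
    linear_combination hk'
  · convert one_mem (IntExt F₀ F) using 1
    rw [map_mul, map_inv₀, U.σ_int, ← add_mul, U.add_conj, mul_inv_cancel₀ ht']

theorem good_lam (hF : Module.finrank F₀ F = 2) : U.Good (U.lam * (U.σ U.π)⁻¹) := by
  by_cases ht : U.t = 0
  · have h2 := two_ne_zero_ext F₀ F
    have hp := U.σπ_ne_zero
    have hσ : U.σ U.π = - U.π := by rw [U.σ_π, ht, map_zero, zero_sub]
    have hσ2 : U.σ (U.σ U.π) = U.π := by rw [hσ, map_neg, hσ, neg_neg]
    have hp0 := U.π_ne_zero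
    rw [lam, if_pos ht]
    apply U.good_of hF
    · convert zero_mem (IntExt F₀ F) using 1
      rw [map_mul, map_div₀, map_one, map_ofNat, map_inv₀, hσ2, hσ]
      field_simp
      ring
    · convert neg_mem (one_mem (IntExt F₀ F)) using 1
      rw [map_mul, map_mul, map_div₀, map_one, map_ofNat, map_inv₀, hσ2, hσ]
      field_simp
      norm_num
  · have := U.good_inv_t hF ht
    rw [lam, if_neg ht]
    convert this using 1
    field_simp [U.σπ_ne_zero, U.t_ne_zero_F ht]

theorem good_σ_lam (hF : Module.finrank F₀ F = 2) : U.Good (U.σ U.lam * (U.σ U.π)⁻¹) := by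
  by_cases ht : U.t = 0
  · have := U.good_lam hF
    rw [lam, if_pos ht] at this ⊢
    rwa [map_div₀, map_one, map_ofNat]
  · have h := (U.good_inv_σπ hF).add (U.good_inv_t hF ht).neg
    rw [lam, if_neg ht]
    convert h using 1
    have ht' := U.t_ne_zero_F ht
    rw [map_div₀, U.σ_int, U.σ_σ hF]
    field_simp [U.σπ_ne_zero]
    linear_combination U.add_conj

namespace SplitHermitianSpace

variable {U} {m : ℕ} {V : Type w} [AddCommGroup V] [Module F V] (W : U.SplitHermitianSpace m V)

theorem good_coeff (hF : Module.finrank F₀ F = 2) (i j : Fin (2 * m + 1)) :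
    U.Good (W.h (U.coeff m i • W.e i) ((U.π : F)⁻¹ • (U.coeff m j • W.e j))) := by
  rw [h_smul_left, h_smul_right, h_smul_right, W.h_e]
  split_ifs with hij
  · have hv : (j : ℕ) = 2 * m - i := by rw [hij, Fin.val_rev]; omega
    rw [map_inv₀, mul_one]
    by_cases hi : (i : ℕ) ≤ m <;> by_cases hj : (j : ℕ) ≤ m
    · simpa [coeff, hi, hj] using U.good_inv_σπ hF
    · have := U.good_σ_lam hF
      rw [mul_comm] at this
      simpa [coeff, hi, hj] using this
    · simpa [coeff, hi, hj] using U.good_lam hF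
    · omega
  · simpa using good_zero

theorem good_h (hF : Module.finrank F₀ F = 2) {x y : V} (hx : x ∈ W.lattice)
    (hy : y ∈ W.lattice) : U.Good (W.h x ((U.π : F)⁻¹ • y)) := by
  induction hx using Submodule.span_induction with
  | mem x hx =>
    obtain ⟨i, rfl⟩ := hx
    induction hy using Submodule.span_induction with
    | mem y hy =>
      obtain ⟨j, rfl⟩ := hy
      exact W.good_coeff hF i j
    | zero => simpa using good_zero
    | add y y' _ _ h h' =>
      rw [smul_add, map_add]
      exact h.add h'
    | smul a y _ h =>
      rw [show a • y = (a : F) • y from rfl, smul_comm, h_smul_right]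
      exact h.mul (U.conj_mem a.2)
  | zero => simpa using good_zero
  | add x x' _ _ h h' =>
    rw [map_add, LinearMap.add_apply]
    exact h.add h'
  | smul a x _ h =>
    rw [show a • x = (a : F) • x from rfl, h_smul_left]
    exact h.mul a.2

theorem h_self_mem (hF : Module.finrank F₀ F = 2) {x : V} (hx : x ∈ W.lattice) :
    W.h x x ∈ IntExt F₀ F := by
  induction hx using Submodule.span_induction with
  | mem x hx =>
    obtain ⟨i, rfl⟩ := hx
    rw [h_smul_left, h_smul_right, W.h_e]
    split_ifs with hi
    · have hv : (i : ℕ) = 2 * m - i := by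
        have := congrArg Fin.val hi
        rw [Fin.val_rev] at this; omega
      have hm : (i : ℕ) ≤ m := by omega
      simpa [coeff, hm] using one_mem _
    · simpa using zero_mem _
  | zero => simpa using zero_mem _
  | add x y hx hy h h' =>
    have hg := W.good_h hF hx (W.lattice.smul_mem U.π hy) 1 (one_mem _)
    have hy' : (U.π : F)⁻¹ • (U.π • y) = y := by
      rw [show U.π • y = (U.π : F) • y from rfl, smul_smul, inv_mul_cancel₀ U.π_ne_zero, one_smul]
    rw [hy', one_mul, ← W.h_conj] at hg
    have := add_mem (add_mem h h') hg
    convert this using 1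
    simp only [map_add, LinearMap.add_apply]
    ring
  | smul a x _ h =>
    rw [show a • x = (a : F) • x from rfl, h_smul_left, h_smul_right]
    exact mul_mem a.2 (mul_mem (U.conj_mem a.2) h)

theorem φV_mem (hF : Module.finrank F₀ F = 2) {x y : V} (hx : x ∈ W.lattice)
    (hy : y ∈ W.lattice) : W.φV x y ∈ U.lineL := by
  apply mem_lineL (F := F)
  rw [U.algebraMap_trace hF]
  simpa using W.good_h hF hx hy 1 (one_mem _)

theorem qV_mem (hF : Module.finrank F₀ F = 2) {x : V} (hx : x ∈ W.lattice) :
    W.qV x ∈ U.lineL := by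
  have : W.qV x = U.ε⁻¹ * (1 / 2 * Algebra.trace F₀ F (W.h x x)) := by rw [qV]; ring
  rw [this]
  apply mem_lineL (F := F)
  rw [map_mul, U.algebraMap_trace hF, ← W.h_conj]
  convert W.h_self_mem hF hx using 1
  have := two_ne_zero_ext F₀ F
  rw [map_div₀, map_one, map_ofNat]
  field_simp
  ring

end SplitHermitianSpace

end UniformizerDatum
end LocalField
end HermQuad

namespace HermQuad

section LocalField

universe u v w

/-- The structure on an `A`-submodule `Λ` of `V`, regarded as a module over `O ⊗ A = A`, given by
maps `q : V → K` and `φ : V × V → K` with the stated properties that send `Λ` to `L ⊆ K`. -/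
noncomputable def FormModule.ofSubmodule {O : Type u} {A : Type v} [CommRing O] [CommRing A]
    [Algebra O A] {V : Type w} [AddCommGroup V] [Module A V] {K : Type u} [AddCommGroup K]
    [Module O K] (Λ : Submodule A V) (L : Submodule O K) (π : A) (q : V → K) (φ : V → V → K)
    (q_mem : ∀ x ∈ Λ, q x ∈ L) (φ_mem : ∀ x ∈ Λ, ∀ y ∈ Λ, φ x y ∈ L)
    (q_add : ∀ x y, q (x + y) = q x + q y + φ x (π • y))
    (q_smul : ∀ (r : O) (x : V), q (algebraMap O A r • x) = (r * r) • q x)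
    (φ_add_left : ∀ x x' y, φ (x + x') y = φ x y + φ x' y)
    (φ_smul_left : ∀ (r : O) (x y : V), φ (algebraMap O A r • x) y = r • φ x y)
    (φ_add_right : ∀ x y y', φ x (y + y') = φ x y + φ x y')
    (φ_smul_right : ∀ (r : O) (x y : V), φ x (algebraMap O A r • y) = r • φ x y) :
    FormModule O A O :=
  letI : Module O Λ := Module.compHom Λ (algebraMap O A)
  letI : Module (O ⊗[O] A) Λ :=
    Module.compHom Λ (Algebra.TensorProduct.lid O A).toAlgHom.toRingHom
  haveI : IsScalarTower O (O ⊗[O] A) Λ :=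
    ⟨fun r a x => by
      change (Algebra.TensorProduct.lid O A (r • a)) • x
        = algebraMap O A r • (Algebra.TensorProduct.lid O A a) • x
      rw [map_smul, Algebra.smul_def, mul_smul]⟩
  let φΛ : Λ →ₗ[O] Λ →ₗ[O] L :=
    LinearMap.mk₂ O (fun x y => ⟨φ x y, φ_mem x x.2 y y.2⟩)
      (fun x x' y => Subtype.ext (φ_add_left x x' y))
      (fun r x y => Subtype.ext (φ_smul_left r x y))
      (fun x y y' => Subtype.ext (φ_add_right x y y'))
      (fun r x y => Subtype.ext (φ_smul_right r x y))
  { M := Λ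
    L := L
    q :=
      { toFun := fun x => ⟨q x, q_mem x x.2⟩
        toFun_smul := fun r x => Subtype.ext (q_smul r x)
        exists_companion' := ⟨LinearMap.mk₂ O (fun x y => φΛ x (π • y))
          (fun x x' y => by rw [map_add]; rfl) (fun r x y => LinearMap.map_smul₂ φΛ r x (π • y))
          (fun x y y' => by rw [smul_add, map_add])
          (fun r x y => by
            change φΛ x (π • algebraMap O A r • y) = _
            rw [smul_comm]
            exact map_smul (φΛ x) r (π • y)), fun x y => Subtype.ext (q_add x y)⟩ }
    φ := φΛ }

variable {F₀ : Type u} {F : Type v} [Field F₀] [Field F] [Algebra ℤ_[2] F₀] [Algebra F₀ F]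

namespace UniformizerDatum.SplitHermitianSpace

variable {U : UniformizerDatum F₀ F} {m : ℕ} {V : Type w} [AddCommGroup V] [Module F V]
variable (W : U.SplitHermitianSpace m V)

theorem trace_base_mul (r : IntBase F₀) (z : F) :
    Algebra.trace F₀ F (algebraMap (IntBase F₀) F r * z) = r * Algebra.trace F₀ F z := by
  have : algebraMap (IntBase F₀) F r * z = (r : F₀) • z := by
    rw [Algebra.smul_def]; rfl
  rw [this, map_smul, smul_eq_mul]

theorem qV_smul (r : IntBase F₀) (x : V) :
    W.qV (algebraMap (IntBase F₀) F r • x) = (r : F₀) * r * W.qV x := by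
  rw [qV, h_smul_left, h_smul_right, U.σ_int, trace_base_mul, trace_base_mul, qV]
  ring

theorem φV_smul_left (r : IntBase F₀) (x y : V) :
    W.φV (algebraMap (IntBase F₀) F r • x) y = (r : F₀) * W.φV x y := by
  rw [φV, h_smul_left, trace_base_mul, φV]
  ring

theorem φV_smul_right (r : IntBase F₀) (x y : V) :
    W.φV x (algebraMap (IntBase F₀) F r • y) = (r : F₀) * W.φV x y := by
  rw [φV, smul_comm, h_smul_right, U.σ_int, trace_base_mul, φV]
  ring

theorem φV_add_left (x x' y : V) : W.φV (x + x') y = W.φV x y + W.φV x' y := by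
  simp only [φV, map_add, LinearMap.add_apply, mul_add]

theorem φV_add_right (x y y' : V) : W.φV x (y + y') = W.φV x y + W.φV x y' := by
  simp only [φV, map_add, smul_add, mul_add]

variable [Algebra ℚ_[2] F₀] [IsScalarTower ℤ_[2] ℚ_[2] F₀] [FiniteDimensional ℚ_[2] F₀]

theorem qV_add (hF : Module.finrank F₀ F = 2) (x y : V) :
    W.qV (x + y) = W.qV x + W.qV y + W.φV x ((U.π : F) • y) := by
  have h2 : (2 : F₀) ≠ 0 := fun h => two_ne_zero_ext F₀ F (by
    have := congrArg (algebraMap F₀ F) h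
    rwa [map_ofNat, map_zero] at this)
  have ht : Algebra.trace F₀ F (W.h y x) = Algebra.trace F₀ F (W.h x y) := by
    apply (algebraMap F₀ F).injective
    rw [U.algebraMap_trace hF, U.algebraMap_trace hF, W.h_conj x y, U.σ_σ hF, add_comm]
  rw [φV, smul_smul, inv_mul_cancel₀ U.π_ne_zero, one_smul, qV, qV, qV]
  simp only [map_add, LinearMap.add_apply, ht]
  field_simp
  ring

/-- The hermitian quadratic module with `φ` given by `(Λ₀, q, ε⁻¹ O, φ)`. -/
noncomputable def latticeModule (hF : Module.finrank F₀ F = 2) :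
    FormModule (IntBase F₀) (IntExt F₀ F) (IntBase F₀) :=
  FormModule.ofSubmodule W.lattice U.lineL U.π W.qV W.φV
    (fun _ hx => W.qV_mem hF hx) (fun _ hx _ hy => W.φV_mem hF hx hy) (W.qV_add hF) W.qV_smul
    W.φV_add_left W.φV_smul_left W.φV_add_right W.φV_smul_right

end UniformizerDatum.SplitHermitianSpace
end LocalField
end HermQuad

/-!
Étale locally on `R` the module `M` is free and `ℒ` is trivial, and everything turns into matrices
over the quadratic ring `R[ω] = 𝒪_F ⊗ R`, called `Quad` below. A pair `(q, φ)` on the free module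
of rank `d` is given by a matrix `B`: writing `tr z` for the coefficient of `ω` in `ω z`, one has
`q(x) = tr (x* B x)` and `φ(x, y) = im h(x, y)`, where `h` is the sesquilinear form with matrix
`herm B = B - (π̄ / π) B*` (`FormModule.exists_similar_ofMatrix`). A change of basis replaces `B` by
`g* B g`, and `SimBy` is the resulting notion of similarity of matrices.

The Gram determinant of `φ` over `R` is the norm of `det h` (`det_gram_eq_norm`), hence
`c * matDisc B = N(det h)` with `c = (4 π₀ - t²) / π₀` (`c_mul_matDisc`). As `c` need not be regular
in `R`, identities for the divided discriminant `matDisc` are lifted to polynomial rings over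
`𝒪_{F₀}`, where `c` can be cancelled.

The heart of the proof is `exists_simBy_stdMat`, an induction on `m` which splits off one hyperbolic
plane at a time in an étale neighbourhood of a given geometric point.
* Where `π₀ = 0`, so that `2 = 0` as well, some value of `h` off the diagonal must be a unit when
  `m > 0`. Otherwise, after lifting, `h = ω G` with `G` alternating modulo the element `η` with
  `ω η = 1 - π̄ / π`. An alternating determinant of odd size vanishes, so `η ∣ det G`, and
  `N(det h)` is divisible by `c π₀ ^ (2 m)`: the divided discriminant would vanish
  (`matDisc_eq_zero`). On the plane spanned by two vectors with `h(e₀, e₁)` a unit, a root of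
  `x² + x + δ`, which is a separable polynomial because `2 = 0`, gives an isotropic vector
  (`exists_hyp_of_re_ne_zero`).
* Where `π₀ ≠ 0`, both `2` and `c` are invertible; the form can be diagonalized, and a square root
  of `-q(e₀) q(e₁)` gives an isotropic vector (`exists_hyp_of_two_ne_zero`).
* In rank one `φ` is determined by `q`, and the divided discriminant is `q(e)²`, so `q(e)` is a unit
  that is absorbed by the similitude factor.

A basis of a fibre of `M` over `Spec R` spreads out to a neighbourhood (`exists_basis_of_fiber`), so
`M` is similar to the standard module in an étale neighbourhood of every geometric point
(`FormModule.IsTypeLambdaZero.exists_etaleNhd`). The images of these neighbourhoods are open and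
cover `Spec R`; the product of finitely many of them is a faithfully flat étale algebra, over which
similarity is checked factor by factor (`FormModule.HermAxioms.similar_pi`).

For the lattice, `λ` agrees up to a unit of `𝒪_F` with `π / (π - π̄)`
(`UniformizerDatum.exists_hypCoeff_eq`). Hence the vectors `e_i` and `π / (π - π̄) e_{n + 1 - i}`
for `i ≤ m`, together with `e_{m + 1}`, form a basis of `Λ₀`, in which the forms of `Λ₀` are `ε⁻¹`
times those of the standard module. So `Λ₀` is similar to the standard module over `𝒪_{F₀}`
(`UniformizerDatum.SplitHermitianSpace.latticeModule_similar`), and the second claim follows from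
the first by base change.
-/

open scoped TensorProduct

namespace HermQuad

open Matrix
open scoped QuadraticAlgebra

universe uO uA uR uS uT uM uL uM' uL' uM'' uL'' uK u v w

/-! ### The quadratic ring and matrices over it -/

/-- The ring `R[ω]` with `ω² - p τ ω + p = 0`. For `p = π₀` and `p τ = t` it is `𝒪_F ⊗ R`, with `ω`
in the place of `π`; see `QuadDatum.toQuad`. -/
abbrev Quad {O : Type uO} [CommRing O] (p τ : O) (R : Type uR) [CommRing R] [Algebra O R] :
    Type uR :=
  QuadraticAlgebra R (-(algebraMap O R p)) (algebraMap O R (p * τ))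

namespace Quad

variable {O : Type uO} [CommRing O] {p τ : O} {R : Type uR} [CommRing R] [Algebra O R]

/-- The quotient `ω̄ / ω`, given by a formula that makes sense when `ω` is a zero divisor; see
`ratio_mul_omega`. -/
def ratio : Quad p τ R := algebraMap R _ (algebraMap O R τ) * star QuadraticAlgebra.omega - 1

/-- The linear form sending `z` to the coefficient of `ω` in `ω z`, see `im_omega_mul`. Its symmetry
property is `tr_ratio_mul_star`: it takes opposite values at `z` and `(ω̄ / ω) z̄`. -/
def tr : Quad p τ R →ₗ[R] R where
  toFun z := z.re + algebraMap O R (p * τ) * z.im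
  map_add' x y := by simp; ring
  map_smul' r x := by simp; ring

theorem tr_apply (z : Quad p τ R) : tr z = z.re + algebraMap O R (p * τ) * z.im := rfl

theorem im_omega_mul (z : Quad p τ R) : (QuadraticAlgebra.omega * z).im = tr z := by
  simp [tr_apply]

theorem ratio_mul_omega :
    (ratio : Quad p τ R) * QuadraticAlgebra.omega = star QuadraticAlgebra.omega := by
  ext
  · simp [ratio]
  · simp [ratio]; ring

theorem omega_mul_star_omega :
    (QuadraticAlgebra.omega : Quad p τ R) * star QuadraticAlgebra.omega
      = algebraMap R _ (algebraMap O R p) := by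
  ext <;> simp

theorem ratio_mul_star_ratio : (ratio : Quad p τ R) * star ratio = 1 := by
  ext <;> simp [ratio] <;> ring

theorem sub_ratio_mul_star (z : Quad p τ R) :
    z - ratio * star z = algebraMap R _ (tr z) * (1 - ratio) := by
  ext <;> simp [ratio, tr_apply] <;> ring

theorem tr_ratio_mul_star (z : Quad p τ R) : tr (ratio * star z) = - tr z := by
  simp [ratio, tr_apply]; ring

theorem tr_star_mul_mul (x b : Quad p τ R) : tr (star x * b * x) = x.norm * tr b := by
  simp [tr_apply, QuadraticAlgebra.norm_def]; ring

theorem tr_algebraMap_mul (r : R) (z : Quad p τ R) : tr (algebraMap R _ r * z) = r * tr z := by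
  rw [← Algebra.smul_def, map_smul, smul_eq_mul]

theorem tr_algebraMap (r : R) : tr (algebraMap R (Quad p τ R) r) = r := by
  simp [tr_apply]

theorem tr_one : tr (1 : Quad p τ R) = 1 := by
  simp [tr_apply]

theorem norm_one_sub_ratio :
    (1 - ratio : Quad p τ R).norm = algebraMap O R (4 - p * τ * τ) := by
  have h4 : algebraMap O R 4 = 4 := map_ofNat _ 4
  simp [ratio, QuadraticAlgebra.norm_def, h4]; ring

theorem star_algebraMap (r : R) : star (algebraMap R (Quad p τ R) r) = algebraMap R _ r := by
  ext <;> simp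

/-- The map `R[ω] → S[ω]` induced by a ring map `R → S`. -/
def map {S : Type uS} [CommRing S] [Algebra O S] (f : R →ₐ[O] S) : Quad p τ R →+* Quad p τ S where
  toFun z := ⟨f z.re, f z.im⟩
  map_one' := by ext <;> simp
  map_mul' x y := by ext <;> simp
  map_zero' := by ext <;> simp
  map_add' x y := by ext <;> simp

section

variable {S : Type uS} [CommRing S] [Algebra O S] (f : R →ₐ[O] S)

@[simp] theorem re_map (z : Quad p τ R) : (map f z).re = f z.re := rfl

@[simp] theorem im_map (z : Quad p τ R) : (map f z).im = f z.im := rfl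

theorem map_star (z : Quad p τ R) : map f (star z) = star (map f z) := by
  ext <;> simp

theorem map_ratio : map f (ratio : Quad p τ R) = ratio := by
  ext <;> simp [ratio]

theorem map_omega : map f (QuadraticAlgebra.omega : Quad p τ R) = QuadraticAlgebra.omega := by
  ext <;> simp

theorem tr_map (z : Quad p τ R) : tr (map f z) = f (tr z) := by
  simp [tr_apply]

theorem norm_map (z : Quad p τ R) : (map f z).norm = f z.norm := by
  simp [QuadraticAlgebra.norm_def]

theorem map_algebraMap (r : R) : map f (algebraMap R (Quad p τ R) r) = algebraMap S _ (f r) := by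
  ext <;> simp

theorem map_smul (r : R) (z : Quad p τ R) : map f (r • z) = f r • map f z := by
  ext <;> simp

end

end Quad

section Matrices

open Quad

variable {O : Type uO} [CommRing O] {p τ : O} {R : Type uR} [CommRing R] [Algebra O R]
variable {ι κ l : Type*}

/-- The matrix of the sesquilinear form `h` attached to `B`, conjugate-linear in the first variable.
The pair `(q, φ)` attached to `B` is `q(x) = tr (x* B x)` and `φ(x, y) = im h(x, y)`. -/
def herm (B : Matrix ι ι (Quad p τ R)) : Matrix ι ι (Quad p τ R) := B - (ratio : Quad p τ R) • Bᴴ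

theorem herm_apply (B : Matrix ι ι (Quad p τ R)) (i j : ι) :
    herm B i j = B i j - ratio * star (B j i) := rfl

theorem herm_diag (B : Matrix ι ι (Quad p τ R)) (i : ι) :
    herm B i i = algebraMap R _ (tr (B i i)) * (1 - ratio) := by
  rw [herm_apply, sub_ratio_mul_star]

theorem herm_swap (B : Matrix ι ι (Quad p τ R)) (i j : ι) :
    herm B i j = - (ratio * star (herm B j i)) := by
  rw [herm_apply, herm_apply, star_sub, star_mul', star_star]
  linear_combination -(B i j) * (ratio_mul_star_ratio (p := p) (τ := τ) (R := R))

theorem herm_sub (B B' : Matrix ι ι (Quad p τ R)) : herm (B - B') = herm B - herm B' := by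
  simp only [herm, conjTranspose_sub, smul_sub]; abel

theorem herm_smul (r : R) (B : Matrix ι ι (Quad p τ R)) : herm (r • B) = r • herm B := by
  ext1 i j
  simp only [herm_apply, Matrix.smul_apply, Algebra.smul_def, star_mul', star_algebraMap]
  ring

theorem herm_congr [Fintype ι] (B : Matrix ι ι (Quad p τ R)) (g : Matrix ι κ (Quad p τ R)) :
    herm (gᴴ * B * g) = gᴴ * herm B * g := by
  simp only [herm, conjTranspose_mul, conjTranspose_conjTranspose, Matrix.mul_sub, Matrix.sub_mul,
    Matrix.mul_smul, Matrix.smul_mul, Matrix.mul_assoc]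

/-- `B` and `B'` define the same pair `(q, φ)`: they have the same `h`, and the same values of `q`
on the basis. -/
structure GramEq (B B' : Matrix ι ι (Quad p τ R)) : Prop where
  herm_eq : herm B = herm B'
  tr_eq : ∀ i, tr (B i i) = tr (B' i i)

namespace GramEq

theorem refl (B : Matrix ι ι (Quad p τ R)) : GramEq B B := ⟨rfl, fun _ => rfl⟩

theorem trans {B B' B'' : Matrix ι ι (Quad p τ R)} (h : GramEq B B') (h' : GramEq B' B'') :
    GramEq B B'' :=
  ⟨h.1.trans h'.1, fun i => (h.2 i).trans (h'.2 i)⟩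

theorem smul {B B' : Matrix ι ι (Quad p τ R)} (h : GramEq B B') (r : R) :
    GramEq (r • B) (r • B') :=
  ⟨by rw [herm_smul, herm_smul, h.1], fun i => by
    rw [Matrix.smul_apply, Matrix.smul_apply, _root_.map_smul, _root_.map_smul, h.2]⟩

theorem submatrix {B B' : Matrix ι ι (Quad p τ R)} (h : GramEq B B') (f : κ → ι) :
    GramEq (B.submatrix f f) (B'.submatrix f f) :=
  ⟨by
    ext1 i j
    exact congrFun (congrFun h.1 (f i)) (f j), fun i => h.2 (f i)⟩

/-- If the pair `(q, φ)` attached to `Z` vanishes on a basis, then `q` vanishes. -/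
theorem tr_eq_zero [Fintype ι] [DecidableEq ι] {Z : Matrix ι ι (Quad p τ R)} (h : herm Z = 0)
    (h' : ∀ i, tr (Z i i) = 0) (x : ι → Quad p τ R) :
    tr (∑ i, ∑ j, star (x i) * Z i j * x j) = 0 := by
  have hs : ∀ i j, Z i j = ratio * star (Z j i) := fun i j => by
    have := congrFun (congrFun h i) j
    rw [herm_apply] at this
    exact sub_eq_zero.1 this
  rw [← Finset.sum_product', map_sum]
  -- The terms at `(i, j)` and `(j, i)` cancel; those on the diagonal vanish.
  refine Finset.sum_involution (fun a _ => (a.2, a.1)) ?_ ?_ (by simp) (by simp)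
  · rintro ⟨i, j⟩ -
    have : star (x j) * Z j i * x i = ratio * star (star (x i) * Z i j * x j) := by
      rw [hs j i, star_mul', star_mul', star_star]; ring
    rw [this, tr_ratio_mul_star, add_neg_cancel]
  · rintro ⟨i, j⟩ - hne heq
    obtain rfl : j = i := congrArg Prod.fst heq
    apply hne
    rw [tr_star_mul_mul, h', mul_zero]

theorem congr [Fintype ι] [DecidableEq ι] {B B' : Matrix ι ι (Quad p τ R)} (h : GramEq B B')
    (g : Matrix ι κ (Quad p τ R)) : GramEq (gᴴ * B * g) (gᴴ * B' * g) := by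
  refine ⟨by rw [herm_congr, herm_congr, h.1], fun k => ?_⟩
  have := tr_eq_zero (Z := B - B') (by rw [herm_sub, h.1, sub_self])
    (fun i => by rw [Matrix.sub_apply, map_sub, h.2, sub_self]) (fun i => g i k)
  rw [← sub_eq_zero, ← map_sub, ← this]
  congr 1
  simp only [Matrix.mul_apply, conjTranspose_apply, Matrix.sub_apply, Finset.sum_mul, mul_sub,
    sub_mul, Finset.sum_sub_distrib]
  rw [Finset.sum_comm, Finset.sum_comm (f := fun i j => star (g i k) * B' i j * g j k)]

end GramEq

/-- A change of basis carries the pair `(q, φ)` attached to `B` to `u` times the pair attached to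
`B'`. -/
def SimBy [Fintype ι] [Fintype κ] [DecidableEq ι] [DecidableEq κ] (u : Rˣ)
    (B : Matrix ι ι (Quad p τ R)) (B' : Matrix κ κ (Quad p τ R)) : Prop :=
  ∃ (g : Matrix ι κ (Quad p τ R)) (g' : Matrix κ ι (Quad p τ R)),
    g * g' = 1 ∧ g' * g = 1 ∧ GramEq (gᴴ * B * g) ((u : R) • B')

end Matrices

/-! ### Similarity of matrices and orthogonal splitting -/

section Matrices

open Quad

variable {O : Type uO} [CommRing O] {p τ : O} {R : Type uR} [CommRing R] [Algebra O R]
variable {S : Type uS} [CommRing S] [Algebra O S] (f : R →ₐ[O] S)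
variable {ι κ l : Type*} [Fintype ι] [Fintype κ] [Fintype l] [DecidableEq ι] [DecidableEq κ]
  [DecidableEq l]

theorem conjTranspose_map_quad {m n : Type*} (g : Matrix m n (Quad p τ R)) :
    (g.map (Quad.map f))ᴴ = gᴴ.map (Quad.map f) := by
  ext1 i j
  simp only [conjTranspose_apply, map_apply, Quad.map_star]

theorem herm_map {n : Type*} (B : Matrix n n (Quad p τ R)) :
    herm (B.map (Quad.map f)) = (herm B).map (Quad.map f) := by
  ext1 i j
  simp only [herm_apply, map_apply, map_sub, map_mul, Quad.map_star, map_ratio]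

theorem GramEq.map {n : Type*} {B B' : Matrix n n (Quad p τ R)} (h : GramEq B B') :
    GramEq (B.map (Quad.map f)) (B'.map (Quad.map f)) :=
  ⟨by rw [herm_map, herm_map, h.1], fun i => by
    rw [map_apply, map_apply, tr_map, tr_map, h.2]⟩

theorem herm_fromBlocks {m n : Type*} (B : Matrix m m (Quad p τ R)) (C : Matrix n n (Quad p τ R)) :
    herm (fromBlocks B 0 0 C) = fromBlocks (herm B) 0 0 (herm C) := by
  ext1 i j
  rcases i with i | i <;> rcases j with j | j <;> simp [herm_apply]

namespace SimBy

variable {u v : Rˣ} {B : Matrix ι ι (Quad p τ R)} {B' : Matrix κ κ (Quad p τ R)}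
  {B'' : Matrix l l (Quad p τ R)}

theorem map (h : SimBy u B B') :
    SimBy (Units.map f.toMonoidHom u) (B.map (Quad.map f)) (B'.map (Quad.map f)) := by
  obtain ⟨g, g', h1, h2, h3⟩ := h
  refine ⟨g.map (Quad.map f), g'.map (Quad.map f), ?_, ?_, ?_⟩
  · rw [← Matrix.map_mul, h1, Matrix.map_one _ (map_zero _) (map_one _)]
  · rw [← Matrix.map_mul, h2, Matrix.map_one _ (map_zero _) (map_one _)]
  · rw [conjTranspose_map_quad, ← Matrix.map_mul, ← Matrix.map_mul]
    convert h3.map f using 1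
    ext1 i j
    simp [Quad.map_smul]

theorem trans (h : SimBy u B B') (h' : SimBy v B' B'') : SimBy (u * v) B B'' := by
  obtain ⟨g, g', h1, h2, h3⟩ := h
  obtain ⟨k, k', h1', h2', h3'⟩ := h'
  refine ⟨g * k, k' * g', ?_, ?_, ?_⟩
  · rw [Matrix.mul_assoc, ← Matrix.mul_assoc k, h1', Matrix.one_mul, h1]
  · rw [Matrix.mul_assoc, ← Matrix.mul_assoc g', h2, Matrix.one_mul, h2']
  · have h4 := (h3.congr k).trans (by
      rw [Matrix.mul_smul, Matrix.smul_mul]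
      exact h3'.smul (u : R))
    rw [smul_smul, ← Units.val_mul] at h4
    convert h4 using 1
    simp only [conjTranspose_mul, Matrix.mul_assoc]

theorem of_gramEq {B₁ : Matrix ι ι (Quad p τ R)} (h : GramEq B B₁) : SimBy 1 B B₁ :=
  ⟨1, 1, by simp, by simp, by simpa using h⟩

theorem refl (B : Matrix ι ι (Quad p τ R)) : SimBy 1 B B := of_gramEq (GramEq.refl B)

theorem submatrix (B : Matrix ι ι (Quad p τ R)) (e : κ ≃ ι) : SimBy 1 B (B.submatrix e e) := by
  refine ⟨(1 : Matrix ι ι _).submatrix id e, (1 : Matrix ι ι _).submatrix e id, ?_, ?_, ?_⟩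
  · rw [Matrix.submatrix_mul_equiv _ _ id e id]; simp
  · rw [Matrix.submatrix_mul _ _ e id e Function.bijective_id |>.symm]; simp
  · convert GramEq.refl _ using 1
    rw [conjTranspose_submatrix, conjTranspose_one, Units.val_one, one_smul]
    nth_rewrite 2 [← Matrix.submatrix_id_id B]
    rw [Matrix.submatrix_mul _ _ e id id Function.bijective_id |>.symm,
      Matrix.submatrix_mul _ _ e id e Function.bijective_id |>.symm]
    simp

theorem fromBlocks {ι' κ' : Type*} [Fintype ι'] [Fintype κ'] [DecidableEq ι'] [DecidableEq κ']
    {C : Matrix ι' ι' (Quad p τ R)} {C' : Matrix κ' κ' (Quad p τ R)}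
    (h : SimBy u B B') (h' : SimBy u C C') :
    SimBy u (fromBlocks B 0 0 C) (fromBlocks B' 0 0 C') := by
  obtain ⟨g, g', h1, h2, h3⟩ := h
  obtain ⟨k, k', h1', h2', h3'⟩ := h'
  refine ⟨Matrix.fromBlocks g 0 0 k, Matrix.fromBlocks g' 0 0 k', ?_, ?_, ?_⟩
  · simp [fromBlocks_multiply, h1, h1']
  · simp [fromBlocks_multiply, h2, h2']
  · simp only [fromBlocks_conjTranspose, fromBlocks_multiply, Matrix.mul_zero, Matrix.zero_mul,
      conjTranspose_zero, add_zero, zero_add, fromBlocks_smul, smul_zero]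
    constructor
    · ext1 i j
      rcases i with i | i <;> rcases j with j | j
      · exact congrFun (congrFun h3.1 i) j
      · simp [herm_apply]
      · simp [herm_apply]
      · exact congrFun (congrFun h3'.1 i) j
    · rintro (i | i)
      · exact h3.2 i
      · exact h3'.2 i

end SimBy

/-- Splitting off a block on which `h` is unimodular (the Schur complement). -/
theorem exists_simBy_fromBlocks (B : Matrix (ι ⊕ κ) (ι ⊕ κ) (Quad p τ R))
    (h : IsUnit (herm B.toBlocks₁₁).det) :
    ∃ C : Matrix κ κ (Quad p τ R), SimBy 1 B (fromBlocks B.toBlocks₁₁ 0 0 C) := by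
  set P := herm B.toBlocks₁₁ with hP
  set H := herm B with hH
  have hHP : H.toBlocks₁₁ = P := rfl
  let g : Matrix (ι ⊕ κ) (ι ⊕ κ) (Quad p τ R) := fromBlocks 1 (-(P⁻¹ * H.toBlocks₁₂)) 0 1
  let g' : Matrix (ι ⊕ κ) (ι ⊕ κ) (Quad p τ R) := fromBlocks 1 (P⁻¹ * H.toBlocks₁₂) 0 1
  let B₁ := gᴴ * B * g
  have hB₁ : herm B₁ = gᴴ * H * g := herm_congr B g
  have h11 : B₁.toBlocks₁₁ = B.toBlocks₁₁ := by
    simp only [B₁, g]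
    rw [← fromBlocks_toBlocks B, fromBlocks_conjTranspose, fromBlocks_multiply,
      fromBlocks_multiply]
    simp
  have h12 : (herm B₁).toBlocks₁₂ = 0 := by
    rw [hB₁]
    simp only [g]
    rw [← fromBlocks_toBlocks H, fromBlocks_conjTranspose, fromBlocks_multiply,
      fromBlocks_multiply, hHP]
    simp [← Matrix.mul_assoc, Matrix.mul_nonsing_inv P h]
  refine ⟨B₁.toBlocks₂₂, g, g', ?_, ?_, ?_⟩
  · simp [g, g', fromBlocks_multiply]
  · simp [g, g', fromBlocks_multiply]
  · change GramEq B₁ _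
    rw [Units.val_one, one_smul, ← h11]
    have h12' : ∀ i j, herm B₁ (Sum.inl i) (Sum.inr j) = 0 := fun i j =>
      congrFun (congrFun h12 i) j
    constructor
    · rw [herm_fromBlocks]
      ext1 i j
      rcases i with i | i <;> rcases j with j | j
      · rfl
      · exact h12' i j
      · rw [herm_swap, h12']; simp
      · rfl
    · rintro (i | i) <;> rfl

end Matrices

/-! ### Gram determinants and the divided discriminant -/

section GramDet

open Quad

variable {O : Type uO} [CommRing O] {p τ : O} {R : Type uR} [CommRing R] [Algebra O R] {d : ℕ}

theorem gramA_eq (B : Matrix (Fin d) (Fin d) (Quad p τ R)) :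
    gramA (algebraMap O R τ) (fun i => tr (B i i)) (fun i j => (herm B i j).im)
      (fun i j => tr (herm B i j)) = Matrix.of fun i j => (herm B i j).im := by
  ext1 i j
  rw [gramA, of_apply, of_apply]
  split_ifs with h1 h2
  · subst h1
    rw [herm_diag]
    simp [ratio]
    ring
  · rfl
  · rw [herm_swap B i j]
    simp [ratio, tr_apply]
    ring

theorem gramB_eq (B : Matrix (Fin d) (Fin d) (Quad p τ R)) :
    gramB (fun i => tr (B i i)) (fun i j => tr (herm B i j))
      = Matrix.of fun i j => tr (herm B i j) := by
  ext1 i j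
  rw [gramB, of_apply, of_apply]
  split_ifs with h1 h2
  · subst h1
    rw [herm_diag, tr_algebraMap_mul, mul_comm]
    congr 1
    simp [ratio, tr_apply]
    ring
  · rfl
  · rw [herm_swap B i j, map_neg, tr_ratio_mul_star, neg_neg]

/-- The determinant of the matrix of `φ` over `R` is the norm of the determinant of `h`. -/
theorem det_gram_eq_norm (B : Matrix (Fin d) (Fin d) (Quad p τ R)) :
    (gram (algebraMap O R p) (algebraMap O R τ) (fun i => tr (B i i))
      (fun i j => (herm B i j).im) (fun i j => tr (herm B i j))).det = (herm B).det.norm := by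
  apply QuadraticAlgebra.algebraMap_injective (a := -(algebraMap O R p))
    (b := algebraMap O R (p * τ))
  rw [QuadraticAlgebra.algebraMap_norm_eq_mul_star]
  let w : Quad p τ R := star QuadraticAlgebra.omega
  let ι : R →+* Quad p τ R := algebraMap R _
  let a : Matrix (Fin d) (Fin d) (Quad p τ R) := (Matrix.of fun i j => (herm B i j).im).map ι
  let b : Matrix (Fin d) (Fin d) (Quad p τ R) := (Matrix.of fun i j => tr (herm B i j)).map ι
  let H : Matrix (Fin d) (Fin d) (Quad p τ R) := b - w • a
  let H' : Matrix (Fin d) (Fin d) (Quad p τ R) :=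
    b - (ι (algebraMap O R p * algebraMap O R τ) - w) • a
  have hw : w * w = ι (algebraMap O R p * algebraMap O R τ) * w - ι (algebraMap O R p) := by
    ext
    · simp [w, ι]; ring
    · simp [w, ι]
  have hH : H = herm B := by
    ext1 i j
    ext <;> simp [H, a, b, ι, w, tr_apply]
  have hH' : H'.det = star (herm B).det := by
    have h1 : H' = (starRingEnd (Quad p τ R)).mapMatrix (herm B) := by
      ext1 i j
      rw [RingHom.mapMatrix_apply, map_apply, starRingEnd_apply]
      ext <;> simp [H', a, b, ι, w, tr_apply]
    rw [h1, ← RingHom.map_det, starRingEnd_apply]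
  have hg : ι.mapMatrix (gram (algebraMap O R p) (algebraMap O R τ) (fun i => tr (B i i))
      (fun i j => (herm B i j).im) (fun i j => tr (herm B i j)))
      = fromBlocks a b (ι (algebraMap O R p * algebraMap O R τ) • a - b)
        (ι (algebraMap O R p) • a) := by
    rw [gram, RingHom.mapMatrix_apply, fromBlocks_map, gramA_eq, gramB_eq]
    congr 1
    · ext1 i j; simp [a, b, -map_mul]; simp
    · ext1 i j; exact map_mul ι _ _
  have hd : H' = b - (ι (algebraMap O R p * algebraMap O R τ) - w) • a := rfl
  clear_value H'
  generalize ι (algebraMap O R p * algebraMap O R τ) = wt at hd hw hg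
  generalize ι (algebraMap O R p) = wp at hw hg
  -- Over `R[ω]` the Gram matrix is block triangularized by elementary operations, the diagonal
  -- blocks being the matrix of `h` and its conjugate.
  let P : Matrix (Fin d ⊕ Fin d) (Fin d ⊕ Fin d) (Quad p τ R) := fromBlocks 1 0 (-(w • 1)) 1
  let Q₁ : Matrix (Fin d ⊕ Fin d) (Fin d ⊕ Fin d) (Quad p τ R) :=
    fromBlocks 1 (-(w • 1) - 1) 0 1
  let Q₂ : Matrix (Fin d ⊕ Fin d) (Fin d ⊕ Fin d) (Quad p τ R) := fromBlocks 1 0 1 1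
  let Q₃ : Matrix (Fin d ⊕ Fin d) (Fin d ⊕ Fin d) (Quad p τ R) := fromBlocks 1 (-1) 0 1
  have hQ : Q₁ * Q₂ * Q₃ = fromBlocks (-(w • 1)) (-1) 1 0 := by
    simp [Q₁, Q₂, Q₃, fromBlocks_multiply]
    abel
  have hmul : P * (ι.mapMatrix (gram (algebraMap O R p) (algebraMap O R τ) (fun i => tr (B i i))
      (fun i j => (herm B i j).im) (fun i j => tr (herm B i j)))) * (Q₁ * Q₂ * Q₃)
      = fromBlocks H (-a) 0 H' := by
    rw [hg, hQ]
    simp only [P, fromBlocks_multiply]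
    congr 1
    · ext1 i j; simp [H]; ring
    · ext1 i j; simp
    · ext1 i j
      simp
      linear_combination (a i j) * hw
    · ext1 i j; simp [hd]; ring
  have := congrArg Matrix.det hmul
  rw [← hH', show (herm B).det = H.det by rw [hH]]
  change ι _ = _
  rw [RingHom.map_det]
  simpa [det_mul, P, Q₁, Q₂, Q₃, det_fromBlocks_zero₁₂, det_fromBlocks_zero₂₁] using this

end GramDet

section DividedDisc

open Quad

variable {O : Type uO} {A : Type uA} [CommRing O] [CommRing A] [Algebra O A] (D : QuadDatum O A)
variable {R : Type uR} [CommRing R] [Algebra O R] {S : Type uS} [CommRing S] [Algebra O S] {m : ℕ}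

/-- The divided discriminant of the pair `(q, φ)` attached to `B`: the divided discriminant
polynomial evaluated at the values `q(eᵢ)`, `φ(eᵢ, eⱼ)` and `φ(eᵢ, π eⱼ)`. -/
noncomputable def matDisc (B : Matrix (Fin (2 * m + 1)) (Fin (2 * m + 1)) (Quad D.π₀ D.τ R)) : R :=
  MvPolynomial.aeval
    (Sum.elim (fun i => tr (B i i))
      (Sum.elim (fun ij => (herm B ij.1 ij.2).im) (fun ij => tr (herm B ij.1 ij.2))))
    (D.dividedDiscPoly m)

theorem c_mul_matDisc (B : Matrix (Fin (2 * m + 1)) (Fin (2 * m + 1)) (Quad D.π₀ D.τ R)) :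
    algebraMap O R D.c * matDisc D B = (herm B).det.norm := by
  rw [← det_gram_eq_norm, matDisc]
  set F := Sum.elim (fun i => tr (B i i))
      (Sum.elim (fun ij : Fin (2 * m + 1) × Fin (2 * m + 1) => (herm B ij.1 ij.2).im)
        (fun ij : Fin (2 * m + 1) × Fin (2 * m + 1) => tr (herm B ij.1 ij.2))) with hF
  have h := congrArg (MvPolynomial.aeval F) (D.C_c_mul_dividedDiscPoly m)
  rw [map_mul, MvPolynomial.aeval_C] at h
  rw [h, QuadDatum.discPoly, AlgHom.map_det]
  congr 1
  ext1 i j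
  have e1 : ∀ x : O, algebraMap O (MvPolynomial (QuadDatum.CoordIndex (2 * m + 1)) O) x
    = MvPolynomial.C x := fun _ => rfl
  rcases i with i | i <;> rcases j with j | j
  · simp only [AlgHom.mapMatrix_apply, map_apply, gram, fromBlocks_apply₁₁, gramA, of_apply]
    split_ifs <;> simp [hF]
  · simp only [AlgHom.mapMatrix_apply, map_apply, gram, fromBlocks_apply₁₂, gramB, of_apply]
    split_ifs <;> simp [hF]
  · simp only [AlgHom.mapMatrix_apply, map_apply, gram, fromBlocks_apply₂₁, gramB, gramA, of_apply,
      Matrix.sub_apply, Matrix.smul_apply, map_sub, smul_eq_mul, map_mul, MvPolynomial.aeval_C]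
    split_ifs <;> simp [hF]
  · simp only [AlgHom.mapMatrix_apply, map_apply, gram, fromBlocks_apply₂₂, gramA, of_apply,
      Matrix.smul_apply, smul_eq_mul, map_mul, MvPolynomial.aeval_C]
    split_ifs <;> simp [hF]

theorem matDisc_map (f : R →ₐ[O] S)
    (B : Matrix (Fin (2 * m + 1)) (Fin (2 * m + 1)) (Quad D.π₀ D.τ R)) :
    matDisc D (B.map (Quad.map f)) = f (matDisc D B) := by
  have : ∀ x : MvPolynomial (QuadDatum.CoordIndex (2 * m + 1)) O, ∀ F,
      f (MvPolynomial.aeval F x) = MvPolynomial.aeval (fun i => f (F i)) x := fun x F => by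
    rw [← AlgHom.comp_apply, MvPolynomial.comp_aeval]
  rw [matDisc, matDisc, this]
  congr 2
  funext i
  rcases i with i | i | i <;> simp [herm_map, tr_map]

theorem matDisc_congr {B B' : Matrix (Fin (2 * m + 1)) (Fin (2 * m + 1)) (Quad D.π₀ D.τ R)}
    (h : GramEq B B') : matDisc D B = matDisc D B' := by
  rw [matDisc, matDisc, h.1]
  congr 3
  funext i
  exact h.2 i

section Lift

variable (O R)

/-- The tautological surjection onto `R` from a polynomial ring over `O`. Matrices lift along it,
and `c` can be cancelled in its source. -/
noncomputable def polyLift : MvPolynomial R O →ₐ[O] R := MvPolynomial.aeval id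

theorem polyLift_surjective : Function.Surjective (polyLift O R) := fun r =>
  ⟨MvPolynomial.X r, by simp [polyLift]⟩

variable {O R}

theorem exists_lift_quad {p τ : O} (z : Quad p τ R) :
    ∃ y : Quad p τ (MvPolynomial R O), Quad.map (polyLift O R) y = z := by
  obtain ⟨a, ha⟩ := polyLift_surjective O R z.re
  obtain ⟨b, hb⟩ := polyLift_surjective O R z.im
  exact ⟨⟨a, b⟩, QuadraticAlgebra.ext ha hb⟩

theorem exists_lift_matrix {p τ : O} {ι κ : Type*} (B : Matrix ι κ (Quad p τ R)) :
    ∃ C : Matrix ι κ (Quad p τ (MvPolynomial R O)), C.map (Quad.map (polyLift O R)) = B := by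
  choose y hy using exists_lift_quad (R := R) (p := p) (τ := τ)
  exact ⟨B.map y, by ext1 i j; simp [hy]⟩

end Lift

variable [IsDomain O] (hc : D.c ≠ 0)

include hc in
theorem algebraMap_c_mul_cancel {σ : Type*} {x y : MvPolynomial σ O}
    (h : algebraMap O _ D.c * x = algebraMap O _ D.c * y) : x = y := by
  refine mul_left_cancel₀ ?_ h
  rw [MvPolynomial.algebraMap_eq]
  simpa using hc

include hc in
theorem matDisc_conj (B g : Matrix (Fin (2 * m + 1)) (Fin (2 * m + 1)) (Quad D.π₀ D.τ R)) :
    matDisc D (gᴴ * B * g) = g.det.norm ^ 2 * matDisc D B := by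
  obtain ⟨B, rfl⟩ := exists_lift_matrix B
  obtain ⟨g, rfl⟩ := exists_lift_matrix g
  rw [conjTranspose_map_quad, ← Matrix.map_mul, ← Matrix.map_mul, matDisc_map, matDisc_map,
    show (g.map (Quad.map (polyLift O R))).det = Quad.map (polyLift O R) g.det from
      ((Quad.map (polyLift O R)).map_det g).symm, Quad.norm_map, ← map_pow, ← map_mul]
  congr 1
  apply algebraMap_c_mul_cancel D hc
  rw [c_mul_matDisc, herm_congr, det_mul, det_mul, det_conjTranspose, map_mul, map_mul,
    QuadraticAlgebra.norm_star, mul_left_comm, c_mul_matDisc]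
  ring

include hc in
theorem matDisc_fromBlocks {κ : Type*} [Fintype κ] [DecidableEq κ] {m' : ℕ}
    (e : Fin (2 * m' + 1) ≃ κ ⊕ Fin (2 * m + 1)) (C : Matrix κ κ (Quad D.π₀ D.τ R))
    (B : Matrix (Fin (2 * m + 1)) (Fin (2 * m + 1)) (Quad D.π₀ D.τ R)) :
    matDisc D ((fromBlocks C 0 0 B).submatrix e e) = (herm C).det.norm * matDisc D B := by
  obtain ⟨B, rfl⟩ := exists_lift_matrix B
  obtain ⟨C, rfl⟩ := exists_lift_matrix C
  have h1 : (fromBlocks (C.map (Quad.map (polyLift O R))) 0 0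
      (B.map (Quad.map (polyLift O R)))).submatrix e e
      = ((fromBlocks C 0 0 B).submatrix e e).map (Quad.map (polyLift O R)) := by
    rw [← submatrix_map, fromBlocks_map, Matrix.map_zero _ (map_zero _),
      Matrix.map_zero _ (map_zero _)]
  rw [h1, herm_map, matDisc_map, matDisc_map,
    show ((herm C).map (Quad.map (polyLift O R))).det = Quad.map (polyLift O R) (herm C).det from
      ((Quad.map (polyLift O R)).map_det _).symm, Quad.norm_map, ← map_mul]
  congr 1
  apply algebraMap_c_mul_cancel D hc
  have h2 : herm ((fromBlocks C 0 0 B).submatrix e e)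
      = (fromBlocks (herm C) 0 0 (herm B)).submatrix e e := by
    rw [← herm_fromBlocks]; rfl
  rw [c_mul_matDisc, h2, det_submatrix_equiv_self, det_fromBlocks_zero₂₁, map_mul, mul_left_comm,
    c_mul_matDisc]

include hc in
/-- Splitting off a block preserves invertibility of the divided discriminant. -/
theorem isUnit_matDisc_of_simBy {κ : Type*} [Fintype κ] [DecidableEq κ] {m' : ℕ}
    (e : Fin (2 * m' + 1) ≃ κ ⊕ Fin (2 * m + 1)) {C : Matrix κ κ (Quad D.π₀ D.τ R)}
    {B : Matrix (Fin (2 * m + 1)) (Fin (2 * m + 1)) (Quad D.π₀ D.τ R)}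
    {B' : Matrix (Fin (2 * m' + 1)) (Fin (2 * m' + 1)) (Quad D.π₀ D.τ R)}
    (h : SimBy 1 B' (fromBlocks C 0 0 B)) (hB' : IsUnit (matDisc D B')) :
    IsUnit (herm C).det ∧ IsUnit (matDisc D B) := by
  obtain ⟨g, g', h1, h2, h3⟩ := h
  have h4 := h3.submatrix e
  rw [Units.val_one, one_smul] at h4
  have h5 : (gᴴ * B' * g).submatrix e e = (g.submatrix id e)ᴴ * B' * (g.submatrix id e) := by
    rw [conjTranspose_submatrix]
    rfl
  have h6 := matDisc_congr D h4
  rw [h5, matDisc_conj D hc, matDisc_fromBlocks D hc] at h6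
  have h7 : (g.submatrix id e) * (g'.submatrix e id) = 1 := by
    rw [submatrix_mul_equiv, h1]; rfl
  have h8 : IsUnit (g.submatrix id e).det :=
    (Matrix.isUnit_iff_isUnit_det _).1 (IsUnit.of_mul_eq_one _ h7)
  have h9 : IsUnit ((herm C).det.norm * matDisc D B) := by
    rw [← h6]
    exact ((QuadraticAlgebra.isUnit_iff_norm_isUnit.1 h8).pow 2).mul hB'
  exact ⟨QuadraticAlgebra.isUnit_iff_norm_isUnit.2 (isUnit_of_mul_isUnit_left h9),
    isUnit_of_mul_isUnit_right h9⟩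

include hc in
theorem matDisc_one (B : Matrix (Fin (2 * 0 + 1)) (Fin (2 * 0 + 1)) (Quad D.π₀ D.τ R)) :
    matDisc D B = tr (B 0 0) ^ 2 := by
  obtain ⟨B, rfl⟩ := exists_lift_matrix B
  rw [matDisc_map, map_apply, tr_map, ← map_pow]
  congr 1
  apply algebraMap_c_mul_cancel D hc
  have : (herm B).det = herm B 0 0 := Matrix.det_fin_one _
  rw [c_mul_matDisc, this, herm_diag, map_mul, QuadraticAlgebra.norm_algebraMap,
    norm_one_sub_ratio, QuadDatum.c, QuadDatum.t, mul_comm]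

end DividedDisc

/-! ### Forms where two vanishes, and hyperbolic planes -/

section CharTwo

open Quad

/-- Two matrices over a linearly ordered index set define the same pair `(q, φ)` as soon as they
do so on the diagonal and above it. -/
theorem GramEq.of_lt {O : Type uO} [CommRing O] {p τ : O} {R : Type uR} [CommRing R] [Algebra O R]
    {ι : Type*} [LinearOrder ι] {B B' : Matrix ι ι (Quad p τ R)}
    (h : ∀ i, tr (B i i) = tr (B' i i)) (h' : ∀ i j, i < j → herm B i j = herm B' i j) :
    GramEq B B' := by
  refine ⟨?_, h⟩
  ext1 i j
  rcases lt_trichotomy i j with hij | rfl | hij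
  · exact h' i j hij
  · rw [herm_diag, herm_diag, h]
  · rw [herm_swap, herm_swap B', h' j i hij]

variable {O : Type uO} {A : Type uA} [CommRing O] [CommRing A] [Algebra O A] (D : QuadDatum O A)
variable {R : Type uR} [CommRing R] [Algebra O R] {m : ℕ}

/-- If `ω` divides the entries of the matrix of `h` off the diagonal (and then also those on the
diagonal, because `ω ∣ 2`), then the divided discriminant is divisible by `π₀ ^ (2 m)`. -/
theorem π₀_pow_dvd_matDisc {P : Type uS} [CommRing P] [Algebra O P]
    (hc : ∀ x y : P, algebraMap O P D.c * x = algebraMap O P D.c * y → x = y)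
    {k : O} (hk : 2 = D.π₀ * k)
    (q : Fin (2 * m + 1) → P) (a : Fin (2 * m + 1) → Fin (2 * m + 1) → P) :
    algebraMap O P D.π₀ ^ (2 * m) ∣ matDisc D
      (Matrix.of fun i j => if i = j then algebraMap P (Quad D.π₀ D.τ P) (q i)
        else if i < j then algebraMap P (Quad D.π₀ D.τ P) (a i j) * QuadraticAlgebra.omega
        else 0) := by
  set B : Matrix (Fin (2 * m + 1)) (Fin (2 * m + 1)) (Quad D.π₀ D.τ P) :=
    Matrix.of fun i j => if i = j then algebraMap P (Quad D.π₀ D.τ P) (q i)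
        else if i < j then algebraMap P (Quad D.π₀ D.τ P) (a i j) * QuadraticAlgebra.omega
        else 0 with hB
  let w : Quad D.π₀ D.τ P := QuadraticAlgebra.omega
  let ρ : Quad D.π₀ D.τ P := ratio
  let η : Quad D.π₀ D.τ P :=
    ρ * (w * algebraMap P _ (algebraMap O P k) - algebraMap P _ (algebraMap O P D.τ))
  have hρw : ρ * w = star w := ratio_mul_omega
  have hww : w * star w = algebraMap P _ (algebraMap O P D.π₀) := omega_mul_star_omega
  have h2 : (2 : Quad D.π₀ D.τ P)
      = algebraMap P _ (algebraMap O P D.π₀) * algebraMap P _ (algebraMap O P k) := by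
    rw [← map_mul, ← map_mul, ← hk, map_ofNat, map_ofNat]
  -- `η` is `(1 - ω̄ / ω) / ω`.
  have hη : w * η = 1 - ρ := by
    have : (1 : Quad D.π₀ D.τ P) - ρ = 2 - algebraMap P _ (algebraMap O P D.τ) * star w := by
      simp only [ρ, ratio, w]; ring
    rw [this, h2]
    simp only [η]
    linear_combination (w * algebraMap P (Quad D.π₀ D.τ P) (algebraMap O P k)
      - algebraMap P (Quad D.π₀ D.τ P) (algebraMap O P D.τ)) * hρw
      + (algebraMap P (Quad D.π₀ D.τ P) (algebraMap O P k)) * hww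
  let G : Matrix (Fin (2 * m + 1)) (Fin (2 * m + 1)) (Quad D.π₀ D.τ P) :=
    Matrix.of fun i j => if i = j then η * algebraMap _ _ (q i)
      else if i < j then algebraMap _ _ (a i j) else - (ρ * ρ * algebraMap _ _ (a j i))
  have hG : herm B = w • G := by
    ext1 i j
    rw [Matrix.smul_apply, smul_eq_mul]
    rcases lt_trichotomy i j with hij | rfl | hij
    · rw [herm_apply]
      simp only [hB, G, of_apply, hij.ne, hij.ne', hij, not_lt.2 hij.le, if_true, if_false,
        star_zero, mul_zero, sub_zero]
      exact mul_comm _ _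
    · rw [herm_diag, ← hη.trans rfl]
      simp only [hB, G, of_apply, if_true, tr_algebraMap]
      ring
    · rw [herm_apply]
      simp only [hB, G, of_apply, hij.ne, hij.ne', hij, not_lt.2 hij.le, if_true, if_false,
        star_mul', star_algebraMap]
      change 0 - ρ * (_ * star w) = _
      rw [← hρw]
      ring
  -- Modulo `η` the matrix `G` is alternating of odd size.
  have hdvd : η ∣ G.det := by
    rw [← Ideal.mem_span_singleton, ← Ideal.Quotient.eq_zero_iff_mem, RingHom.map_det]
    have key : ∀ i j, i < j → η ∣ G i j + G j i := by
      intro i j hij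
      refine ⟨algebraMap _ _ (a i j) * w * (1 + ρ), ?_⟩
      simp only [G, of_apply, hij.ne, hij.ne', hij, not_lt.2 hij.le, if_true, if_false]
      linear_combination (-(1 + ρ) * algebraMap P (Quad D.π₀ D.τ P) (a i j)) * hη
    apply det_eq_zero_of_alternating_of_odd ⟨m, rfl⟩
    · intro i
      rw [RingHom.mapMatrix_apply, map_apply, Ideal.Quotient.eq_zero_iff_mem,
        Ideal.mem_span_singleton]
      exact ⟨algebraMap _ _ (q i), by simp [G]⟩
    · intro i j
      rw [RingHom.mapMatrix_apply, map_apply, map_apply, ← sub_eq_zero, sub_neg_eq_add,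
        ← RingHom.map_add, Ideal.Quotient.eq_zero_iff_mem, Ideal.mem_span_singleton]
      rcases lt_trichotomy i j with h | h | h
      · rw [add_comm]; exact key i j h
      · subst h
        refine ⟨2 * algebraMap _ _ (q i), ?_⟩
        simp only [G, of_apply, if_true]
        ring
      · exact key j i h
  obtain ⟨κ, hκ⟩ := hdvd
  refine ⟨κ.norm, ?_⟩
  apply hc
  have hnw : w.norm = algebraMap O P D.π₀ := by simp [w, QuadraticAlgebra.norm_def]
  have hdet : (herm B).det = w ^ (2 * m) * (1 - ρ) * κ := by
    rw [hG, det_smul, hκ, Fintype.card_fin, ← hη]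
    ring
  have hn : (1 - ρ).norm = algebraMap O P D.c := norm_one_sub_ratio
  rw [c_mul_matDisc, hdet, map_mul, map_mul, map_pow, hnw, hn]
  ring

/-- Where `π₀ = 0`, the divided discriminant in rank `2 m + 1 > 1` vanishes unless some value of
`h` off the diagonal is a unit. -/
theorem matDisc_eq_zero [IsDomain O] (hc : D.c ≠ 0) (hπ : D.π₀ ∣ 2)
    (hR : algebraMap O R D.π₀ = 0) (hm : m ≠ 0)
    {B : Matrix (Fin (2 * m + 1)) (Fin (2 * m + 1)) (Quad D.π₀ D.τ R)}
    (h : ∀ i j, i ≠ j → (herm B i j).re = 0) : matDisc D B = 0 := by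
  obtain ⟨k, hk⟩ := hπ
  choose q hq using fun i => polyLift_surjective O R (tr (B i i))
  choose a ha using fun i j => polyLift_surjective O R (herm B i j).im
  have h1 := (map_dvd (polyLift O R) (π₀_pow_dvd_matDisc D
    (fun _ _ => algebraMap_c_mul_cancel D hc) hk q a))
  rw [map_pow, AlgHom.commutes, hR, zero_pow (by omega), zero_dvd_iff, ← matDisc_map] at h1
  rw [← h1]
  apply matDisc_congr
  apply GramEq.of_lt
  · intro i
    rw [map_apply, tr_map]
    simp [tr_algebraMap, hq]
  · intro i j hij
    rw [herm_map, map_apply, herm_apply (Matrix.of _)]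
    simp only [of_apply, hij.ne, hij.ne', hij, not_lt.2 hij.le, if_true, if_false, star_zero,
      mul_zero, sub_zero, map_mul, Quad.map_algebraMap, ha, map_omega]
    ext
    · simp [h i j hij.ne]
    · simp

end CharTwo

section RankTwo

open Quad

variable {O : Type uO} [CommRing O] {p τ : O} {R : Type uR} [CommRing R] [Algebra O R]

variable (p τ R) in
/-- The matrix of an orthogonal sum of hyperbolic planes. The first copy of `α` indexes the vectors
`e₁` of the planes, the second copy the vectors `e₂`. -/
def hypMat (α : Type*) [DecidableEq α] : Matrix (α ⊕ α) (α ⊕ α) (Quad p τ R) := fromBlocks 0 1 0 0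

variable (p τ R) in
/-- The matrix of the standard module. -/
def stdMat (α : Type*) [DecidableEq α] :
    Matrix ((α ⊕ α) ⊕ Unit) ((α ⊕ α) ⊕ Unit) (Quad p τ R) :=
  fromBlocks (hypMat p τ R α) 0 0 1

theorem isUnit_quad_iff {z : Quad p τ R} : IsUnit z ↔ IsUnit z.norm :=
  QuadraticAlgebra.isUnit_iff_norm_isUnit

theorem isUnit_ratio : IsUnit (ratio : Quad p τ R) := IsUnit.of_mul_eq_one _ ratio_mul_star_ratio

theorem isUnit_det_herm_hypMat : IsUnit (herm (hypMat p τ R Unit)).det := by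
  have : herm (hypMat p τ R Unit) = fromBlocks 0 1 (-((ratio : Quad p τ R) • 1)) 0 := by
    ext1 i j
    rcases i with i | i <;> rcases j with j | j <;> simp [herm_apply, hypMat]
  rw [this, ← Matrix.isUnit_iff_isUnit_det]
  obtain ⟨r, hr⟩ := isUnit_ratio (p := p) (τ := τ) (R := R)
  apply IsUnit.of_mul_eq_one (b := fromBlocks 0 (-(((r⁻¹ : (Quad p τ R)ˣ) : Quad p τ R) • 1)) 1 0)
  rw [fromBlocks_multiply, ← hr]
  simp [smul_smul]

/-- The value of `q` on a vector in rank two. -/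
theorem tr_two (B : Matrix (Unit ⊕ Unit) (Unit ⊕ Unit) (Quad p τ R)) {l : Type*}
    (g : Matrix (Unit ⊕ Unit) l (Quad p τ R)) (i : l) :
    tr ((gᴴ * B * g) i i) = (g (.inl ()) i).norm * tr (B (.inl ()) (.inl ()))
      + (g (.inr ()) i).norm * tr (B (.inr ()) (.inr ()))
      + tr (star (g (.inl ()) i) * herm B (.inl ()) (.inr ()) * g (.inr ()) i) := by
  simp only [Matrix.mul_apply, Fintype.sum_sum_type, Finset.univ_unique, Finset.sum_singleton,
    conjTranspose_apply, herm_apply, PUnit.default_eq_unit]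
  rw [← tr_star_mul_mul, ← tr_star_mul_mul, ← map_add, ← map_add]
  have h := tr_ratio_mul_star (star (g (.inr ()) i) * B (.inr ()) (.inl ()) * g (.inl ()) i)
  rw [star_mul', star_mul', star_star] at h
  rw [← sub_eq_zero, ← map_sub, ← sub_eq_zero.2 h, sub_neg_eq_add, ← map_add]
  congr 1
  ring

theorem herm_two (B : Matrix (Unit ⊕ Unit) (Unit ⊕ Unit) (Quad p τ R)) {l : Type*}
    (g : Matrix (Unit ⊕ Unit) l (Quad p τ R)) (i j : l) :
    herm (gᴴ * B * g) i j =
      star (g (.inl ()) i) * herm B (.inl ()) (.inl ()) * g (.inl ()) j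
      + star (g (.inr ()) i) * herm B (.inr ()) (.inl ()) * g (.inl ()) j
      + star (g (.inl ()) i) * herm B (.inl ()) (.inr ()) * g (.inr ()) j
      + star (g (.inr ()) i) * herm B (.inr ()) (.inr ()) * g (.inr ()) j := by
  rw [herm_congr]
  simp only [Matrix.mul_apply, Fintype.sum_sum_type, Finset.univ_unique, Finset.sum_singleton,
    conjTranspose_apply, PUnit.default_eq_unit]
  ring

/-- In rank two, an isotropic vector `x` and a vector `y` with `h(x, y)` a unit yield a basis of a
hyperbolic plane. -/
theorem exists_hyp_basis (B : Matrix (Unit ⊕ Unit) (Unit ⊕ Unit) (Quad p τ R))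
    (g : Matrix (Unit ⊕ Unit) (Unit ⊕ Unit) (Quad p τ R))
    (h0 : tr ((gᴴ * B * g) (.inl ()) (.inl ())) = 0)
    (h1 : IsUnit (herm (gᴴ * B * g) (.inl ()) (.inr ()))) :
    ∃ k k' : Matrix (Unit ⊕ Unit) (Unit ⊕ Unit) (Quad p τ R), k * k' = 1 ∧ k' * k = 1 ∧
      GramEq (kᴴ * B * k) (hypMat p τ R Unit) := by
  set C := gᴴ * B * g with hC
  obtain ⟨v, hv⟩ := h1.exists_right_inv
  let b : R := v.norm * tr (C (.inr ()) (.inr ()))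
  let s : Matrix (Unit ⊕ Unit) (Unit ⊕ Unit) (Quad p τ R) :=
    fromBlocks 1 (-(algebraMap R (Quad p τ R) b • 1)) 0 (v • 1)
  have hs : GramEq (sᴴ * C * s) (hypMat p τ R Unit) := by
    have h00 : herm C (.inl ()) (.inl ()) = 0 := by rw [herm_diag, h0]; simp
    have t00 : tr ((sᴴ * C * s) (.inl ()) (.inl ())) = 0 := by
      rw [tr_two]
      simp [s, h0]
    have t11 : tr ((sᴴ * C * s) (.inr ()) (.inr ())) = 0 := by
      rw [tr_two, h0]
      simp only [s, fromBlocks_apply₁₂, fromBlocks_apply₂₂, Matrix.neg_apply, Matrix.smul_apply,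
        Matrix.one_apply_eq, smul_eq_mul, mul_one, star_neg, star_algebraMap]
      rw [neg_mul, neg_mul, mul_assoc, hv, mul_one, (tr (p := p) (τ := τ) (R := R)).map_neg,
        tr_algebraMap]
      simp [b]
    have h01 : herm (sᴴ * C * s) (.inl ()) (.inr ()) = 1 := by
      rw [herm_two, h00]
      simp [s, hv]
    have k01 : herm (hypMat p τ R Unit) (.inl ()) (.inr ()) = 1 := by simp [herm_apply, hypMat]
    have htr : ∀ i, tr ((sᴴ * C * s) i i) = tr (hypMat p τ R Unit i i) := by
      rintro (⟨⟩ | ⟨⟩)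
      · rw [t00]; simp [hypMat]
      · rw [t11]; simp [hypMat]
    refine ⟨?_, htr⟩
    ext1 i j
    rcases i with ⟨⟩ | ⟨⟩ <;> rcases j with ⟨⟩ | ⟨⟩
    · rw [herm_diag, herm_diag, htr]
    · rw [h01, k01]
    · rw [herm_swap, h01, herm_swap (hypMat p τ R Unit), k01]
    · rw [herm_diag, herm_diag, htr]
  have hk : GramEq ((g * s)ᴴ * B * (g * s)) (hypMat p τ R Unit) := by
    convert hs using 1
    simp only [hC, conjTranspose_mul, Matrix.mul_assoc]
  have hdet : IsUnit (g * s).det := by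
    have h2 := congrArg Matrix.det hk.1
    rw [herm_congr, det_mul] at h2
    have h3 := isUnit_det_herm_hypMat (p := p) (τ := τ) (R := R)
    rw [← h2] at h3
    exact isUnit_of_mul_isUnit_right h3
  exact ⟨g * s, (g * s)⁻¹, Matrix.mul_nonsing_inv _ hdet, Matrix.nonsing_inv_mul _ hdet, hk⟩

/-- Splitting off a hyperbolic plane. -/
theorem exists_simBy_hyp {l : Type*} [Fintype l] [DecidableEq l]
    (B : Matrix ((Unit ⊕ Unit) ⊕ l) ((Unit ⊕ Unit) ⊕ l) (Quad p τ R))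
    (g : Matrix (Unit ⊕ Unit) (Unit ⊕ Unit) (Quad p τ R))
    (h0 : tr ((gᴴ * B.toBlocks₁₁ * g) (.inl ()) (.inl ())) = 0)
    (h1 : IsUnit (herm (gᴴ * B.toBlocks₁₁ * g) (.inl ()) (.inr ()))) :
    ∃ C : Matrix l l (Quad p τ R), SimBy 1 B (fromBlocks (hypMat p τ R Unit) 0 0 C) := by
  obtain ⟨k, k', hk, hk', hB⟩ := exists_hyp_basis _ g h0 h1
  let s : Matrix ((Unit ⊕ Unit) ⊕ l) ((Unit ⊕ Unit) ⊕ l) (Quad p τ R) := fromBlocks k 0 0 1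
  let s' : Matrix ((Unit ⊕ Unit) ⊕ l) ((Unit ⊕ Unit) ⊕ l) (Quad p τ R) := fromBlocks k' 0 0 1
  have h2 : (sᴴ * B * s).toBlocks₁₁ = kᴴ * B.toBlocks₁₁ * k := by
    simp only [s]
    rw [← fromBlocks_toBlocks B, fromBlocks_conjTranspose, fromBlocks_multiply,
      fromBlocks_multiply]
    simp
  have h3 : SimBy 1 B (sᴴ * B * s) :=
    ⟨s, s', by simp [s, s', fromBlocks_multiply, hk], by simp [s, s', fromBlocks_multiply, hk'],
      by simpa using GramEq.refl _⟩
  obtain ⟨C, hC⟩ := exists_simBy_fromBlocks (sᴴ * B * s) (by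
    rw [h2, hB.1]; exact isUnit_det_herm_hypMat)
  refine ⟨C, ?_⟩
  rw [h2] at hC
  simpa using (h3.trans hC).trans ((SimBy.of_gramEq hB).fromBlocks (SimBy.refl C))

/-- A plane on which `h(e₀, e₁)` has an inverse `v` is hyperbolic as soon as `x² + x + δ` has a
root, where `δ = q(e₀) N(v) q(e₁)`: the vector `(1 + x) e₀ - q(e₀) v e₁` is isotropic. -/
theorem exists_simBy_hyp_of_root {l : Type*} [Fintype l] [DecidableEq l]
    (B : Matrix ((Unit ⊕ Unit) ⊕ l) ((Unit ⊕ Unit) ⊕ l) (Quad p τ R)) {v : Quad p τ R}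
    (hv : herm B (.inl (.inl ())) (.inl (.inr ())) * v = 1) {δ x : R}
    (hδ : δ = tr (B (.inl (.inl ())) (.inl (.inl ())))
      * (v.norm * tr (B (.inl (.inr ())) (.inl (.inr ())))))
    (hx : x ^ 2 + x + δ = 0) (hx1 : IsUnit (1 + x))
    (hc : IsUnit (1 - algebraMap O R (4 - p * τ * τ) * δ)) :
    ∃ C : Matrix l l (Quad p τ R), SimBy 1 B (fromBlocks (hypMat p τ R Unit) 0 0 C) := by
  set q₀ := tr (B (.inl (.inl ())) (.inl (.inl ()))) with hq₀
  set q₁ := tr (B (.inl (.inr ())) (.inl (.inr ()))) with hq₁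
  let ι := algebraMap R (Quad p τ R)
  let g : Matrix (Unit ⊕ Unit) (Unit ⊕ Unit) (Quad p τ R) :=
    fromBlocks (ι (1 + x) • 1) 0 (-((ι q₀ * v) • 1)) (v • 1)
  have hv' : herm B.toBlocks₁₁ (.inl ()) (.inr ()) * v = 1 := hv
  have e0 : tr (B.toBlocks₁₁ (.inl ()) (.inl ())) = q₀ := rfl
  have e1 : tr (B.toBlocks₁₁ (.inr ()) (.inr ())) = q₁ := rfl
  apply exists_simBy_hyp B g
  · rw [tr_two, e0, e1]
    simp only [g, fromBlocks_apply₁₁, fromBlocks_apply₂₁, Matrix.neg_apply, Matrix.smul_apply,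
      Matrix.one_apply_eq, smul_eq_mul, mul_one, star_algebraMap, ι, QuadraticAlgebra.norm_neg,
      map_mul, QuadraticAlgebra.norm_algebraMap]
    have : algebraMap R (Quad p τ R) (1 + x) * herm B.toBlocks₁₁ (.inl ()) (.inr ())
        * -(algebraMap R (Quad p τ R) q₀ * v) = algebraMap R _ (-((1 + x) * q₀)) := by
      rw [(algebraMap R (Quad p τ R)).map_neg, (algebraMap R (Quad p τ R)).map_mul]
      linear_combination (-(algebraMap R (Quad p τ R) (1 + x)) * algebraMap R (Quad p τ R) q₀) * hv'
    rw [this, tr_algebraMap]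
    linear_combination q₀ * hx - q₀ * hδ
  · have h3 : herm (gᴴ * B.toBlocks₁₁ * g) (.inl ()) (.inr ())
        = ι (1 + x) * (1 + ι x * (1 - ratio)) := by
      rw [herm_two, herm_diag B.toBlocks₁₁ (.inr ()), e1]
      simp only [g, fromBlocks_apply₁₁, fromBlocks_apply₂₁, fromBlocks_apply₁₂, fromBlocks_apply₂₂,
        Matrix.neg_apply, Matrix.smul_apply, Matrix.zero_apply,
        Matrix.one_apply_eq, smul_eq_mul, mul_one, mul_zero, star_neg, star_mul',
        star_algebraMap, ι]
      have hn := QuadraticAlgebra.algebraMap_norm_eq_mul_star v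
      have hδ' := congrArg (algebraMap R (Quad p τ R)) hδ
      have hx' := congrArg (algebraMap R (Quad p τ R)) hx
      simp only [map_add, map_mul, map_pow, map_zero, map_one] at hδ' hx' hn ⊢
      linear_combination (1 + algebraMap R (Quad p τ R) x) * hv' - (1 - ratio) * hx'
        + (1 - ratio) * hδ' + (1 - ratio) * algebraMap R (Quad p τ R) q₀
          * algebraMap R (Quad p τ R) q₁ * hn
    rw [h3]
    refine (hx1.map ι).mul ?_
    rw [isUnit_quad_iff]
    have : (1 + ι x * (1 - ratio)).norm = 1 - algebraMap O R (4 - p * τ * τ) * δ := by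
      have hd : δ = - (x ^ 2 + x) := by linear_combination hx
      rw [hd]
      have h4 : algebraMap O R 4 = 4 := map_ofNat _ 4
      simp [ι, ratio, QuadraticAlgebra.norm_def, h4]
      ring
    rwa [this]

/-- An orthogonal sum of two lines is a hyperbolic plane as soon as `-q(e₀) q(e₁)` has a square root
`x`: the vector `q(e₁) e₀ + x e₁` is isotropic. -/
theorem exists_simBy_hyp_of_sqrt {l : Type*} [Fintype l] [DecidableEq l]
    (B : Matrix ((Unit ⊕ Unit) ⊕ l) ((Unit ⊕ Unit) ⊕ l) (Quad p τ R))
    (hB : herm B (.inl (.inl ())) (.inl (.inr ())) = 0)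
    (h0 : IsUnit (tr (B (.inl (.inl ())) (.inl (.inl ())))))
    (h1 : IsUnit (tr (B (.inl (.inr ())) (.inl (.inr ()))))) {x : R}
    (hx : x ^ 2 = - (tr (B (.inl (.inl ())) (.inl (.inl ())))
      * tr (B (.inl (.inr ())) (.inl (.inr ())))))
    (hc : IsUnit (algebraMap O R (4 - p * τ * τ))) :
    ∃ C : Matrix l l (Quad p τ R), SimBy 1 B (fromBlocks (hypMat p τ R Unit) 0 0 C) := by
  set q₀ := tr (B (.inl (.inl ())) (.inl (.inl ()))) with hq₀
  set q₁ := tr (B (.inl (.inr ())) (.inl (.inr ()))) with hq₁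
  let ι := algebraMap R (Quad p τ R)
  let g : Matrix (Unit ⊕ Unit) (Unit ⊕ Unit) (Quad p τ R) :=
    fromBlocks (ι q₁ • 1) 1 (ι x • 1) 0
  have e0 : tr (B.toBlocks₁₁ (.inl ()) (.inl ())) = q₀ := rfl
  have e1 : tr (B.toBlocks₁₁ (.inr ()) (.inr ())) = q₁ := rfl
  have e01 : herm B.toBlocks₁₁ (.inl ()) (.inr ()) = 0 := hB
  have e10 : herm B.toBlocks₁₁ (.inr ()) (.inl ()) = 0 := by rw [herm_swap, e01]; simp
  apply exists_simBy_hyp B g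
  · rw [tr_two, e0, e1, e01]
    simp only [g, fromBlocks_apply₁₁, fromBlocks_apply₂₁, Matrix.smul_apply,
      Matrix.one_apply_eq, smul_eq_mul, mul_one, ι, mul_zero, zero_mul, map_zero,
      QuadraticAlgebra.norm_algebraMap]
    linear_combination q₁ * hx
  · rw [herm_two, herm_diag, e0, e01, e10]
    simp only [g, fromBlocks_apply₁₁, fromBlocks_apply₂₁, fromBlocks_apply₁₂, fromBlocks_apply₂₂,
      Matrix.smul_apply, Matrix.zero_apply,
      Matrix.one_apply_eq, smul_eq_mul, mul_one, ι, mul_zero, star_algebraMap, add_zero]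
    refine (h1.map _).mul ((h0.map _).mul ?_)
    rw [isUnit_quad_iff, norm_one_sub_ratio]
    exact hc

end RankTwo

/-! ### Étale neighbourhoods and the classification over them -/

section EtaleNhd

variable {O : Type uO} [CommRing O] {R : Type uR} [CommRing R] [Algebra O R]
  {K : Type uK} [Field K] [Algebra O K]

/-- An étale neighbourhood of the geometric point `σ : R → K` of `Spec R`: an étale `R`-algebra
together with a lift of `σ`. -/
structure EtaleNhd (σ : R →ₐ[O] K) where
  S : Type uR
  [commRing : CommRing S]
  [algebraR : Algebra R S]
  [algebraO : Algebra O S]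
  [tower : IsScalarTower O R S]
  [etale : Algebra.Etale R S]
  point : S →ₐ[O] K
  point_comp : point.comp (IsScalarTower.toAlgHom O R S) = σ

attribute [instance] EtaleNhd.commRing EtaleNhd.algebraR EtaleNhd.algebraO EtaleNhd.tower
  EtaleNhd.etale

namespace EtaleNhd

variable {σ : R →ₐ[O] K}

/-- The structure map of an étale neighbourhood. -/
def hom (N : EtaleNhd σ) : R →ₐ[O] N.S := IsScalarTower.toAlgHom O R N.S

theorem point_hom (N : EtaleNhd σ) (r : R) : N.point (N.hom r) = σ r :=
  DFunLike.congr_fun N.point_comp r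

/-- The trivial étale neighbourhood. -/
def self (σ : R →ₐ[O] K) : EtaleNhd σ where
  S := R
  point := σ
  point_comp := by ext; rfl

/-- An étale neighbourhood in an étale neighbourhood. -/
def comp (N : EtaleNhd σ) (N' : EtaleNhd N.point) : EtaleNhd σ :=
  letI : Algebra R N'.S := ((algebraMap N.S N'.S).comp (algebraMap R N.S)).toAlgebra
  haveI : IsScalarTower R N.S N'.S := IsScalarTower.of_algebraMap_eq fun _ => rfl
  haveI : IsScalarTower O R N'.S := IsScalarTower.of_algebraMap_eq fun x => by
    rw [IsScalarTower.algebraMap_apply O N.S N'.S, IsScalarTower.algebraMap_apply O R N.S]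
    rfl
  haveI : Algebra.Etale R N'.S := Algebra.Etale.comp R N.S N'.S
  { S := N'.S
    point := N'.point
    point_comp := by
      ext r
      exact (N'.point_hom (N.hom r)).trans (N.point_hom r) }

/-- An element that does not vanish at the geometric point is invertible on a neighbourhood. -/
theorem exists_isUnit (σ : R →ₐ[O] K) {r : R} (hr : σ r ≠ 0) :
    ∃ N : EtaleNhd σ, IsUnit (N.hom r) := by
  have : Algebra.Etale R (Localization.Away r) := Algebra.Etale.of_isLocalizationAway r
  let ψ : Localization.Away r →ₐ[O] K :=
    { IsLocalization.Away.lift r (g := σ.toRingHom) (IsUnit.mk0 _ hr) with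
      commutes' := fun x => by
        have h := IsLocalization.Away.lift_eq (S := Localization.Away r) r (g := σ.toRingHom)
          (IsUnit.mk0 _ hr) (algebraMap O R x)
        rw [← IsScalarTower.algebraMap_apply] at h
        exact h.trans (σ.commutes x) }
  exact ⟨{ S := Localization.Away r
           point := ψ
           point_comp := by
            ext x
            exact IsLocalization.Away.lift_eq (S := Localization.Away r) r (g := σ.toRingHom)
              (IsUnit.mk0 _ hr) x }, IsLocalization.Away.algebraMap_isUnit r⟩

open Polynomial in
/-- A simple root of a monic polynomial `f` at the geometric point extends to a neighbourhood. The
multiple `g` of the derivative serves to make further elements invertible there. -/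
theorem exists_root (σ : R →ₐ[O] K) {f g : R[X]} (hf : f.Monic) (hg : derivative f ∣ g) {x₀ : K}
    (hx₀ : f.eval₂ σ.toRingHom x₀ = 0) (hgx₀ : g.eval₂ σ.toRingHom x₀ ≠ 0) :
    ∃ (N : EtaleNhd σ) (x : N.S), f.eval₂ N.hom.toRingHom x = 0 ∧
      IsUnit (g.eval₂ N.hom.toRingHom x) := by
  obtain ⟨k, hk⟩ := hg
  let P : StandardEtalePair R := ⟨f, hf, g, k, 0, 1, by rw [hk]; ring⟩
  let : Algebra O P.Ring := ((algebraMap R P.Ring).comp (algebraMap O R)).toAlgebra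
  have : IsScalarTower O R P.Ring := IsScalarTower.of_algebraMap_eq fun _ => rfl
  let : Algebra R K := σ.toRingHom.toAlgebra
  let ψ : P.Ring →ₐ[R] K := P.lift x₀ ⟨hx₀, IsUnit.mk0 _ hgx₀⟩
  let ψ' : P.Ring →ₐ[O] K :=
    { ψ.toRingHom with
      commutes' := fun x => (ψ.commutes (algebraMap O R x)).trans (σ.commutes x) }
  exact ⟨{ S := P.Ring
           point := ψ'
           point_comp := by ext x; exact ψ.commutes x }, P.X, P.hasMap_X.1, P.hasMap_X.2⟩

end EtaleNhd

end EtaleNhd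

section Split

open Quad

variable {O : Type uO} [CommRing O] {p τ : O} {R : Type uR} [CommRing R] [Algebra O R]
  {K : Type uK} [Field K] [Algebra O K]

theorem SimBy.isUnit_det_herm {ι κ : Type*} [Fintype ι] [Fintype κ] [DecidableEq ι] [DecidableEq κ]
    {B : Matrix ι ι (Quad p τ R)} {B' : Matrix κ κ (Quad p τ R)} (h : SimBy 1 B B')
    (hB : IsUnit (herm B).det) : IsUnit (herm B').det := by
  obtain ⟨g, g', h1, h2, h3⟩ := h
  rw [← Matrix.isUnit_iff_isUnit_det] at hB ⊢
  obtain ⟨H, hH⟩ := hB.exists_right_inv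
  have h4 : herm B' = gᴴ * herm B * g := by
    rw [← herm_congr, h3.1, Units.val_one, one_smul]
  apply IsUnit.of_mul_eq_one (b := g' * H * g'ᴴ)
  rw [h4]
  calc gᴴ * herm B * g * (g' * H * g'ᴴ) = gᴴ * (herm B * ((g * g') * H)) * g'ᴴ := by
        simp only [Matrix.mul_assoc]
    _ = 1 := by
        rw [h1, Matrix.one_mul, hH, Matrix.mul_one, ← conjTranspose_mul, h2, conjTranspose_one]

theorem exists_equiv_sum {k : ℕ} (i : Fin (k + 1)) : ∃ e : Unit ⊕ Fin k ≃ Fin (k + 1),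
    e (.inl ()) = i :=
  ⟨(((finSuccEquiv' i).trans (Equiv.optionEquivSumPUnit _)).trans (Equiv.sumComm _ _)).symm,
    by simp⟩

theorem exists_equiv_sum_sum {k : ℕ} {i j : Fin (k + 2)} (hij : i ≠ j) :
    ∃ e : (Unit ⊕ Unit) ⊕ Fin k ≃ Fin (k + 2), e (.inl (.inl ())) = i ∧
      e (.inl (.inr ())) = j := by
  obtain ⟨e, he⟩ := exists_equiv_sum i
  obtain ⟨j', hj'⟩ : ∃ j', e (.inr j') = j := by
    rcases h : e.symm j with u | j'
    · exact absurd (by rw [← he, ← e.apply_symm_apply j, h]) hij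
    · exact ⟨j', by rw [← h, e.apply_symm_apply]⟩
  obtain ⟨e', he'⟩ := exists_equiv_sum j'
  exact ⟨(Equiv.sumAssoc _ _ _).trans ((Equiv.sumCongr (Equiv.refl _) e').trans e), by simp [he],
    by simp [he', hj']⟩

/-- At a point where `2 ≠ 0`, a form with `h` unimodular has a basis on one of whose members `q`
does not vanish at that point. -/
theorem exists_tr_ne_zero {ι : Type*} [Fintype ι] [DecidableEq ι] [Nonempty ι] (σ : R →ₐ[O] K)
    (h2 : algebraMap O K 2 ≠ 0) (hp : p ∣ 2) {B : Matrix ι ι (Quad p τ R)}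
    (hB : IsUnit (herm B).det) :
    ∃ (g g' : Matrix ι ι (Quad p τ R)) (i : ι), g * g' = 1 ∧ g' * g = 1 ∧
      σ (tr ((gᴴ * B * g) i i)) ≠ 0 := by
  by_cases h : ∃ i, σ (tr (B i i)) ≠ 0
  · obtain ⟨i, hi⟩ := h
    exact ⟨1, 1, i, by simp, by simp, by simpa using hi⟩
  push Not at h
  have hp0 : algebraMap O K p ≠ 0 := fun h0 => h2 (by
    obtain ⟨k, hk⟩ := hp
    rw [hk, map_mul, h0, zero_mul])
  -- The value of `q` at `e_i + a e_j`.
  have key : ∀ (i j : ι) (a : Quad p τ R), i ≠ j →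
      tr (((1 + single j i a : Matrix ι ι (Quad p τ R))ᴴ * B *
          (1 + single j i a : Matrix ι ι (Quad p τ R))) i i)
        = tr (B i i) + a.norm * tr (B j j) + tr (herm B i j * a) := by
    intro i j a hij
    have e : ((1 + single j i a : Matrix ι ι (Quad p τ R))ᴴ * B *
          (1 + single j i a : Matrix ι ι (Quad p τ R))) i i
        = B i i + B i j * a + star a * B j i + star a * B j j * a := by
      simp only [conjTranspose_add, conjTranspose_one, conjTranspose_single, Matrix.add_mul,
        Matrix.mul_add, Matrix.one_mul, Matrix.mul_one, Matrix.add_apply, single_mul_apply_same,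
        mul_single_apply_same]
      ring
    rw [e, map_add, map_add, map_add, tr_star_mul_mul, herm_apply, sub_mul, map_sub]
    have := tr_ratio_mul_star (star a * B j i)
    rw [star_mul', star_star] at this
    rw [show ratio * star (B j i) * a = ratio * (a * star (B j i)) by ring, this]
    ring
  have hinv : ∀ (i j : ι) (a : Quad p τ R), i ≠ j →
      (1 + single j i a : Matrix ι ι (Quad p τ R)) * (1 + single j i (-a)) = 1 := by
    intro i j a hij
    have : single j i a * single j i (-a) = 0 := by
      rw [single_mul_single_of_ne _ _ _ _ hij]
    rw [Matrix.add_mul, Matrix.mul_add, Matrix.mul_add, this, Matrix.one_mul, Matrix.one_mul,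
      Matrix.mul_one, add_zero, add_assoc, ← single_add, neg_add_cancel, single_zero, add_zero]
  by_contra! hcon
  have hz : ∀ i j, Quad.map σ (herm B i j) = 0 := by
    intro i j
    by_cases hij : i = j
    · subst hij
      rw [herm_diag, map_mul, Quad.map_algebraMap, h, map_zero, zero_mul]
    · have hv : ∀ a : Quad p τ R, σ (tr (herm B i j * a)) = 0 := by
        intro a
        have h1 := hcon (1 + single j i a) (1 + single j i (-a)) i (hinv i j a hij)
          (by simpa using hinv i j (-a) hij)
        rw [key i j a hij, map_add σ, map_add σ, map_mul σ, h, h, mul_zero, zero_add,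
          zero_add] at h1
        exact h1
      have h1 := hv 1
      have h3 := hv QuadraticAlgebra.omega
      simp [tr_apply] at h1 h3
      have him : σ (herm B i j).im = 0 := by
        have : algebraMap O K p * σ (herm B i j).im = 0 := by
          linear_combination -h3 + algebraMap O K p * algebraMap O K τ * h1
        exact (mul_eq_zero.1 this).resolve_left hp0
      ext
      · rw [him] at h1
        simpa using h1
      · simpa using him
  have hd := hB.map (Quad.map σ)
  rw [RingHom.map_det, show (Quad.map σ).mapMatrix (herm B) = 0 by ext1 i j; exact hz i j,
    det_zero] at hd
  exact not_isUnit_zero hd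

/-- A hyperbolic plane splits off near a point at which `π₀` vanishes and `h` takes a unit value
off the diagonal. -/
theorem exists_hyp_of_re_ne_zero [IsAlgClosed K] (σ : R →ₐ[O] K) (h2 : algebraMap O K 2 = 0)
    (hp : algebraMap O K p = 0) {k : ℕ} {B : Matrix (Fin (k + 2)) (Fin (k + 2)) (Quad p τ R)}
    {i j : Fin (k + 2)} (hij : i ≠ j) (hB : σ (herm B i j).re ≠ 0) :
    ∃ (N : EtaleNhd σ) (C : Matrix (Fin k) (Fin k) (Quad p τ N.S)),
      SimBy 1 (B.map (Quad.map N.hom)) (fromBlocks (hypMat p τ N.S Unit) 0 0 C) := by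
  have hσp : σ (algebraMap O R p) = 0 := by rw [AlgHom.commutes, hp]
  obtain ⟨N₁, hN₁⟩ := EtaleNhd.exists_isUnit σ (r := (herm B i j).norm) (by
    rw [QuadraticAlgebra.norm_def]
    simpa [hp] using hB)
  obtain ⟨e, rfl, rfl⟩ := exists_equiv_sum_sum hij
  set B₁ := (B.map (Quad.map N₁.hom)).submatrix e e with hB₁
  have hu : IsUnit (herm B₁ (.inl (.inl ())) (.inl (.inr ()))) := by
    rw [isUnit_quad_iff]
    have : herm B₁ (.inl (.inl ())) (.inl (.inr ()))
        = Quad.map N₁.hom (herm B (e (.inl (.inl ()))) (e (.inl (.inr ())))) := by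
      rw [← map_apply (f := Quad.map N₁.hom), ← herm_map]; rfl
    rw [this, Quad.norm_map]
    exact hN₁
  obtain ⟨v, hv⟩ := hu.exists_right_inv
  set δ : N₁.S := tr (B₁ (.inl (.inl ())) (.inl (.inl ())))
      * (v.norm * tr (B₁ (.inl (.inr ())) (.inl (.inr ())))) with hδ
  set c : N₁.S := algebraMap O N₁.S (4 - p * τ * τ) with hc
  have h4 : algebraMap O K 4 = 0 := by
    rw [show (4 : O) = 2 * 2 by norm_num, map_mul, h2, mul_zero]
  have h2' : (2 : K) = 0 := by rw [← h2, map_ofNat]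
  have hcK : N₁.point c = 0 := by
    rw [hc, AlgHom.commutes, map_sub, map_mul, map_mul, hp, h4]; ring
  -- The roots are `x₀` and `-1 - x₀`; one of them differs from `-1`.
  obtain ⟨x₀, hx₀, hx₀'⟩ : ∃ x₀ : K, x₀ ^ 2 + x₀ + N₁.point δ = 0 ∧ 1 + x₀ ≠ 0 := by
    by_cases hδ0 : N₁.point δ = 0
    · exact ⟨0, by rw [hδ0]; ring, by simp⟩
    · obtain ⟨x₀, hx₀⟩ := IsAlgClosed.exists_eval₂_eq_zero (RingHom.id K)
        (Polynomial.X ^ 2 + Polynomial.X + Polynomial.C (N₁.point δ)) (by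
          have : (Polynomial.X ^ 2 + Polynomial.X + Polynomial.C (N₁.point δ)).degree = 2 := by
            compute_degree!
          rw [this]; norm_num)
      simp at hx₀
      refine ⟨x₀, hx₀, fun h => hδ0 ?_⟩
      linear_combination hx₀ - x₀ * h
  let f : Polynomial N₁.S := Polynomial.X ^ 2 + Polynomial.X + Polynomial.C δ
  have hf : f.Monic := by simp only [f]; monicity!
  let g : Polynomial N₁.S := Polynomial.derivative f * ((1 + Polynomial.X)
    * Polynomial.C (1 - c * δ))
  obtain ⟨N₂, x, hx, hgx⟩ := EtaleNhd.exists_root N₁.point hf (g := g) ⟨_, rfl⟩ (x₀ := x₀)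
    (by simpa [f] using hx₀) (by
      simp only [g, f, Polynomial.derivative_add, Polynomial.derivative_X_sq,
        Polynomial.derivative_X, Polynomial.derivative_C]
      simp [hcK]
      exact ⟨by rw [map_ofNat, h2']; simp, hx₀'⟩)
  have hx' : x ^ 2 + x + N₂.hom δ = 0 := by simpa [f] using hx
  simp only [g, Polynomial.eval₂_mul] at hgx
  have hgx2 := isUnit_of_mul_isUnit_right hgx
  have hx1 : IsUnit (1 + x) := by simpa using isUnit_of_mul_isUnit_left hgx2
  have hcu : IsUnit (1 - N₂.hom c * N₂.hom δ) := by
    simpa using isUnit_of_mul_isUnit_right hgx2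
  have hcN : N₂.hom c = algebraMap O N₂.S (4 - p * τ * τ) := AlgHom.commutes _ _
  rw [hcN] at hcu
  obtain ⟨C, hC⟩ := exists_simBy_hyp_of_root (B₁.map (Quad.map N₂.hom)) (v := Quad.map N₂.hom v)
    (by rw [herm_map, map_apply, ← map_mul, hv, map_one]) (δ := N₂.hom δ)
    (by simp only [hδ, map_mul, map_apply, tr_map, Quad.norm_map]) hx' hx1 hcu
  refine ⟨N₁.comp N₂, C, ?_⟩
  have h3 : SimBy 1 (B.map (Quad.map (N₁.comp N₂).hom)) (B₁.map (Quad.map N₂.hom)) :=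
    SimBy.submatrix (B.map (Quad.map (N₁.comp N₂).hom)) e
  have h5 : SimBy ((1 : N₂.Sˣ) * 1) (B.map (Quad.map (N₁.comp N₂).hom)) _ := SimBy.trans h3 hC
  exact (mul_one (1 : N₂.Sˣ)) ▸ h5

/-- A hyperbolic plane splits off near a point at which `2` and `4 - t² / π₀` do not vanish. -/
theorem exists_hyp_of_two_ne_zero [IsAlgClosed K] (σ : R →ₐ[O] K) (h2 : algebraMap O K 2 ≠ 0)
    (hp : p ∣ 2) (hc : algebraMap O K (4 - p * τ * τ) ≠ 0) {k : ℕ}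
    {B : Matrix (Fin (k + 2)) (Fin (k + 2)) (Quad p τ R)}
    (hB : σ (herm B).det.norm ≠ 0) :
    ∃ (N : EtaleNhd σ) (C : Matrix (Fin k) (Fin k) (Quad p τ N.S)),
      SimBy 1 (B.map (Quad.map N.hom)) (fromBlocks (hypMat p τ N.S Unit) 0 0 C) := by
  obtain ⟨N₁, hN₁⟩ := EtaleNhd.exists_isUnit σ
    (r := (herm B).det.norm * algebraMap O R (4 - p * τ * τ)) (by
      rw [map_mul, AlgHom.commutes]; exact mul_ne_zero hB hc)
  rw [map_mul, AlgHom.commutes] at hN₁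
  have hcu := isUnit_of_mul_isUnit_right hN₁
  set B₁ := B.map (Quad.map N₁.hom) with hB₁
  have hdet : IsUnit (herm B₁).det := by
    rw [isUnit_quad_iff, hB₁, herm_map,
      show ((herm B).map (Quad.map N₁.hom)).det = Quad.map N₁.hom (herm B).det from
        ((Quad.map N₁.hom).map_det _).symm, Quad.norm_map]
    exact isUnit_of_mul_isUnit_left hN₁
  -- Two steps of diagonalization give an orthogonal sum of two lines and a complement.
  obtain ⟨g, g', i, hg, hg', hi⟩ := exists_tr_ne_zero N₁.point h2 hp hdet
  have hs₁ : SimBy 1 B₁ (gᴴ * B₁ * g) := ⟨g, g', hg, hg', by simpa using GramEq.refl _⟩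
  have hdet₁ := hs₁.isUnit_det_herm hdet
  obtain ⟨e, rfl⟩ := exists_equiv_sum i
  obtain ⟨N₂, hN₂⟩ := EtaleNhd.exists_isUnit N₁.point hi
  set B₂ := ((gᴴ * B₁ * g).map (Quad.map N₂.hom)).submatrix e e with hB₂
  have hs₂ : SimBy 1 (B₁.map (Quad.map N₂.hom)) B₂ := by
    have := (hs₁.map N₂.hom).trans (SimBy.submatrix _ e)
    rw [map_one, mul_one] at this
    exact this
  have hdet₂ : IsUnit (herm (B₁.map (Quad.map N₂.hom))).det := by
    rw [herm_map]
    have := hdet.map (Quad.map N₂.hom)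
    rwa [RingHom.map_det] at this
  have hcu₂ : IsUnit (algebraMap O N₂.S (4 - p * τ * τ)) := by
    have := hcu.map N₂.hom
    rwa [AlgHom.commutes] at this
  have hα : IsUnit (tr (B₂ (.inl ()) (.inl ()))) := by
    have : tr (B₂ (.inl ()) (.inl ())) = N₂.hom (tr ((gᴴ * B₁ * g) (e (.inl ())) (e (.inl ())))) :=
      tr_map _ _
    rwa [this]
  obtain ⟨C, hC⟩ := exists_simBy_fromBlocks B₂ (by
    rw [Matrix.det_unique]
    change IsUnit (herm B₂ (.inl ()) (.inl ()))
    rw [herm_diag]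
    refine (hα.map _).mul ?_
    rw [isUnit_quad_iff, norm_one_sub_ratio]
    exact hcu₂)
  have hs₃ := hs₂.trans hC
  rw [mul_one] at hs₃
  have hdetC : IsUnit (herm C).det := by
    have := hs₃.isUnit_det_herm hdet₂
    rw [herm_fromBlocks, det_fromBlocks_zero₂₁] at this
    exact isUnit_of_mul_isUnit_right this
  obtain ⟨s, s', j, hs, hs', hj⟩ := exists_tr_ne_zero N₂.point h2 hp hdetC
  obtain ⟨e', rfl⟩ := exists_equiv_sum j
  have hs₄ := hs₃.trans ((SimBy.refl B₂.toBlocks₁₁).fromBlocks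
    (⟨s, s', hs, hs', by simpa using GramEq.refl _⟩ : SimBy 1 C (sᴴ * C * s)))
  rw [mul_one] at hs₄
  obtain ⟨N₃, hN₃⟩ := EtaleNhd.exists_isUnit N₂.point hj
  let E : (Unit ⊕ Unit) ⊕ Fin k ≃ Unit ⊕ Fin (k + 1) :=
    (Equiv.sumAssoc _ _ _).trans (Equiv.sumCongr (Equiv.refl _) e')
  set B₃ := ((fromBlocks B₂.toBlocks₁₁ 0 0 (sᴴ * C * s)).map (Quad.map N₃.hom)).submatrix E E
    with hB₃
  have hs₅ := (hs₄.map N₃.hom).trans (SimBy.submatrix _ E)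
  rw [← hB₃, map_one, mul_one] at hs₅
  have h00 : B₃ (.inl (.inl ())) (.inl (.inl ())) = Quad.map N₃.hom (B₂ (.inl ()) (.inl ())) := rfl
  have h11 : B₃ (.inl (.inr ())) (.inl (.inr ()))
      = Quad.map N₃.hom ((sᴴ * C * s) (e' (.inl ())) (e' (.inl ()))) := rfl
  have h01 : herm B₃ (.inl (.inl ())) (.inl (.inr ())) = 0 := by
    have : herm B₃ (.inl (.inl ())) (.inl (.inr ()))
      = Quad.map N₃.hom 0 - ratio * star (Quad.map N₃.hom 0) := rfl
    rw [this]; simp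
  have hu₀ : IsUnit (tr (B₃ (.inl (.inl ())) (.inl (.inl ())))) := by
    rw [h00, tr_map]; exact hα.map _
  have hu₁ : IsUnit (tr (B₃ (.inl (.inr ())) (.inl (.inr ())))) := by
    rw [h11, tr_map]; exact hN₃
  set δ := tr (B₃ (.inl (.inl ())) (.inl (.inl ()))) * tr (B₃ (.inl (.inr ())) (.inl (.inr ())))
    with hδ
  have hδ0 : N₃.point δ ≠ 0 := ((hu₀.mul hu₁).map N₃.point).ne_zero
  obtain ⟨x₀, hx₀⟩ := IsAlgClosed.exists_pow_nat_eq (-N₃.point δ) (n := 2) (by norm_num)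
  have hx₀' : x₀ ≠ 0 := by
    rintro rfl
    apply hδ0
    rw [zero_pow two_ne_zero] at hx₀
    linear_combination hx₀
  let f : Polynomial N₃.S := Polynomial.X ^ 2 + Polynomial.C δ
  have hf : f.Monic := by simp only [f]; monicity!
  obtain ⟨N₄, x, hx, -⟩ := EtaleNhd.exists_root N₃.point hf dvd_rfl (x₀ := x₀)
    (by simp [f, hx₀]) (by
      rw [map_ofNat] at h2
      have h2' : (1 + 1 : K) ≠ 0 := by rwa [one_add_one_eq_two]
      simpa [f, h2'] using hx₀')
  have hx' : x ^ 2 + N₄.hom δ = 0 := by simpa [f] using hx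
  obtain ⟨C', hC'⟩ := exists_simBy_hyp_of_sqrt (B₃.map (Quad.map N₄.hom)) (x := x)
    (by rw [herm_map, map_apply, h01, map_zero]) (by rw [map_apply, tr_map]; exact hu₀.map _)
    (by rw [map_apply, tr_map]; exact hu₁.map _)
    (by
      rw [map_apply, map_apply, tr_map, tr_map, ← map_mul, ← hδ]
      linear_combination hx')
    (by
      have := hcu₂.map (N₄.hom.comp N₃.hom)
      rwa [AlgHom.commutes] at this)
  refine ⟨((N₁.comp N₂).comp N₃).comp N₄, C', ?_⟩
  have hs₆ := (hs₅.map N₄.hom).trans hC'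
  rw [map_one, mul_one] at hs₆
  exact hs₆

end Split

section Classification

open Quad

theorem SimBy.of_gramEq_smul {O : Type uO} [CommRing O] {p τ : O} {R : Type uR} [CommRing R]
    [Algebra O R] {ι : Type*} [Fintype ι] [DecidableEq ι] {B B' : Matrix ι ι (Quad p τ R)} {u : Rˣ}
    (h : GramEq B ((u : R) • B')) : SimBy u B B' :=
  ⟨1, 1, by simp, by simp, by simpa using h⟩

theorem simBy_hypMat {O : Type uO} [CommRing O] {p τ : O} {R : Type uR} [CommRing R]
    [Algebra O R] (α : Type*) [Fintype α] [DecidableEq α] (u : Rˣ) :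
    SimBy u (hypMat p τ R α) (hypMat p τ R α) := by
  refine ⟨fromBlocks 1 0 0 (algebraMap R (Quad p τ R) u • 1),
    fromBlocks 1 0 0 (algebraMap R (Quad p τ R) ↑u⁻¹ • 1), ?_, ?_, ?_⟩
  · simp [fromBlocks_multiply, smul_smul]
  · simp [fromBlocks_multiply, smul_smul]
  · convert GramEq.refl _ using 1
    simp only [hypMat, fromBlocks_conjTranspose, fromBlocks_multiply, fromBlocks_smul]
    simp [Algebra.algebraMap_eq_smul_one]

/-- The standard form of rank `2 (m + 1) + 1` is the orthogonal sum of a hyperbolic plane and the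
standard form of rank `2 m + 1`. -/
theorem simBy_stdMat_succ {O : Type uO} [CommRing O] {p τ : O} {R : Type uR} [CommRing R]
    [Algebra O R] (m : ℕ) :
    SimBy 1 (fromBlocks (hypMat p τ R Unit) 0 0 (stdMat p τ R (Fin m)))
      (stdMat p τ R (Fin (m + 1))) := by
  obtain ⟨e, -⟩ := exists_equiv_sum (0 : Fin (m + 1))
  let E : (Unit ⊕ Unit) ⊕ ((Fin m ⊕ Fin m) ⊕ Unit) ≃ (Fin (m + 1) ⊕ Fin (m + 1)) ⊕ Unit :=
    ((Equiv.sumAssoc _ _ _).symm.trans (Equiv.sumCongr (Equiv.sumSumSumComm _ _ _ _)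
      (Equiv.refl Unit))).trans (Equiv.sumCongr (Equiv.sumCongr e e) (Equiv.refl _))
  have h := SimBy.submatrix (fromBlocks (hypMat p τ R Unit) 0 0 (stdMat p τ R (Fin m))) E.symm
  convert h using 1
  have : (stdMat p τ R (Fin (m + 1))).submatrix E E
      = fromBlocks (hypMat p τ R Unit) 0 0 (stdMat p τ R (Fin m)) := by
    ext1 i j
    rcases i with (i | i) | ((i | i) | i) <;> rcases j with (j | j) | ((j | j) | j) <;>
      simp [E, stdMat, hypMat, Matrix.one_apply]
  rw [← this]
  simp

variable {O : Type uO} {A : Type uA} [CommRing O] [CommRing A] [Algebra O A] (D : QuadDatum O A)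
variable {K : Type uK} [Field K] [Algebra O K] [IsAlgClosed K]

/-- A form whose divided discriminant is a unit is similar to the standard form near every
geometric point. -/
theorem exists_simBy_stdMat [IsDomain O] (hc : D.c ≠ 0) (hπ : D.π₀ ∣ 2) {k : ℕ}
    (h2 : 2 ∣ D.π₀ ^ k) (hc' : D.c ∣ D.π₀ ^ k) (m : ℕ) {R : Type uR} [CommRing R] [Algebra O R]
    (σ : R →ₐ[O] K) (B : Matrix (Fin (2 * m + 1)) (Fin (2 * m + 1)) (Quad D.π₀ D.τ R))
    (hB : IsUnit (matDisc D B)) :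
    ∃ (N : EtaleNhd σ) (u : N.Sˣ),
      SimBy u (B.map (Quad.map N.hom)) (stdMat D.π₀ D.τ N.S (Fin m)) := by
  induction m generalizing R with
  | zero =>
    rw [matDisc_one D hc] at hB
    have hu : IsUnit (tr (B 0 0)) := (isUnit_pow_iff two_ne_zero).1 hB
    obtain ⟨u, hu⟩ := hu
    refine ⟨EtaleNhd.self σ, u, ?_⟩
    let e : (Fin 0 ⊕ Fin 0) ⊕ Unit ≃ Fin (2 * 0 + 1) :=
      (Equiv.emptySum _ _).trans (Equiv.ofUnique Unit (Fin 1))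
    have h := (SimBy.submatrix B e).trans (SimBy.of_gramEq_smul (u := u)
      (B' := stdMat D.π₀ D.τ R (Fin 0)) (by
        have htr : ∀ i, tr ((B.submatrix e e) i i)
            = tr (((u : R) • stdMat D.π₀ D.τ R (Fin 0)) i i) := by
          rintro ((i | i) | i)
          · exact i.elim0
          · exact i.elim0
          · rw [Matrix.smul_apply, LinearMap.map_smul]
            simp only [stdMat, fromBlocks_apply₂₂, Matrix.one_apply_eq, tr_one, smul_eq_mul,
              mul_one, hu, submatrix_apply]
            congr 2
        refine ⟨?_, htr⟩
        ext1 i j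
        obtain rfl : i = j := by
          rcases i with (i | i) | i
          · exact i.elim0
          · exact i.elim0
          · rcases j with (j | j) | j
            · exact j.elim0
            · exact j.elim0
            · rfl
        rw [herm_diag, herm_diag, htr]))
    rw [one_mul] at h
    exact h
  | succ m ih =>
    have hcm : algebraMap O K D.c * σ (matDisc D B) = σ (herm B).det.norm := by
      rw [← c_mul_matDisc, map_mul, AlgHom.commutes]
    have hB' : σ (matDisc D B) ≠ 0 := (hB.map σ).ne_zero
    have hsplit : ∃ (N : EtaleNhd σ) (C : Matrix (Fin (2 * m + 1)) (Fin (2 * m + 1))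
        (Quad D.π₀ D.τ N.S)), SimBy 1 (B.map (Quad.map N.hom))
          (fromBlocks (hypMat D.π₀ D.τ N.S Unit) 0 0 C) := by
      by_cases hp : algebraMap O K D.π₀ = 0
      · have h2K : algebraMap O K 2 = 0 := by
          obtain ⟨x, hx⟩ := hπ
          rw [hx, map_mul, hp, zero_mul]
        obtain ⟨i, j, hij, hne⟩ : ∃ i j, i ≠ j ∧ σ (herm B i j).re ≠ 0 := by
          by_contra! hcon
          apply hB'
          rw [← matDisc_map]
          refine matDisc_eq_zero D hc hπ hp (by omega) fun i j hij => ?_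
          rw [herm_map]
          exact hcon i j hij
        exact exists_hyp_of_re_ne_zero σ h2K hp (k := 2 * m + 1) hij hne
      · have hu : ∀ x : O, x ∣ D.π₀ ^ k → algebraMap O K x ≠ 0 := by
          rintro x ⟨y, hy⟩ hx
          have := congrArg (algebraMap O K) hy
          rw [map_pow, map_mul, hx] at this
          exact hp (eq_zero_of_pow_eq_zero (this.trans (zero_mul _)))
        have hcc : D.c = 4 - D.π₀ * D.τ * D.τ := rfl
        exact exists_hyp_of_two_ne_zero σ (hu 2 h2) hπ (hcc ▸ hu _ hc') (k := 2 * m + 1)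
          (by rw [← hcm]; exact mul_ne_zero (hu _ hc') hB')
    obtain ⟨N₁, C, hC⟩ := hsplit
    have hCu : IsUnit (matDisc D C) := by
      refine (isUnit_matDisc_of_simBy D hc (m' := m + 1) (Fintype.equivOfCardEq (by
        simp; omega)) hC ?_).2
      rw [matDisc_map]
      exact hB.map _
    obtain ⟨N₂, u, hu⟩ := ih N₁.point C hCu
    refine ⟨N₁.comp N₂, u, ?_⟩
    have h1 := hC.map N₂.hom
    have h3 : (fromBlocks (hypMat D.π₀ D.τ N₁.S Unit) 0 0 C).map (Quad.map N₂.hom)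
        = fromBlocks (hypMat D.π₀ D.τ N₂.S Unit) 0 0 (C.map (Quad.map N₂.hom)) := by
      rw [fromBlocks_map]
      congr 1
      · ext1 i j
        rcases i with i | i <;> rcases j with j | j <;> simp [hypMat]
      · ext1 i j; simp
      · ext1 i j; simp
    rw [h3, map_one] at h1
    have h4 := (h1.trans ((simBy_hypMat Unit u).fromBlocks hu)).trans (simBy_stdMat_succ m)
    rw [one_mul, mul_one] at h4
    exact h4

end Classification

/-! ### The identities of a form module and base change -/

section FormModules

variable {O : Type uO} {A : Type uA} [CommRing O] [CommRing A] [Algebra O A] (D : QuadDatum O A)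
variable {R : Type uR} [CommRing R] [Algebra O R]
variable (S : Type uS) [CommRing S] [Algebra R S] [Algebra O S] [IsScalarTower O R S]

namespace QuadDatum

variable (R) in
/-- The element `π` of `R ⊗ A`. -/
noncomputable def piR : R ⊗[O] A := (1 : R) ⊗ₜ[O] D.π

theorem tmul_algebraMap (x : O) :
    (1 : R) ⊗ₜ[O] algebraMap O A x = algebraMap R (R ⊗[O] A) (algebraMap O R x) := by
  rw [← IsScalarTower.algebraMap_apply O R (R ⊗[O] A), ← Algebra.TensorProduct.algebraMap_apply']

theorem one_tmul_conj :
    (1 : R) ⊗ₜ[O] D.conj D.π = algebraMap R _ (algebraMap O R (D.π₀ * D.τ)) - D.piR R := by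
  rw [← tmul_algebraMap (A := A), ← D.add_conj, TensorProduct.tmul_add, piR, add_sub_cancel_left]

theorem one_tmul_ratio :
    (1 : R) ⊗ₜ[O] D.ratio
      = algebraMap R _ (algebraMap O R D.τ) * (1 : R) ⊗ₜ[O] D.conj D.π - 1 := by
  rw [← tmul_algebraMap (A := A), Algebra.TensorProduct.tmul_mul_tmul, one_mul, ratio,
    TensorProduct.tmul_sub]
  rfl

theorem piR_mul_piR :
    D.piR R * D.piR R = algebraMap R _ (algebraMap O R (D.π₀ * D.τ)) * D.piR R
      - algebraMap R _ (algebraMap O R D.π₀) := by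
  have h : D.piR R * (1 : R) ⊗ₜ[O] D.conj D.π = algebraMap R _ (algebraMap O R D.π₀) := by
    rw [piR, Algebra.TensorProduct.tmul_mul_tmul, one_mul, D.mul_conj, tmul_algebraMap]
  rw [one_tmul_conj] at h
  linear_combination -h

theorem eq_add_piR (a : R ⊗[O] A) :
    a = algebraMap R _ (D.coord R 0 a) + algebraMap R _ (D.coord R 1 a) * D.piR R := by
  have := D.eq_coord R a
  rwa [Algebra.smul_def, Algebra.smul_def, mul_one] at this

theorem coord_zero_add (r s : R) :
    D.coord R 0 (algebraMap R _ r + algebraMap R _ s * D.piR R) = r := by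
  rw [← Algebra.smul_def, Algebra.algebraMap_eq_smul_one, map_add, map_smul, map_smul,
    D.coord_zero_one, piR, D.coord_zero_π]; simp

theorem coord_one_add (r s : R) :
    D.coord R 1 (algebraMap R _ r + algebraMap R _ s * D.piR R) = s := by
  rw [← Algebra.smul_def, Algebra.algebraMap_eq_smul_one, map_add, map_smul, map_smul,
    D.coord_one_one, piR, D.coord_one_π]; simp

variable (R) in
/-- The isomorphism of `R ⊗ A` with `R[ω]` sending `π` to `ω`. -/
noncomputable def toQuad : R ⊗[O] A ≃+* Quad D.π₀ D.τ R where
  toFun a := ⟨D.coord R 0 a, D.coord R 1 a⟩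
  invFun z := algebraMap R _ z.re + algebraMap R _ z.im * D.piR R
  left_inv a := (D.eq_add_piR a).symm
  right_inv z := by
    ext
    · exact D.coord_zero_add _ _
    · exact D.coord_one_add _ _
  map_add' a b := by ext <;> simp
  map_mul' a b := by
    have h : a * b = algebraMap R _ (D.coord R 0 a * D.coord R 0 b
          - algebraMap O R D.π₀ * (D.coord R 1 a * D.coord R 1 b))
        + algebraMap R _ (D.coord R 0 a * D.coord R 1 b + D.coord R 1 a * D.coord R 0 b
          + algebraMap O R (D.π₀ * D.τ) * (D.coord R 1 a * D.coord R 1 b)) * D.piR R := by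
      nth_rewrite 1 [D.eq_add_piR a, D.eq_add_piR b]
      simp only [(algebraMap R (R ⊗[O] A)).map_add, (algebraMap R (R ⊗[O] A)).map_mul,
        (algebraMap R (R ⊗[O] A)).map_sub]
      linear_combination (algebraMap R _ (D.coord R 1 a)) * (algebraMap R _ (D.coord R 1 b))
        * D.piR_mul_piR (R := R)
    ext
    · rw [h, D.coord_zero_add, QuadraticAlgebra.re_mul]; ring
    · rw [h, D.coord_one_add, QuadraticAlgebra.im_mul]; ring

theorem toQuad_piR : D.toQuad R (D.piR R) = QuadraticAlgebra.omega := by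
  ext
  · exact D.coord_zero_π R
  · exact D.coord_one_π R

theorem toQuad_algebraMap (r : R) : D.toQuad R (algebraMap R _ r) = algebraMap R _ r := by
  ext
  · change D.coord R 0 _ = _
    rw [Algebra.algebraMap_eq_smul_one, map_smul, coord_zero_one]; simp
  · change D.coord R 1 _ = _
    rw [Algebra.algebraMap_eq_smul_one, map_smul, coord_one_one]; simp

theorem toQuad_conj : D.toQuad R ((1 : R) ⊗ₜ[O] D.conj D.π) = star QuadraticAlgebra.omega := by
  rw [one_tmul_conj, map_sub, toQuad_algebraMap, toQuad_piR]
  ext <;> simp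

theorem toQuad_ratio : D.toQuad R ((1 : R) ⊗ₜ[O] D.ratio) = Quad.ratio := by
  rw [one_tmul_ratio, map_sub, map_one, (D.toQuad R).map_mul, toQuad_algebraMap, toQuad_conj]
  rfl

end QuadDatum

namespace FormModule

/-- The identities satisfied by a hermitian quadratic module with `φ`, without the conditions on the
underlying modules. The rule `q (a x) = N(a) q x` is required only for `a = π`, from which it
follows in general; in this form the identities are easily seen to be stable under base change. -/
structure HermAxioms (X : FormModule.{uO, uA, uR, uM, uL} O A R) : Prop where
  q_π : ∀ x, X.q (D.piR R • x) = algebraMap O R D.π₀ • X.q x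
  φ_π_right : ∀ x y, X.φ x (D.piR R • y) = QuadraticMap.polar X.q x y
  φ_π_left : ∀ x y, X.φ (D.piR R • x) y = X.φ x (((1 : R) ⊗ₜ[O] D.conj D.π) • y)
  φ_swap : ∀ x y, X.φ x y = X.φ (((1 : R) ⊗ₜ[O] D.ratio) • y) x
  φ_self : ∀ x, X.φ x x = algebraMap O R D.τ • X.q x

variable {D}

theorem IsHermitian.hermAxioms {d : ℕ} {X : FormModule.{uO, uA, uR, uM, uL} O A R}
    (h : X.IsHermitian D d) : X.HermAxioms D where
  q_π x := by
    rw [h.q_smul]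
    congr 1
    have h1 : D.conjR R (D.piR R) = (1 : R) ⊗ₜ[O] D.conj D.π := rfl
    rw [QuadDatum.normR, h1, QuadDatum.piR, Algebra.TensorProduct.tmul_mul_tmul, one_mul,
      D.mul_conj, QuadDatum.tmul_algebraMap, Algebra.algebraMap_eq_smul_one, map_smul,
      D.coord_zero_one, smul_eq_mul, mul_one]
  φ_π_right := h.φ_π_right
  φ_π_left := h.φ_π_left
  φ_swap := h.φ_swap
  φ_self := h.φ_self

namespace HermAxioms

variable {X : FormModule.{uO, uA, uR, uM, uL} O A R}

theorem q_add (h : X.HermAxioms D) (x y : X.M) :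
    X.q (x + y) = X.q x + X.q y + X.φ x (D.piR R • y) := by
  rw [h.φ_π_right, QuadraticMap.polar]; abel

theorem φ_add_swap (h : X.HermAxioms D) (x y : X.M) :
    X.φ x y + X.φ y x = algebraMap O R D.τ • X.φ x (D.piR R • y) := by
  have e : X.φ (((1 : R) ⊗ₜ[O] D.conj D.π) • x) y = X.φ x (D.piR R • y) := by
    have h1 := h.φ_π_left x y
    rw [QuadDatum.one_tmul_conj, sub_smul, algebraMap_smul (R ⊗[O] A), map_sub,
      (X.φ _).map_smul] at h1
    rw [QuadDatum.one_tmul_conj, sub_smul, algebraMap_smul (R ⊗[O] A), map_sub,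
      X.φ.map_smul, LinearMap.sub_apply, LinearMap.smul_apply, h1, sub_sub_cancel]
  rw [h.φ_swap y x, QuadDatum.one_tmul_ratio, sub_smul, mul_smul, algebraMap_smul (R ⊗[O] A),
    one_smul, map_sub, map_smul, LinearMap.sub_apply, LinearMap.smul_apply, e, add_sub_cancel]

/-- The polar form of `q` at `π x` and `π y`. -/
theorem polar_π (h : X.HermAxioms D) (x y : X.M) :
    X.φ (D.piR R • x) (D.piR R • (D.piR R • y))
      = algebraMap O R D.π₀ • X.φ x (D.piR R • y) := by
  have e : (1 : R) ⊗ₜ[O] D.conj D.π * D.piR R = algebraMap R _ (algebraMap O R D.π₀) := by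
    rw [QuadDatum.piR, Algebra.TensorProduct.tmul_mul_tmul, one_mul, mul_comm, D.mul_conj,
      QuadDatum.tmul_algebraMap]
  rw [h.φ_π_left, smul_smul, e, algebraMap_smul, (X.φ _).map_smul]

end HermAxioms

section BaseChange

variable (X : FormModule.{uO, uA, uR, uM, uL} O A R)

/-- The module underlying a base change. -/
noncomputable def bcM : S ⊗[R] X.M ≃ₗ[S] (X.baseChange S).M := LinearEquiv.refl S (S ⊗[R] X.M)

/-- The module of values of a base change. -/
noncomputable def bcL : S ⊗[R] X.L ≃ₗ[S] (X.baseChange S).L := LinearEquiv.refl S (S ⊗[R] X.L)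

theorem bcM_smul (a : A) (s : S) (m : X.M) :
    ((1 : S) ⊗ₜ[O] a) • X.bcM S (s ⊗ₜ m) = X.bcM S (s ⊗ₜ (((1 : R) ⊗ₜ[O] a) • m)) := by
  change X.tensorAction S (1 ⊗ₜ a) (s ⊗ₜ m) = s ⊗ₜ (((1 : R) ⊗ₜ[O] a) • m)
  have : X.tensorAction S (1 ⊗ₜ a) = X.scalarAction S a :=
    (Algebra.TensorProduct.lift_tmul _ _ _ _ _).trans (by rw [map_one, one_mul])
  rw [this]
  rfl

theorem bc_q (z : S ⊗[R] X.M) :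
    (X.baseChange S).q (X.bcM S z) = X.bcL S (X.q.scalarExtension S z) := rfl

theorem bc_q_tmul (s : S) (x : X.M) :
    (X.baseChange S).q (X.bcM S (s ⊗ₜ x)) = X.bcL S ((s * s) ⊗ₜ X.q x) := by
  rw [bc_q, QuadraticMap.scalarExtension_tmul]

theorem bc_φ_tmul (s s' : S) (x y : X.M) :
    (X.baseChange S).φ (X.bcM S (s ⊗ₜ x)) (X.bcM S (s' ⊗ₜ y))
      = X.bcL S ((s * s') ⊗ₜ X.φ x y) := LinearMap.BilinMap.baseChange_tmul _ _ _ _ _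

/-- Induction over a base change. -/
theorem bc_induction {P : (X.baseChange S).M → Prop} (z : (X.baseChange S).M)
    (h0 : P 0) (ht : ∀ s x, P (X.bcM S (s ⊗ₜ x))) (ha : ∀ x y, P x → P y → P (x + y)) : P z := by
  obtain ⟨z, rfl⟩ := (X.bcM S).surjective z
  induction z with
  | zero => simpa using h0
  | tmul s x => exact ht s x
  | add x y hx hy => rw [map_add]; exact ha _ _ hx hy

theorem bc_polar_tmul (s s' : S) (x y : X.M) :
    QuadraticMap.polar (X.baseChange S).q (X.bcM S (s ⊗ₜ x)) (X.bcM S (s' ⊗ₜ y))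
      = X.bcL S ((s * s') ⊗ₜ QuadraticMap.polar X.q x y) := by
  have e : ∀ (s : S) (x : X.M), X.bcM S (s ⊗ₜ x) = s • X.bcM S (1 ⊗ₜ x) := fun s x => by
    rw [← map_smul, TensorProduct.smul_tmul', smul_eq_mul, mul_one]
  rw [e s, e s', QuadraticMap.polar_smul_left, QuadraticMap.polar_smul_right,
    QuadraticMap.polar, ← map_add, ← TensorProduct.tmul_add, bc_q_tmul, bc_q_tmul, bc_q_tmul,
    ← map_sub, ← map_sub, ← TensorProduct.tmul_sub, ← TensorProduct.tmul_sub, ← map_smul,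
    ← map_smul, TensorProduct.smul_tmul', TensorProduct.smul_tmul', QuadraticMap.polar]
  simp

variable {X}

theorem HermAxioms.baseChange (h : X.HermAxioms D) : (X.baseChange S).HermAxioms D := by
  have hO : ∀ (x : O) (s : S) (y : X.L), algebraMap O S x • X.bcL S (s ⊗ₜ y)
      = X.bcL S (s ⊗ₜ (algebraMap O R x • y)) := fun x s y => by
    rw [← map_smul, TensorProduct.smul_tmul', TensorProduct.tmul_smul,
      IsScalarTower.algebraMap_apply O R S, algebraMap_smul, TensorProduct.smul_tmul']
  have h2 : ∀ x y, (X.baseChange S).φ x (D.piR S • y)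
      = QuadraticMap.polar (X.baseChange S).q x y := by
    intro x y
    induction x using X.bc_induction S with
    | h0 => simp
    | ha x x' hx hx' => rw [map_add, LinearMap.add_apply, hx, hx', QuadraticMap.polar_add_left]
    | ht s x =>
      induction y using X.bc_induction S with
      | h0 => simp
      | ha y y' hy hy' => rw [smul_add, map_add, hy, hy', QuadraticMap.polar_add_right]
      | ht s' y =>
        rw [QuadDatum.piR, bcM_smul, bc_φ_tmul, bc_polar_tmul, ← h.φ_π_right]; rfl
  have h3 : ∀ x y, (X.baseChange S).φ (D.piR S • x) y
      = (X.baseChange S).φ x (((1 : S) ⊗ₜ[O] D.conj D.π) • y) := by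
    intro x y
    induction x using X.bc_induction S with
    | h0 => simp
    | ha x x' hx hx' => simp only [smul_add, map_add, LinearMap.add_apply, hx, hx']
    | ht s x =>
      induction y using X.bc_induction S with
      | h0 => simp
      | ha y y' hy hy' => simp only [smul_add, map_add, hy, hy']
      | ht s' y =>
        rw [QuadDatum.piR, bcM_smul, bcM_smul, bc_φ_tmul, bc_φ_tmul, ← h.φ_π_left]; rfl
  have h4 : ∀ x y, (X.baseChange S).φ x y
      = (X.baseChange S).φ (((1 : S) ⊗ₜ[O] D.ratio) • y) x := by
    intro x y
    induction x using X.bc_induction S with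
    | h0 => simp
    | ha x x' hx hx' => simp only [map_add, LinearMap.add_apply, hx, hx']
    | ht s x =>
      induction y using X.bc_induction S with
      | h0 => simp
      | ha y y' hy hy' => simp only [smul_add, map_add, LinearMap.add_apply, hy, hy']
      | ht s' y =>
        rw [bcM_smul, bc_φ_tmul, bc_φ_tmul, ← h.φ_swap, mul_comm]
  have hadd : ∀ x y, (X.baseChange S).φ x y + (X.baseChange S).φ y x
      = algebraMap O S D.τ • (X.baseChange S).φ x (D.piR S • y) := by
    intro x y
    induction x using X.bc_induction S with
    | h0 => simp
    | ha x x' hx hx' =>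
      simp only [map_add, LinearMap.add_apply, smul_add, ← hx, ← hx']; abel
    | ht s x =>
      induction y using X.bc_induction S with
      | h0 => simp
      | ha y y' hy hy' => simp only [smul_add, map_add, LinearMap.add_apply, ← hy, ← hy']; abel
      | ht s' y =>
        rw [QuadDatum.piR, bcM_smul, bc_φ_tmul, bc_φ_tmul, bc_φ_tmul, hO, mul_comm s s',
          ← map_add, ← TensorProduct.tmul_add, h.φ_add_swap]; rfl
  have hππ : ∀ x y, (X.baseChange S).φ (D.piR S • x) (D.piR S • (D.piR S • y))
      = algebraMap O S D.π₀ • (X.baseChange S).φ x (D.piR S • y) := by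
    intro x y
    induction x using X.bc_induction S with
    | h0 => simp
    | ha x x' hx hx' => simp only [map_add, LinearMap.add_apply, smul_add, hx, hx']
    | ht s x =>
      induction y using X.bc_induction S with
      | h0 => simp
      | ha y y' hy hy' => simp only [smul_add, map_add, hy, hy']
      | ht s' y =>
        have := h.polar_π x y
        simp only [QuadDatum.piR] at this ⊢
        rw [bcM_smul, bcM_smul, bcM_smul, bc_φ_tmul, bc_φ_tmul, hO, this]
  have hq : ∀ x y, (X.baseChange S).q (x + y) = (X.baseChange S).q x + (X.baseChange S).q y
      + (X.baseChange S).φ x (D.piR S • y) := by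
    intro x y
    rw [h2, QuadraticMap.polar]; abel
  refine ⟨fun x => ?_, h2, h3, h4, fun x => ?_⟩
  · induction x using X.bc_induction S with
    | h0 => simp
    | ha x x' hx hx' => rw [smul_add, hq, hq, hx, hx', hππ, smul_add, smul_add]
    | ht s x =>
      have := h.q_π x
      rw [QuadDatum.piR] at this ⊢
      rw [bcM_smul, bc_q_tmul, bc_q_tmul, this, hO]
  · induction x using X.bc_induction S with
    | h0 => simp
    | ha x x' hx hx' =>
      rw [hq, smul_add, smul_add, ← hx, ← hx', ← hadd]
      simp only [map_add, LinearMap.add_apply]; abel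
    | ht s x => rw [bc_φ_tmul, bc_q_tmul, h.φ_self, hO]

end BaseChange

end FormModule

end FormModules

/-! ### Similarity of form modules -/

section FormModules

variable {O : Type uO} {A : Type uA} [CommRing O] [CommRing A] [Algebra O A] {D : QuadDatum O A}
variable {R : Type uR} [CommRing R] [Algebra O R]

namespace FormModule

section Similar

variable {X : FormModule.{uO, uA, uR, uM, uL} O A R} {Y : FormModule.{uO, uA, uR, uM', uL'} O A R}
  {Z : FormModule.{uO, uA, uR, uM'', uL''} O A R}

theorem Similar.symm (h : X.Similar Y) : Y.Similar X := by
  obtain ⟨f, γ, hq, hφ⟩ := h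
  refine ⟨f.symm, γ.symm, fun x => ?_, fun x y => ?_⟩
  · rw [LinearEquiv.eq_symm_apply, ← hq, f.apply_symm_apply]
  · rw [LinearEquiv.eq_symm_apply, ← hφ, f.apply_symm_apply, f.apply_symm_apply]

theorem Similar.trans (h : X.Similar Y) (h' : Y.Similar Z) : X.Similar Z := by
  obtain ⟨f, γ, hq, hφ⟩ := h
  obtain ⟨f', γ', hq', hφ'⟩ := h'
  exact ⟨f.trans f', γ.trans γ', fun x => by simp [hq, hq'], fun x y => by simp [hφ, hφ']⟩

variable (D) in
/-- It suffices to give an `R`-linear isomorphism that commutes with `π`. -/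
theorem Similar.of_linear (f : X.M ≃ₗ[R] Y.M) (γ : X.L ≃ₗ[R] Y.L)
    (hπ : ∀ x, f (D.piR R • x) = D.piR R • f x) (hq : ∀ x, Y.q (f x) = γ (X.q x))
    (hφ : ∀ x y, Y.φ (f x) (f y) = γ (X.φ x y)) : X.Similar Y := by
  refine ⟨{ f with map_smul' := fun a x => ?_ }, γ, hq, hφ⟩
  change f (a • x) = a • f x
  rw [D.eq_add_piR a, add_smul, add_smul, mul_smul, mul_smul, algebraMap_smul, algebraMap_smul,
    algebraMap_smul, algebraMap_smul, map_add, map_smul, map_smul, hπ]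

variable (f : X.M →ₗ[R] Y.M) (γ : X.L →ₗ[R] Y.L) (hπ : ∀ x, f (D.piR R • x) = D.piR R • f x)

include hπ in
/-- Compatibility of a map with `φ` and `q` can be checked on generators. -/
theorem HermAxioms.eq_of_span (hX : X.HermAxioms D) (hY : Y.HermAxioms D) {ι : Type*} (e : ι → X.M)
    (he : Submodule.span (R ⊗[O] A) (Set.range e) = ⊤) (hq : ∀ i, Y.q (f (e i)) = γ (X.q (e i)))
    (hφ : ∀ i j, Y.φ (f (e i)) (f (e j)) = γ (X.φ (e i) (e j)))
    (hφπ : ∀ i j, Y.φ (f (e i)) (f (D.piR R • e j)) = γ (X.φ (e i) (D.piR R • e j))) :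
    (∀ x, Y.q (f x) = γ (X.q x)) ∧ ∀ x y, Y.φ (f x) (f y) = γ (X.φ x y) := by
  have hs : ∀ (P : X.M → Prop), (∀ i, P (e i)) → P 0 → (∀ x y, P x → P y → P (x + y)) →
      (∀ (r : R) x, P x → P (r • x)) → (∀ x, P x → P (D.piR R • x)) → ∀ x, P x := by
    intro P h1 h2 h3 h4 h5 x
    have hx : x ∈ Submodule.span (R ⊗[O] A) (Set.range e) := by rw [he]; trivial
    induction hx using Submodule.span_induction with
    | mem x hx => obtain ⟨i, rfl⟩ := hx; exact h1 i
    | zero => exact h2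
    | add x y _ _ hx hy => exact h3 x y hx hy
    | smul a x _ hx =>
      rw [D.eq_add_piR a, add_smul, mul_smul, algebraMap_smul, algebraMap_smul]
      exact h3 _ _ (h4 _ _ hx) (h4 _ _ (h5 _ hx))
  have h1 : ∀ i y, Y.φ (f (e i)) (f y) = γ (X.φ (e i) y) ∧
      Y.φ (f (e i)) (f (D.piR R • y)) = γ (X.φ (e i) (D.piR R • y)) := by
    intro i
    apply hs
    · exact fun j => ⟨hφ i j, hφπ i j⟩
    · simp
    · intro x y hx hy
      simp only [smul_add, map_add, hx.1, hx.2, hy.1, hy.2, and_self]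
    · intro r x hx
      simp only [smul_comm (D.piR R) r, map_smul, hx.1, hx.2, and_self]
    · intro x hx
      refine ⟨hx.2, ?_⟩
      rw [smul_smul, D.piR_mul_piR, sub_smul, mul_smul, algebraMap_smul (R ⊗[O] A),
        algebraMap_smul (R ⊗[O] A)]
      simp only [map_sub, map_smul, hx.1, hx.2]
  have h2 : ∀ x y, Y.φ (f x) (f y) = γ (X.φ x y) := by
    apply hs
    · exact fun i y => (h1 i y).1
    · simp
    · intro x y hx hy z
      simp only [map_add, LinearMap.add_apply, hx, hy]
    · intro r x hx z
      simp only [map_smul, LinearMap.smul_apply, hx]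
    · intro x hx z
      rw [hX.φ_π_left, ← hx, hπ, hY.φ_π_left, D.one_tmul_conj]
      simp only [sub_smul, algebraMap_smul (R ⊗[O] A), map_sub, map_smul, hπ]
  refine ⟨?_, h2⟩
  apply hs
  · exact hq
  · simp
  · intro x y hx hy
    rw [map_add, hY.q_add, hX.q_add, ← hπ, h2, hx, hy, map_add, map_add]
  · intro r x hx
    rw [map_smul, QuadraticMap.map_smul, QuadraticMap.map_smul, hx, map_smul]
  · intro x hx
    rw [hπ, hY.q_π, hX.q_π, hx, map_smul]

/-- Two modules with bases on which the forms take the same values are similar. -/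
theorem HermAxioms.similar_of_basis (hX : X.HermAxioms D) (hY : Y.HermAxioms D) {ι : Type*}
    (e : Module.Basis ι (R ⊗[O] A) X.M) (e' : Module.Basis ι (R ⊗[O] A) Y.M) (γ : X.L ≃ₗ[R] Y.L)
    (hq : ∀ i, Y.q (e' i) = γ (X.q (e i)))
    (hφ : ∀ i j, Y.φ (e' i) (e' j) = γ (X.φ (e i) (e j)))
    (hφπ : ∀ i j, Y.φ (e' i) (D.piR R • e' j) = γ (X.φ (e i) (D.piR R • e j))) : X.Similar Y := by
  let f : X.M ≃ₗ[R ⊗[O] A] Y.M := e.equiv e' (Equiv.refl ι)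
  have hf : ∀ i, f (e i) = e' i := fun i => by simp [f]
  have h := hX.eq_of_span (f.restrictScalars R).toLinearMap γ.toLinearMap (fun x => map_smul f _ x)
    hY e e.span_eq (fun i => by simpa [hf] using hq i) (fun i j => by simpa [hf] using hφ i j)
    (fun i j => by simpa [hf] using hφπ i j)
  exact ⟨f, γ, h.1, h.2⟩

theorem HermAxioms.of_similar (hX : X.HermAxioms D) (h : X.Similar Y) : Y.HermAxioms D := by
  obtain ⟨f, γ, hq, hφ⟩ := h.symm
  have hp : ∀ x y, γ (QuadraticMap.polar Y.q x y) = QuadraticMap.polar X.q (f x) (f y) := by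
    intro x y
    simp only [QuadraticMap.polar, map_sub, ← hq, map_add]
  refine ⟨fun x => γ.injective ?_, fun x y => γ.injective ?_, fun x y => γ.injective ?_,
    fun x y => γ.injective ?_, fun x => γ.injective ?_⟩
  · rw [← hq, map_smul f, hX.q_π, hq, map_smul]
  · rw [hp, ← hφ, map_smul f, hX.φ_π_right]
  · rw [← hφ, ← hφ, map_smul f, map_smul f, hX.φ_π_left]
  · rw [← hφ, ← hφ, map_smul f, hX.φ_swap]
  · rw [map_smul, ← hφ, ← hq, hX.φ_self]

end Similar

section BaseChange

variable {S : Type uS} [CommRing S] [Algebra R S] [Algebra O S] [IsScalarTower O R S]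
variable {X : FormModule.{uO, uA, uR, uM, uL} O A R}

/-- A base change is similar to a module over `S` if the forms agree on elements of `M`. -/
theorem HermAxioms.similar_baseChange {Y : FormModule.{uO, uA, uS, uM', uL'} O A S}
    (hX : X.HermAxioms D) (hY : Y.HermAxioms D) (E : S ⊗[R] X.M ≃ₗ[S] Y.M)
    (γ : S ⊗[R] X.L ≃ₗ[S] Y.L)
    (hπ : ∀ x, E (1 ⊗ₜ (D.piR R • x)) = D.piR S • E (1 ⊗ₜ x))
    (hq : ∀ x, Y.q (E (1 ⊗ₜ x)) = γ (1 ⊗ₜ X.q x))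
    (hφ : ∀ x y, Y.φ (E (1 ⊗ₜ x)) (E (1 ⊗ₜ y)) = γ (1 ⊗ₜ X.φ x y)) :
    (X.baseChange S).Similar Y := by
  let f : (X.baseChange S).M ≃ₗ[S] Y.M := (X.bcM S).symm.trans E
  let g : (X.baseChange S).L ≃ₗ[S] Y.L := (X.bcL S).symm.trans γ
  have hs : ∀ {N : Type uM} [AddCommGroup N] [Module R N] (s : S) (x : N),
      s ⊗ₜ[R] x = s • ((1 : S) ⊗ₜ[R] x) := fun s x => by
    rw [TensorProduct.smul_tmul', smul_eq_mul, mul_one]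
  have hs' : ∀ {N : Type uL} [AddCommGroup N] [Module R N] (s : S) (x : N),
      s ⊗ₜ[R] x = s • ((1 : S) ⊗ₜ[R] x) := fun s x => by
    rw [TensorProduct.smul_tmul', smul_eq_mul, mul_one]
  have hf : ∀ (s : S) x, f (X.bcM S (s ⊗ₜ x)) = s • E (1 ⊗ₜ x) := fun s x => by
    rw [← map_smul, ← hs]; simp [f]
  have hg : ∀ (s : S) x, g (X.bcL S (s ⊗ₜ x)) = s • γ (1 ⊗ₜ x) := fun s x => by
    rw [← map_smul, ← hs']; simp [g]
  have hfπ : ∀ x, f (D.piR S • x) = D.piR S • f x := by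
    intro x
    induction x using X.bc_induction S with
    | h0 => simp
    | ha x y hx hy => rw [smul_add, map_add, map_add, smul_add, hx, hy]
    | ht s x =>
      have h1 : D.piR S • X.bcM S (s ⊗ₜ x) = X.bcM S (s ⊗ₜ (D.piR R • x)) := X.bcM_smul S _ _ _
      rw [h1, hf, hf, smul_comm, ← hπ]
  have hφ' : ∀ x y, Y.φ (f x) (f y) = g ((X.baseChange S).φ x y) := by
    intro x y
    induction x using X.bc_induction S with
    | h0 => simp
    | ha x x' hx hx' => simp only [map_add, LinearMap.add_apply, hx, hx']
    | ht s x =>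
      induction y using X.bc_induction S with
      | h0 => simp
      | ha y y' hy hy' => simp only [map_add, hy, hy']
      | ht s' y =>
        rw [hf, hf, bc_φ_tmul, hg, map_smul, map_smul, LinearMap.smul_apply, hφ, smul_smul,
          mul_comm]
  have hq' : ∀ x, Y.q (f x) = g ((X.baseChange S).q x) := by
    intro x
    induction x using X.bc_induction S with
    | h0 => simp
    | ha x y hx hy =>
      rw [map_add, hY.q_add, (hX.baseChange S).q_add, ← hfπ, hφ', hx, hy, map_add, map_add]
    | ht s x => rw [hf, bc_q_tmul, hg, QuadraticMap.map_smul, hq]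
  exact Similar.of_linear D f g hfπ hq' hφ'

theorem piR_smul_bcM (x : X.M) :
    D.piR S • X.bcM S (1 ⊗ₜ x) = X.bcM S (1 ⊗ₜ (D.piR R • x)) := X.bcM_smul S _ _ _

theorem bc_q_one_tmul (x : X.M) :
    (X.baseChange S).q (X.bcM S (1 ⊗ₜ x)) = X.bcL S (1 ⊗ₜ X.q x) := by
  rw [bc_q_tmul, one_mul]

theorem bc_φ_one_tmul (x y : X.M) :
    (X.baseChange S).φ (X.bcM S (1 ⊗ₜ x)) (X.bcM S (1 ⊗ₜ y)) = X.bcL S (1 ⊗ₜ X.φ x y) := by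
  rw [bc_φ_tmul, one_mul]

theorem Similar.baseChange {Y : FormModule.{uO, uA, uR, uM', uL'} O A R} (h : X.Similar Y)
    (hX : X.HermAxioms D) : (X.baseChange S).Similar (Y.baseChange S) := by
  have hY := hX.of_similar h
  obtain ⟨f, γ, hq, hφ⟩ := h
  refine hX.similar_baseChange (hY.baseChange S)
    (((f.restrictScalars R).baseChange R S _ _).trans (Y.bcM S))
    ((γ.baseChange R S _ _).trans (Y.bcL S)) (fun x => ?_) (fun x => ?_) (fun x y => ?_)
  · simp [piR_smul_bcM]
  · simp [bc_q_one_tmul, hq]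
  · simp [bc_φ_one_tmul, hφ]

/-- Transitivity of base change. -/
theorem HermAxioms.baseChange_baseChange (hX : X.HermAxioms D) {T : Type uT} [CommRing T]
    [Algebra R T] [Algebra S T] [Algebra O T] [IsScalarTower O R T] [IsScalarTower O S T]
    [IsScalarTower R S T] : (X.baseChange T).Similar ((X.baseChange S).baseChange T) := by
  refine hX.similar_baseChange ((hX.baseChange S).baseChange T)
    ((((TensorProduct.AlgebraTensorModule.cancelBaseChange R S T T X.M).symm).trans
      ((X.bcM S).baseChange S T _ _)).trans ((X.baseChange S).bcM T))
    ((((TensorProduct.AlgebraTensorModule.cancelBaseChange R S T T X.L).symm).trans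
      ((X.bcL S).baseChange S T _ _)).trans ((X.baseChange S).bcL T))
    (fun x => ?_) (fun x => ?_) (fun x y => ?_)
  · simp [piR_smul_bcM]
  · simp [bc_q_one_tmul]
  · simp [bc_φ_one_tmul]

end BaseChange

end FormModule

end FormModules

/-! ### Form modules attached to matrices -/

section MatrixModules

variable {O : Type uO} {A : Type uA} [CommRing O] [CommRing A] [Algebra O A] (D : QuadDatum O A)
variable {R : Type uR} [CommRing R] [Algebra O R]

open Quad hiding map_smul

section Form

variable {p τ : O} {ι : Type*} [Fintype ι]

/-- The form `(x, y) ↦ x* B y` on column vectors. -/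
def matForm (B : Matrix ι ι (Quad p τ R)) :
    (ι → Quad p τ R) →ₗ[R] (ι → Quad p τ R) →ₗ[R] Quad p τ R :=
  LinearMap.mk₂ R (fun x y => star x ⬝ᵥ B *ᵥ y)
    (fun x x' y => by rw [star_add, add_dotProduct])
    (fun r x y => by
      rw [show star (r • x) = r • star x by ext1 i; simp [Algebra.smul_def, star_algebraMap],
        smul_dotProduct])
    (fun x y y' => by rw [mulVec_add, dotProduct_add])
    (fun r x y => by rw [mulVec_smul, dotProduct_smul])

theorem matForm_apply (B : Matrix ι ι (Quad p τ R)) (x y : ι → Quad p τ R) :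
    matForm B x y = star x ⬝ᵥ B *ᵥ y := rfl

theorem matForm_smul_left (B : Matrix ι ι (Quad p τ R)) (a : Quad p τ R) (x y : ι → Quad p τ R) :
    matForm B (a • x) y = star a * matForm B x y := by
  rw [matForm_apply, matForm_apply, star_smul, smul_dotProduct, smul_eq_mul]

theorem matForm_smul_right (B : Matrix ι ι (Quad p τ R)) (a : Quad p τ R)
    (x y : ι → Quad p τ R) : matForm B x (a • y) = a * matForm B x y := by
  rw [matForm_apply, matForm_apply, mulVec_smul, dotProduct_smul, smul_eq_mul]

theorem matForm_herm (B : Matrix ι ι (Quad p τ R)) (x y : ι → Quad p τ R) :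
    matForm (herm B) x y = matForm B x y - ratio * star (matForm B y x) := by
  have : star (matForm B y x) = matForm Bᴴ x y := by
    rw [matForm_apply, matForm_apply, star_dotProduct, star_star, star_mulVec, ← dotProduct_mulVec,
      dotProduct_comm, dotProduct_comm, dotProduct_mulVec, ← dotProduct_mulVec]
  rw [this, herm, matForm_apply, sub_mulVec, dotProduct_sub, smul_mulVec, dotProduct_smul]
  rfl

theorem matForm_single [DecidableEq ι] (B : Matrix ι ι (Quad p τ R)) (i j : ι) :
    matForm B (Pi.single i 1) (Pi.single j 1) = B i j := by
  rw [matForm_apply, mulVec_single_one]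
  simp [dotProduct, Pi.single_apply, apply_ite star]

theorem matForm_mulVec {κ : Type*} [Fintype κ] (B : Matrix ι ι (Quad p τ R))
    (g : Matrix ι κ (Quad p τ R)) (x y : κ → Quad p τ R) :
    matForm B (g *ᵥ x) (g *ᵥ y) = matForm (gᴴ * B * g) x y := by
  rw [matForm_apply, matForm_apply, star_mulVec, ← dotProduct_mulVec, mulVec_mulVec,
    mulVec_mulVec, Matrix.mul_assoc]

end Form

variable {ι κ : Type*} [Fintype ι] [Fintype κ]

namespace FormModule

/-- The free module of column vectors with `q(x) = tr (x* B x)` and `φ(x, y) = im h(x, y)` where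
`h(x, y) = x* B y - (π̄ / π) conj(y* B x)`. -/
noncomputable def ofMatrix (B : Matrix ι ι (Quad D.π₀ D.τ R)) : FormModule O A R :=
  letI : Module (R ⊗[O] A) (ι → Quad D.π₀ D.τ R) :=
    Module.compHom _ (D.toQuad R : R ⊗[O] A →+* Quad D.π₀ D.τ R)
  haveI : IsScalarTower R (R ⊗[O] A) (ι → Quad D.π₀ D.τ R) :=
    ⟨fun r a x => by
      change D.toQuad R (r • a) • x = r • D.toQuad R a • x
      rw [Algebra.smul_def r a, (D.toQuad R).map_mul, D.toQuad_algebraMap, mul_smul,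
        algebraMap_smul]⟩
  { M := ι → Quad D.π₀ D.τ R
    L := R
    q := LinearMap.BilinMap.toQuadraticMap ((matForm B).compr₂ Quad.tr)
    φ := (matForm (herm B)).compr₂ (QuadraticAlgebra.imₗ _ _) }

variable {D}

/-- The vectors underlying `ofMatrix`. -/
noncomputable def omM (B : Matrix ι ι (Quad D.π₀ D.τ R)) :
    (ι → Quad D.π₀ D.τ R) ≃ₗ[R] (ofMatrix D B).M := LinearEquiv.refl R (ι → Quad D.π₀ D.τ R)

/-- The values of the forms of `ofMatrix`. -/
noncomputable def omL (B : Matrix ι ι (Quad D.π₀ D.τ R)) :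
    R ≃ₗ[R] (ofMatrix D B).L := LinearEquiv.refl R R

variable (B : Matrix ι ι (Quad D.π₀ D.τ R))

theorem smul_omM (a : R ⊗[O] A) (x : ι → Quad D.π₀ D.τ R) :
    a • omM B x = omM B (D.toQuad R a • x) := rfl

theorem piR_smul_omM (x : ι → Quad D.π₀ D.τ R) :
    D.piR R • omM B x = omM B ((QuadraticAlgebra.omega : Quad D.π₀ D.τ R) • x) := by
  rw [smul_omM, D.toQuad_piR]

theorem q_omM (x : ι → Quad D.π₀ D.τ R) :
    (ofMatrix D B).q (omM B x) = omL B (tr (matForm B x x)) := rfl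

theorem φ_omM (x y : ι → Quad D.π₀ D.τ R) :
    (ofMatrix D B).φ (omM B x) (omM B y) = omL B (matForm (herm B) x y).im := rfl

theorem φ_piR_omM (x y : ι → Quad D.π₀ D.τ R) :
    (ofMatrix D B).φ (omM B x) (D.piR R • omM B y) = omL B (tr (matForm (herm B) x y)) := by
  rw [piR_smul_omM, φ_omM, matForm_smul_right, im_omega_mul]

theorem ofMatrix_hermAxioms : (ofMatrix D B).HermAxioms D := by
  refine ⟨fun x => ?_, fun x y => ?_, fun x y => ?_, fun x y => ?_, fun x => ?_⟩
  · obtain ⟨x, rfl⟩ := (omM B).surjective x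
    rw [piR_smul_omM, q_omM, q_omM, matForm_smul_left, matForm_smul_right, ← mul_assoc,
      mul_comm (star _), omega_mul_star_omega, tr_algebraMap_mul, ← smul_eq_mul, map_smul]
  · obtain ⟨x, rfl⟩ := (omM B).surjective x
    obtain ⟨y, rfl⟩ := (omM B).surjective y
    rw [φ_piR_omM, QuadraticMap.polar, ← map_add, q_omM, q_omM, q_omM, ← map_sub, ← map_sub,
      matForm_herm, map_sub, tr_ratio_mul_star]
    congr 1
    simp only [map_add, LinearMap.add_apply]
    ring
  · obtain ⟨x, rfl⟩ := (omM B).surjective x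
    obtain ⟨y, rfl⟩ := (omM B).surjective y
    rw [piR_smul_omM, smul_omM, D.toQuad_conj, φ_omM, φ_omM, matForm_smul_left, matForm_smul_right]
  · obtain ⟨x, rfl⟩ := (omM B).surjective x
    obtain ⟨y, rfl⟩ := (omM B).surjective y
    rw [smul_omM, D.toQuad_ratio, φ_omM, φ_omM, matForm_smul_left, matForm_herm, matForm_herm,
      mul_sub, ← mul_assoc, mul_comm (star ratio) ratio, ratio_mul_star_ratio, one_mul]
    congr 1
    simp [ratio]
    ring
  · obtain ⟨x, rfl⟩ := (omM B).surjective x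
    rw [φ_omM, q_omM, matForm_herm, sub_ratio_mul_star, ← map_smul]
    congr 1
    simp [ratio]
    ring

/-- The standard basis of `ofMatrix`. -/
noncomputable def omBasis : Module.Basis ι (R ⊗[O] A) (ofMatrix D B).M :=
  letI : Module (R ⊗[O] A) (ι → Quad D.π₀ D.τ R) := (ofMatrix D B).moduleAM
  (Pi.basisFun (Quad D.π₀ D.τ R) ι).mapCoeffs (D.toQuad R).symm fun c x => by
    change D.toQuad R ((D.toQuad R).symm c) • x = c • x
    rw [RingEquiv.apply_symm_apply]

theorem omBasis_apply [DecidableEq ι] (i : ι) : omBasis B i = omM B (Pi.single i 1) := by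
  let : Module (R ⊗[O] A) (ι → Quad D.π₀ D.τ R) := (ofMatrix D B).moduleAM
  exact (Module.Basis.mapCoeffs_apply (Pi.basisFun (Quad D.π₀ D.τ R) ι) (D.toQuad R).symm _ i).trans
    (Pi.basisFun_apply _ _ i)

/-- Forms with similar matrices are similar. -/
theorem similar_of_simBy [DecidableEq ι] [DecidableEq κ] {C : Matrix κ κ (Quad D.π₀ D.τ R)}
    {u : Rˣ} (h : SimBy u B C) : (ofMatrix D B).Similar (ofMatrix D C) := by
  obtain ⟨g, g', hg, hg', hG⟩ := h
  apply Similar.symm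
  have hq : ∀ x, tr (matForm (gᴴ * B * g) x x) = u * tr (matForm C x x) := by
    intro x
    have h0 := GramEq.tr_eq_zero (Z := gᴴ * B * g - (u : R) • C)
      (by rw [herm_sub, hG.1, sub_self])
      (fun i => by rw [Matrix.sub_apply, map_sub, hG.2, sub_self]) x
    have h1 : ∑ i, ∑ j, star (x i) * (gᴴ * B * g - (u : R) • C) i j * x j
        = matForm (gᴴ * B * g) x x - (u : R) • matForm C x x := by
      rw [matForm_apply, matForm_apply, ← dotProduct_smul, ← smul_mulVec, ← dotProduct_sub,
        ← sub_mulVec]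
      simp only [dotProduct, mulVec, Finset.mul_sum, Pi.star_apply, mul_assoc]
    rwa [h1, map_sub, map_smul, sub_eq_zero] at h0
  have hφ : ∀ x y, matForm (herm (gᴴ * B * g)) x y = (u : R) • matForm (herm C) x y := by
    intro x y
    rw [hG.1, herm_smul, matForm_apply, matForm_apply, smul_mulVec, dotProduct_smul]
  let f : (κ → Quad D.π₀ D.τ R) ≃ₗ[R] (ι → Quad D.π₀ D.τ R) :=
    (LinearEquiv.ofLinearMap g.mulVecLin g'.mulVecLin
      (by rw [← mulVecLin_mul, hg, mulVecLin_one]) (by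
        rw [← mulVecLin_mul, hg', mulVecLin_one])).restrictScalars R
  have hf : ∀ x, f x = g *ᵥ x := fun _ => rfl
  refine Similar.of_linear D (((omM C).symm.trans f).trans (omM B))
    (((omL C).symm.trans (LinearEquiv.smulOfUnit u)).trans (omL B)) (fun x => ?_) (fun x => ?_)
    (fun x y => ?_)
  · obtain ⟨x, rfl⟩ := (omM C).surjective x
    simp only [LinearEquiv.trans_apply, piR_smul_omM, LinearEquiv.symm_apply_apply, hf,
      mulVec_smul]
  · obtain ⟨x, rfl⟩ := (omM C).surjective x
    simp only [LinearEquiv.trans_apply, q_omM, LinearEquiv.symm_apply_apply, hf,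
      matForm_mulVec, hq]
    rfl
  · obtain ⟨x, rfl⟩ := (omM C).surjective x
    obtain ⟨y, rfl⟩ := (omM C).surjective y
    simp only [LinearEquiv.trans_apply, φ_omM, LinearEquiv.symm_apply_apply, hf,
      matForm_mulVec, ← herm_congr, hφ]
    rfl

/-- The forms on a free module are given by a matrix. -/
theorem exists_similar_ofMatrix {d : ℕ} {X : FormModule.{uO, uA, uR, uM, uL} O A R}
    (hX : X.HermAxioms D) (e : Module.Basis (Fin d) (R ⊗[O] A) X.M) (ℓ : X.L ≃ₗ[R] R) :
    ∃ B : Matrix (Fin d) (Fin d) (Quad D.π₀ D.τ R), X.Similar (ofMatrix D B) ∧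
      (∀ i, ℓ (X.q (e i)) = tr (B i i)) ∧ (∀ i j, ℓ (X.φ (e i) (e j)) = (herm B i j).im) ∧
      ∀ i j, ℓ (X.φ (e i) (D.piR R • e j)) = tr (herm B i j) := by
  let w : Fin d → Fin d → Quad D.π₀ D.τ R := fun i j =>
    ⟨ℓ (X.φ (e i) (D.piR R • e j)) - algebraMap O R (D.π₀ * D.τ) * ℓ (X.φ (e i) (e j)),
      ℓ (X.φ (e i) (e j))⟩
  have hw : ∀ i j, tr (w i j) = ℓ (X.φ (e i) (D.piR R • e j)) := fun i j => by
    simp [tr_apply, w]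
  let B : Matrix (Fin d) (Fin d) (Quad D.π₀ D.τ R) := Matrix.of fun i j =>
    if i = j then algebraMap R _ (ℓ (X.q (e i))) else if i < j then w i j else 0
  have hd : ∀ i, B i i = algebraMap R _ (ℓ (X.q (e i))) := fun i => by simp [B]
  have hlt : ∀ i j, i < j → B i j = w i j := fun i j h => by simp [B, h, h.ne]
  have hgt : ∀ i j, i < j → B j i = 0 := fun i j h => by simp [B, h.not_gt, h.ne']
  have hq : ∀ i, ℓ (X.q (e i)) = tr (B i i) := fun i => by rw [hd, tr_algebraMap]
  have h1 : ∀ i j, i < j → herm B i j = w i j := fun i j h => by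
    rw [herm_apply, hlt i j h, hgt i j h, star_zero, mul_zero, sub_zero]
  have h2 : ∀ i j, ℓ (X.φ (e i) (D.piR R • e j)) = tr (herm B i j) := by
    intro i j
    rcases lt_trichotomy i j with h | rfl | h
    · rw [h1 i j h, hw]
    · rw [herm_diag, tr_algebraMap_mul, ← hq, hX.φ_π_right, QuadraticMap.polar_self]
      simp [tr_apply, ratio]
      ring
    · rw [herm_swap, h1 j i h, map_neg, tr_ratio_mul_star, neg_neg, hw, hX.φ_π_right,
        hX.φ_π_right, QuadraticMap.polar_comm]
  have h3 : ∀ i j, ℓ (X.φ (e i) (e j)) = (herm B i j).im := by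
    intro i j
    rcases lt_trichotomy i j with h | rfl | h
    · rw [h1 i j h]
    · rw [herm_diag, ← hq, hX.φ_self, map_smul]
      simp [ratio]
      ring
    · have h4 := congrArg ℓ (hX.φ_add_swap (e j) (e i))
      rw [map_add, map_smul, smul_eq_mul] at h4
      have h5 : (-(ratio * star (w j i))).im
          = algebraMap O R D.τ * tr (w j i) - (w j i).im := by
        simp [ratio, tr_apply]
        ring
      rw [herm_swap, h1 j i h, h5, hw]
      linear_combination h4
  refine ⟨B, ?_, hq, h3, h2⟩
  refine hX.similar_of_basis (ofMatrix_hermAxioms B) e (omBasis B) (ℓ.trans (omL B))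
    (fun i => ?_) (fun i j => ?_) (fun i j => ?_)
  · rw [omBasis_apply, q_omM, matForm_single, LinearEquiv.trans_apply, hq]
  · rw [omBasis_apply, omBasis_apply, φ_omM, matForm_single, LinearEquiv.trans_apply, h3]
  · rw [omBasis_apply, omBasis_apply, φ_piR_omM, matForm_single, LinearEquiv.trans_apply, h2]

theorem ofMatrix_baseChange (S : Type uS) [CommRing S] [Algebra R S] [Algebra O S]
    [IsScalarTower O R S] [DecidableEq ι] :
    ((ofMatrix D B).baseChange S).Similar
      (ofMatrix D (B.map (Quad.map (IsScalarTower.toAlgHom O R S)))) := by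
  set f := IsScalarTower.toAlgHom O R S with hf
  let b := Pi.basis fun _ : ι => QuadraticAlgebra.basis (R := R) (-(algebraMap O R D.π₀))
    (algebraMap O R (D.π₀ * D.τ))
  let b' := Pi.basis fun _ : ι => QuadraticAlgebra.basis (R := S) (-(algebraMap O S D.π₀))
    (algebraMap O S (D.π₀ * D.τ))
  let E : S ⊗[R] (ι → Quad D.π₀ D.τ R) ≃ₗ[S] (ι → Quad D.π₀ D.τ S) :=
    (b.baseChange S).repr.trans b'.repr.symm
  have hE : ∀ x : ι → Quad D.π₀ D.τ R, E (1 ⊗ₜ x) = fun i => Quad.map f (x i) := by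
    intro x
    apply b'.repr.injective
    rw [LinearEquiv.trans_apply, LinearEquiv.apply_symm_apply]
    ext ⟨i, k⟩
    rw [Module.Basis.baseChange_repr_tmul, Pi.basis_repr, Pi.basis_repr,
      QuadraticAlgebra.basis_repr_apply, QuadraticAlgebra.basis_repr_apply, Algebra.smul_def,
      mul_one]
    fin_cases k <;> rfl
  have hform : ∀ (C : Matrix ι ι (Quad D.π₀ D.τ R)) x y,
      matForm (C.map (Quad.map f)) (fun i => Quad.map f (x i)) (fun i => Quad.map f (y i))
        = Quad.map f (matForm C x y) := by
    intro C x y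
    simp only [matForm_apply, dotProduct, mulVec, map_sum, map_mul, Pi.star_apply, Quad.map_star,
      map_apply]
  have hfr : ∀ r : R, r • (1 : S) = f r := fun r => by rw [Algebra.smul_def, mul_one]; rfl
  refine (ofMatrix_hermAxioms B).similar_baseChange (ofMatrix_hermAxioms _)
    ((((omM B).symm.baseChange R S _ _).trans E).trans (omM _))
    ((((omL B).symm.baseChange R S _ _).trans (TensorProduct.AlgebraTensorModule.rid R S S)).trans
      (omL _))
    (fun x => ?_) (fun x => ?_) (fun x y => ?_)
  · obtain ⟨x, rfl⟩ := (omM B).surjective x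
    simp only [piR_smul_omM, LinearEquiv.trans_apply, LinearEquiv.baseChange_tmul,
      LinearEquiv.symm_apply_apply, hE]
    congr 1
    ext1 i
    simp only [Pi.smul_apply, smul_eq_mul, map_mul, Quad.map_omega]
  · obtain ⟨x, rfl⟩ := (omM B).surjective x
    simp only [q_omM, LinearEquiv.trans_apply, LinearEquiv.baseChange_tmul,
      LinearEquiv.symm_apply_apply, hE, hform, tr_map,
      TensorProduct.AlgebraTensorModule.rid_tmul, hfr]
  · obtain ⟨x, rfl⟩ := (omM B).surjective x
    obtain ⟨y, rfl⟩ := (omM B).surjective y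
    simp only [φ_omM, LinearEquiv.trans_apply, LinearEquiv.baseChange_tmul,
      LinearEquiv.symm_apply_apply, hE, herm_map, hform, im_map,
      TensorProduct.AlgebraTensorModule.rid_tmul, hfr]

end FormModule

end MatrixModules

/-! ### The standard module -/

section StandardModule

variable {O : Type uO} {A : Type uA} [CommRing O] [CommRing A] [Algebra O A] (D : QuadDatum O A)
variable {R : Type uR} [CommRing R] [Algebra O R]

open Quad hiding map_smul

variable (R) in
/-- `QuadDatum.toQuad` as an `R`-linear map. -/
noncomputable def QuadDatum.toQuadₗ : R ⊗[O] A ≃ₗ[R] Quad D.π₀ D.τ R :=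
  { D.toQuad R with
    map_smul' := fun r a => by
      change D.toQuad R (r • a) = r • D.toQuad R a
      rw [Algebra.smul_def r a, (D.toQuad R).map_mul, D.toQuad_algebraMap]
      exact (Algebra.smul_def r _).symm }

theorem QuadDatum.toQuad_conjR (a : R ⊗[O] A) :
    D.toQuad R (D.conjR R a) = star (D.toQuad R a) := by
  have h : D.conjR R a = algebraMap R _ (D.coord R 0 a)
      + algebraMap R _ (D.coord R 1 a) * (1 : R) ⊗ₜ[O] D.conj D.π := by
    conv_lhs => rw [D.eq_add_piR a]
    rw [map_add, map_mul, AlgHom.commutes, AlgHom.commutes]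
    rfl
  have h2 : D.toQuad R a = algebraMap R _ (D.coord R 0 a)
      + algebraMap R _ (D.coord R 1 a) * QuadraticAlgebra.omega := by
    conv_lhs => rw [D.eq_add_piR a]
    rw [(D.toQuad R).map_add, (D.toQuad R).map_mul, D.toQuad_algebraMap, D.toQuad_algebraMap,
      D.toQuad_piR]
  rw [h, h2, (D.toQuad R).map_add, (D.toQuad R).map_mul, D.toQuad_algebraMap, D.toQuad_algebraMap,
    D.toQuad_conj, star_add, star_mul', star_algebraMap, star_algebraMap]

theorem re_toQuad (a : R ⊗[O] A) : (D.toQuad R a).re = D.coord R 0 a := rfl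

theorem im_toQuad (a : R ⊗[O] A) : (D.toQuad R a).im = D.coord R 1 a := rfl

theorem toQuad_sesq (a b : R ⊗[O] A) :
    D.toQuad R (sesq D R a b) = star (D.toQuad R a) * D.toQuad R b := by
  rw [← D.toQuad_conjR, ← (D.toQuad R).map_mul]
  rfl

theorem matForm_stdMat {p τ : O} {m : ℕ} (x y : (Fin m ⊕ Fin m) ⊕ Unit → Quad p τ R) :
    matForm (stdMat p τ R (Fin m)) x y
      = ∑ i, star (x (.inl (.inl i))) * y (.inl (.inr i)) + star (x (.inr ())) * y (.inr ()) := by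
  rw [matForm_apply, stdMat, hypMat]
  simp [dotProduct, mulVec, Matrix.one_apply, Fintype.sum_sum_type]

variable (R) in
/-- The vectors underlying the standard module. -/
noncomputable def stdM (m : ℕ) : StdCarrier O A R m ≃ₗ[R] (stdModule D R m).M :=
  LinearEquiv.refl R (StdCarrier O A R m)

variable (R) in
/-- The values of the forms of the standard module. -/
noncomputable def stdL (m : ℕ) : R ≃ₗ[R] (stdModule D R m).L := LinearEquiv.refl R R

theorem piR_smul_stdM {m : ℕ} (x : StdCarrier O A R m) :
    D.piR R • stdM D R m x = stdM D R m (D.piR R • x) := rfl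

theorem q_stdM {m : ℕ} (x : StdCarrier O A R m) :
    (stdModule D R m).q (stdM D R m x)
      = stdL D R m (∑ i, D.coord R 1 ((1 ⊗ₜ[O] D.π) * sesq D R (x.1 i).1 (x.1 i).2)
          + D.coord R 0 (sesq D R x.2 x.2)) := rfl

theorem φ_stdM {m : ℕ} (x y : StdCarrier O A R m) :
    (stdModule D R m).φ (stdM D R m x) (stdM D R m y)
      = stdL D R m (∑ i, (D.coord R 1 (sesq D R (x.1 i).1 (y.1 i).2)
          + D.coord R 1 (sesq D R ((1 ⊗ₜ[O] D.ratio) * (y.1 i).1) (x.1 i).2))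
        + (algebraMap O R D.τ * D.coord R 0 (sesq D R x.2 y.2)
          + 2 * D.coord R 1 (sesq D R x.2 y.2))) := rfl

/-- The standard module is given by the standard matrix. -/
theorem stdModule_similar (m : ℕ) :
    (stdModule D R m).Similar (FormModule.ofMatrix D (stdMat D.π₀ D.τ R (Fin m))) := by
  let f : StdCarrier O A R m ≃ₗ[R] ((Fin m ⊕ Fin m) ⊕ Unit → Quad D.π₀ D.τ R) :=
    { toFun := fun x => Sum.elim (Sum.elim (fun i => D.toQuadₗ R (x.1 i).1)
        (fun i => D.toQuadₗ R (x.1 i).2)) (fun _ => D.toQuadₗ R x.2)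
      invFun := fun z => (fun i => ((D.toQuadₗ R).symm (z (.inl (.inl i))),
        (D.toQuadₗ R).symm (z (.inl (.inr i)))), (D.toQuadₗ R).symm (z (.inr ())))
      left_inv := fun x => by simp
      right_inv := fun z => by
        funext i
        rcases i with (i | i) | i <;> simp
      map_add' := fun x y => by
        funext i
        rcases i with (i | i) | i <;> simp
      map_smul' := fun r x => by
        funext i
        rcases i with (i | i) | i <;> simp }
  have h0 : ∀ x i, f x (.inl (.inl i)) = D.toQuad R (x.1 i).1 := fun _ _ => rfl
  have h1 : ∀ x i, f x (.inl (.inr i)) = D.toQuad R (x.1 i).2 := fun _ _ => rfl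
  have h2 : ∀ x, f x (.inr ()) = D.toQuad R x.2 := fun _ => rfl
  refine FormModule.Similar.of_linear D
    (((stdM D R m).symm.trans f).trans (FormModule.omM (stdMat D.π₀ D.τ R (Fin m))))
    ((stdL D R m).symm.trans (FormModule.omL (stdMat D.π₀ D.τ R (Fin m)))) (fun x => ?_)
    (fun x => ?_) (fun x y => ?_)
  · obtain ⟨x, rfl⟩ := (stdM D R m).surjective x
    simp only [piR_smul_stdM, LinearEquiv.trans_apply, LinearEquiv.symm_apply_apply,
      FormModule.piR_smul_omM]
    congr 1
    funext i
    rcases i with (i | i) | i <;> rw [← D.toQuad_piR] <;>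
      exact (D.toQuad R).map_mul _ _
  · obtain ⟨x, rfl⟩ := (stdM D R m).surjective x
    simp only [q_stdM, LinearEquiv.trans_apply, LinearEquiv.symm_apply_apply, FormModule.q_omM]
    congr 1
    rw [matForm_stdMat, map_add, map_sum]
    congr 1
    · refine Finset.sum_congr rfl fun i _ => ?_
      rw [← im_toQuad, (D.toQuad R).map_mul, toQuad_sesq, ← QuadDatum.piR, D.toQuad_piR,
        im_omega_mul, h0, h1]
    · rw [← re_toQuad, toQuad_sesq, h2, tr_apply, add_eq_left]
      have : (star (D.toQuad R x.2) * D.toQuad R x.2).im = 0 := by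
        simp
        ring
      rw [this, mul_zero]
  · obtain ⟨x, rfl⟩ := (stdM D R m).surjective x
    obtain ⟨y, rfl⟩ := (stdM D R m).surjective y
    simp only [φ_stdM, LinearEquiv.trans_apply, LinearEquiv.symm_apply_apply, FormModule.φ_omM]
    congr 1
    have hr : ∀ z : Quad D.π₀ D.τ R, (z - ratio * z).im = algebraMap O R D.τ * z.re + 2 * z.im := by
      intro z
      simp [ratio]
      ring
    have hs : ∀ a b : Quad D.π₀ D.τ R,
        (star (ratio * a) * b).im = - (ratio * star (star a * b)).im := by
      intro a b
      rw [show ratio * star (star a * b) = star (star (ratio * a) * b) by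
        simp only [star_mul', star_star]; ring, QuadraticAlgebra.im_star, neg_neg]
    have him : ∀ a b : R ⊗[O] A, D.coord R 1 (sesq D R a b)
        = (star (D.toQuad R a) * D.toQuad R b).im := fun a b => by
      rw [← im_toQuad, toQuad_sesq]
    rw [← re_toQuad, toQuad_sesq]
    simp only [him, (D.toQuad R).map_mul, D.toQuad_ratio, hs]
    rw [← hr, matForm_herm, matForm_stdMat, matForm_stdMat, star_add, star_sum, mul_add,
      Finset.mul_sum, add_sub_add_comm, ← Finset.sum_sub_distrib, QuadraticAlgebra.im_add]
    simp only [h0, h1, h2]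
    congr 1
    · rw [← QuadraticAlgebra.imₗ_apply, map_sum]
      refine Finset.sum_congr rfl fun i _ => ?_
      rw [← sub_eq_add_neg]
      rfl
    · rw [star_mul', star_star, mul_comm (D.toQuad R y.2)]

theorem stdModule_hermAxioms (m : ℕ) : (stdModule D R m).HermAxioms D :=
  (FormModule.ofMatrix_hermAxioms _).of_similar (stdModule_similar D m).symm

theorem stdMat_map {p τ : O} {S : Type uS} [CommRing S] [Algebra O S] (f : R →ₐ[O] S) (α : Type*)
    [DecidableEq α] : (stdMat p τ R α).map (Quad.map f) = stdMat p τ S α := by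
  ext1 i j
  rcases i with (i | i) | i <;> rcases j with (j | j) | j <;>
    simp [stdMat, hypMat, Matrix.one_apply, apply_ite (Quad.map f)]

theorem stdModule_baseChange (S : Type uS) [CommRing S] [Algebra R S] [Algebra O S]
    [IsScalarTower O R S] (m : ℕ) :
    ((stdModule D R m).baseChange S).Similar (stdModule D S m) := by
  refine (((stdModule_similar D m).baseChange (stdModule_hermAxioms D m)).trans
    (FormModule.ofMatrix_baseChange _ S)).trans ?_
  rw [stdMat_map]
  exact (stdModule_similar D m).symm

end StandardModule

/-! ### Spreading out from a localization -/

section LocalFreeness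

/-- A family that is a basis over a localization of `R` becomes a basis after inverting one element.
-/
theorem exists_bijective_localization_powers {R : Type uR} [CommRing R] {M : Type uM}
    [AddCommGroup M] [Module R M] [Module.FinitePresentation R M] (T : Submonoid R) (R' : Type uR)
    [CommRing R'] [Algebra R R'] [IsLocalization T R'] {ι : Type*}
    [Finite ι] (v : ι → M) (b : Module.Basis ι R' (R' ⊗[R] M)) (hb : ∀ i, b i = 1 ⊗ₜ v i) :
    ∃ t ∈ T, Function.Bijective
      (LocalizedModule.map (Submonoid.powers t) (Finsupp.linearCombination R v)) := by
  let b₀ : Module.Basis ι R' (R' ⊗[R] (ι →₀ R)) :=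
    (Finsupp.basisSingleOne (R := R) (ι := ι)).baseChange R'
  let f : (ι →₀ R) →ₗ[R] R' ⊗[R] (ι →₀ R) := TensorProduct.mk R R' (ι →₀ R) 1
  let g : M →ₗ[R] R' ⊗[R] M := TensorProduct.mk R R' M 1
  have : IsLocalizedModule T f := (isLocalizedModule_iff_isBaseChange T R' f).2
    (TensorProduct.isBaseChange R _ R')
  have : IsLocalizedModule T g := (isLocalizedModule_iff_isBaseChange T R' g).2
    (TensorProduct.isBaseChange R _ R')
  have hbij : Function.Bijective (IsLocalizedModule.map T f g (Finsupp.linearCombination R v)) := by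
    have : IsLocalizedModule.map T f g (Finsupp.linearCombination R v)
        = ((b₀.equiv b (Equiv.refl ι)).restrictScalars R).toLinearMap := by
      apply IsLocalizedModule.ext T f (IsLocalizedModule.map_units g)
      rw [IsLocalizedModule.map_comp]
      apply Finsupp.lhom_ext'
      intro i
      apply LinearMap.ext_ring
      have h0 : f (Finsupp.single i 1) = b₀ i := by simp [b₀, f]
      have h1 : b₀.equiv b (Equiv.refl ι) (b₀ i) = b i := by
        rw [Module.Basis.equiv_apply, Equiv.refl_apply]
      simp only [LinearMap.comp_apply, Finsupp.lsingle_apply, LinearEquiv.coe_coe,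
        LinearEquiv.restrictScalars_apply]
      rw [h0, h1, hb, Finsupp.linearCombination_single, one_smul]
      rfl
    rw [this]
    exact (b₀.equiv b (Equiv.refl ι)).bijective
  obtain ⟨t, ht, h⟩ := exists_bijective_map_powers T f g _ hbij
  exact ⟨t, ht, h t dvd_rfl⟩

/-- A family is a basis over a localization if the map it defines from the free module localizes to
an isomorphism. -/
theorem exists_basis_of_bijective_localizedModule_map {R : Type uR} [CommRing R] {M : Type uM}
    [AddCommGroup M] [Module R M] (T : Submonoid R) {ι : Type*}
    (v : ι → M)
    (h : Function.Bijective (LocalizedModule.map T (Finsupp.linearCombination R v))) :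
    ∃ b : Module.Basis ι (Localization T) (Localization T ⊗[R] M), ∀ i, b i = 1 ⊗ₜ v i := by
  let b₀ := (Finsupp.basisSingleOne (R := R) (ι := ι)).ofIsLocalizedModule
    (Localization T) T (LocalizedModule.mkLinearMap T (ι →₀ R))
  let e₁ : LocalizedModule T (ι →₀ R) ≃ₗ[Localization T] LocalizedModule T M :=
    LinearEquiv.ofBijective _ h
  let e₂ : LocalizedModule T M ≃ₗ[Localization T] Localization T ⊗[R] M :=
    LocalizedModule.equivTensorProduct T M
  refine ⟨(b₀.map e₁).map e₂, fun i => ?_⟩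
  have h0 : b₀ i = LocalizedModule.mk (Finsupp.single i 1) 1 := by
    rw [Module.Basis.ofIsLocalizedModule_apply, LocalizedModule.mkLinearMap_apply,
      Finsupp.coe_basisSingleOne]
  have h1 : e₁ (LocalizedModule.mk (Finsupp.single i 1) 1) = LocalizedModule.mk (v i) 1 := by
    change LocalizedModule.map T (Finsupp.linearCombination R v) _ = _
    rw [LocalizedModule.map_mk, Finsupp.linearCombination_single, one_smul]
  rw [Module.Basis.map_apply, Module.Basis.map_apply, h0, h1]
  exact (LocalizedModule.equivTensorProduct_apply_mk _ _ _).trans (by rw [Localization.mk_one])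
/-- A family in a finitely presented flat module that is a basis of the fibre at `p` is a basis
over a neighbourhood of `p`. -/
theorem exists_basis_of_fiber {R : Type uR} [CommRing R] {M : Type uM} [AddCommGroup M] [Module R M]
    [Module.FinitePresentation R M] [Module.Flat R M] (p : Ideal R) [p.IsPrime] {ι : Type*}
    [Finite ι] (v : ι → M) (b : Module.Basis ι p.ResidueField (p.ResidueField ⊗[R] M))
    (hb : ∀ i, b i = 1 ⊗ₜ v i) :
    ∃ t, t ∉ p ∧ ∀ (S : Type uS) [CommRing S] [Algebra R S], IsUnit (algebraMap R S t) →
      ∃ b' : Module.Basis ι S (S ⊗[R] M), ∀ i, b' i = 1 ⊗ₜ v i := by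
  let Rp := Localization.AtPrime p
  let b₁ := b.map (TensorProduct.AlgebraTensorModule.cancelBaseChange R Rp p.ResidueField
    p.ResidueField M).symm
  have hb₁ : (b₁ : ι → _)
      = TensorProduct.mk Rp p.ResidueField (Rp ⊗[R] M) 1 ∘ fun i => 1 ⊗ₜ v i := by
    funext i
    rw [Module.Basis.map_apply, hb]
    rfl
  obtain ⟨b₂, hb₂⟩ := Module.exists_basis_of_basis_baseChange (R := Rp) (M := Rp ⊗[R] M)
    (fun i => 1 ⊗ₜ v i) (hb₁ ▸ b₁.linearIndependent) (hb₁ ▸ b₁.span_eq)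
    (Module.Flat.rTensor_preserves_injective_linearMap _ (Submodule.subtype_injective _))
  obtain ⟨t, ht, h⟩ := exists_bijective_localization_powers p.primeCompl Rp v b₂ hb₂
  obtain ⟨b₃, hb₃⟩ := exists_basis_of_bijective_localizedModule_map _ v h
  refine ⟨t, ht, fun S _ _ hS => ?_⟩
  let Rt := Localization (Submonoid.powers t)
  let : Algebra Rt S := (IsLocalization.Away.lift t hS : Rt →+* S).toAlgebra
  have : IsScalarTower R Rt S := IsScalarTower.of_algebraMap_eq fun x =>
    (IsLocalization.Away.lift_eq t hS x).symm
  refine ⟨(b₃.baseChange S).map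
    (TensorProduct.AlgebraTensorModule.cancelBaseChange R Rt S S M), fun i => ?_⟩
  rw [Module.Basis.map_apply, Module.Basis.baseChange_apply, hb₃]
  exact (TensorProduct.AlgebraTensorModule.cancelBaseChange_tmul _ _ _ _ _ _).trans
    (by rw [one_smul])

/-- Every element of the fibre at `p` is a multiple of an element of the module. -/
theorem exists_smul_eq_one_tmul {R : Type uR} [CommRing R] {M : Type uM} [AddCommGroup M]
    [Module R M] (p : Ideal R) [p.IsPrime] (y : p.ResidueField ⊗[R] M) :
    ∃ (s : R) (x : M), algebraMap R p.ResidueField s ≠ 0 ∧ s • y = 1 ⊗ₜ x := by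
  induction y with
  | zero => exact ⟨1, 0, by simp, by simp⟩
  | tmul c x =>
    obtain ⟨a, s, hs, rfl⟩ := IsFractionRing.div_surjective (A := R ⧸ p) c
    obtain ⟨a, rfl⟩ := Ideal.Quotient.mk_surjective a
    obtain ⟨s, rfl⟩ := Ideal.Quotient.mk_surjective s
    have hs' : algebraMap (R ⧸ p) p.ResidueField (Ideal.Quotient.mk p s) ≠ 0 :=
      IsFractionRing.to_map_ne_zero_of_mem_nonZeroDivisors hs
    have e : ∀ r : R, algebraMap (R ⧸ p) p.ResidueField (Ideal.Quotient.mk p r)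
        = algebraMap R p.ResidueField r := fun r =>
      (IsScalarTower.algebraMap_apply R (R ⧸ p) p.ResidueField r).symm
    refine ⟨s, a • x, by rwa [← e], ?_⟩
    rw [TensorProduct.smul_tmul', Algebra.smul_def, ← e, mul_div_cancel₀ _ hs',
      TensorProduct.tmul_smul, TensorProduct.smul_tmul', Algebra.smul_def, mul_one, e]
  | add y y' hy hy' =>
    obtain ⟨s, x, hs, h⟩ := hy
    obtain ⟨s', x', hs', h'⟩ := hy'
    refine ⟨s * s', s' • x + s • x', by rw [map_mul]; exact mul_ne_zero hs hs', ?_⟩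
    rw [smul_add, TensorProduct.tmul_add, TensorProduct.tmul_smul, TensorProduct.tmul_smul, ← h,
      ← h', smul_smul, smul_smul, mul_comm]

variable {O : Type uO} {A : Type uA} [CommRing O] [CommRing A] [Algebra O A] {D : QuadDatum O A}
variable {R : Type uR} [CommRing R] [Algebra O R]

namespace FormModule

variable {X : FormModule.{uO, uA, uR, uM, uL} O A R}

/-- The base change of `M` is locally free of the same rank over `S ⊗ A`. -/
theorem IsHermitian.baseChange_rank {d : ℕ} (hX : X.IsHermitian D d) (S : Type uS) [CommRing S]
    [Algebra R S] [Algebra O S] [IsScalarTower O R S] :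
    Module.Finite (S ⊗[O] A) (X.baseChange S).M ∧
      Module.Projective (S ⊗[O] A) (X.baseChange S).M ∧
      ∀ P : PrimeSpectrum (S ⊗[O] A), Module.rankAtStalk (X.baseChange S).M P = d := by
  have := hX.finite
  have := hX.projective
  let j : R ⊗[O] A →ₐ[O] S ⊗[O] A :=
    Algebra.TensorProduct.map (IsScalarTower.toAlgHom O R S) (AlgHom.id O A)
  let : Algebra (R ⊗[O] A) (S ⊗[O] A) := j.toRingHom.toAlgebra
  let : Module (R ⊗[O] A) (X.baseChange S).M := Module.compHom _ j.toRingHom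
  have : IsScalarTower (R ⊗[O] A) (S ⊗[O] A) (X.baseChange S).M :=
    ⟨fun c c' x => mul_smul (j c) c' x⟩
  let f : X.M →ₗ[R ⊗[O] A] (X.baseChange S).M :=
    { toFun := fun x => X.bcM S (1 ⊗ₜ x)
      map_add' := fun x y => by rw [TensorProduct.tmul_add, map_add]
      map_smul' := fun c x => by
        change _ = j c • X.bcM S (1 ⊗ₜ x)
        induction c with
        | zero => simp
        | add c c' h h' => rw [add_smul, TensorProduct.tmul_add, map_add, map_add, add_smul, h, h']
        | tmul r a =>
          have e : (r ⊗ₜ[O] a : R ⊗[O] A) = r • ((1 : R) ⊗ₜ[O] a) := by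
            rw [TensorProduct.smul_tmul', smul_eq_mul, mul_one]
          have e' : j (r ⊗ₜ[O] a) = algebraMap R S r • ((1 : S) ⊗ₜ[O] a) := by
            rw [TensorProduct.smul_tmul', smul_eq_mul, mul_one]
            rfl
          rw [e', smul_assoc, bcM_smul, e, smul_assoc, ← map_smul, TensorProduct.tmul_smul,
            algebraMap_smul] }
  have hC : ∀ r : R, algebraMap (R ⊗[O] A) (S ⊗[O] A) (algebraMap R _ r)
      = algebraMap S _ (algebraMap R S r) := fun r => by
    change j (r ⊗ₜ 1) = _
    rw [Algebra.TensorProduct.map_tmul, map_one]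
    rfl
  have : IsScalarTower R (R ⊗[O] A) (S ⊗[O] A) := IsScalarTower.of_algebraMap_eq fun r => by
    rw [hC, ← IsScalarTower.algebraMap_apply]
  -- `S ⊗ M` is the base change of `M` along `R ⊗ A → S ⊗ A`.
  let E := (S ⊗[O] A) ⊗[R ⊗[O] A] X.M
  have hS : ∀ (s : S) (e : E), s • e = algebraMap S (S ⊗[O] A) s • e := fun s e =>
    (algebraMap_smul (S ⊗[O] A) s e).symm
  let g : X.M →ₗ[R] E :=
    { toFun := fun x => (1 : S ⊗[O] A) ⊗ₜ x
      map_add' := fun x y => TensorProduct.tmul_add _ _ _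
      map_smul' := fun r x => by
        rw [RingHom.id_apply, ← algebraMap_smul (R ⊗[O] A) r x, TensorProduct.tmul_smul,
          algebraMap_smul] }
  let toY : E →ₗ[S ⊗[O] A] (X.baseChange S).M := f.liftBaseChange (S ⊗[O] A)
  let inv : (X.baseChange S).M →ₗ[S] E :=
    (g.liftBaseChange S).comp (X.bcM S).symm.toLinearMap
  have hinv : ∀ x, inv (X.bcM S (1 ⊗ₜ x)) = 1 ⊗ₜ x := fun x => by
    simp [inv, g]
  have hinvC : ∀ (c : S ⊗[O] A) x, inv (c • X.bcM S (1 ⊗ₜ x)) = c ⊗ₜ x := by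
    intro c x
    induction c with
    | zero => simp
    | add c c' h h' => rw [add_smul, map_add, h, h', TensorProduct.add_tmul]
    | tmul s a =>
      have e : (s ⊗ₜ[O] a : S ⊗[O] A) = s • ((1 : S) ⊗ₜ[O] a) := by
        rw [TensorProduct.smul_tmul', smul_eq_mul, mul_one]
      have e' : (1 : S) ⊗ₜ[O] a = algebraMap (R ⊗[O] A) (S ⊗[O] A) ((1 : R) ⊗ₜ a) := by
        change _ = j _
        rw [Algebra.TensorProduct.map_tmul, map_one]
        rfl
      rw [e, smul_assoc, bcM_smul, map_smul, hinv, hS, TensorProduct.tmul_smul,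
        TensorProduct.smul_tmul', TensorProduct.smul_tmul',
        Algebra.smul_def ((1 : R) ⊗ₜ[O] a : R ⊗[O] A), ← e', mul_one, algebraMap_smul]
  have hbij : Function.Bijective toY := by
    refine Function.bijective_iff_has_inverse.2 ⟨inv, fun e => ?_, fun z => ?_⟩
    · induction e using TensorProduct.induction_on with
      | zero => simp
      | add e e' h h' => rw [map_add, map_add, h, h']
      | tmul c x =>
        rw [LinearMap.liftBaseChange_tmul]
        exact hinvC c x
    · induction z using X.bc_induction S with
      | h0 => simp
      | ha x y hx hy => rw [map_add, map_add, hx, hy]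
      | ht s x =>
        have e : X.bcM S (s ⊗ₜ x) = algebraMap S (S ⊗[O] A) s • X.bcM S (1 ⊗ₜ x) := by
          rw [algebraMap_smul, ← map_smul, TensorProduct.smul_tmul', smul_eq_mul, mul_one]
        rw [e, hinvC, LinearMap.liftBaseChange_tmul]
        rfl
  let eqv : E ≃ₗ[S ⊗[O] A] (X.baseChange S).M := LinearEquiv.ofBijective toY hbij
  refine ⟨Module.Finite.equiv eqv, Module.Projective.of_equiv eqv, fun P => ?_⟩
  rw [← Module.rankAtStalk_eq_of_equiv eqv, Module.rankAtStalk_baseChange, hX.rank]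

end FormModule

end LocalFreeness

/-! ### Triviality in étale neighbourhoods -/

section LocalTriviality

/-- Over a semilocal ring a locally free module of constant rank is free. -/
theorem nonempty_basis_of_rankAtStalk_eq {C : Type*} [CommRing C] [Finite (MaximalSpectrum C)]
    {M : Type*} [AddCommGroup M] [Module C M] [Module.Finite C M] [Module.Projective C M] (n : ℕ)
    (h : ∀ P : PrimeSpectrum C, Module.rankAtStalk M P = n) :
    Nonempty (Module.Basis (Fin n) C M) := by
  refine Module.nonempty_basis_of_flat_of_finrank_eq C M n fun P => ?_
  let := Ideal.Quotient.field P.1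
  have h1 := Module.rankAtStalk_baseChange (R := C) (M := M) (S := C ⧸ P.1) ⊥
  rw [h, Module.rankAtStalk_eq_finrank_of_free] at h1
  exact h1

/-- An invertible module is trivial near a prime `p`. -/
theorem exists_linearEquiv_of_invertible {R : Type uR} [CommRing R] {L : Type uL} [AddCommGroup L]
    [Module R L] [Module.Invertible R L] (p : Ideal R) [p.IsPrime] :
    ∃ t, t ∉ p ∧ ∀ (S : Type uS) [CommRing S] [Algebra R S], IsUnit (algebraMap R S t) →
      Nonempty (S ⊗[R] L ≃ₗ[S] S) := by
  let b : Module.Basis Unit p.ResidueField (p.ResidueField ⊗[R] L) :=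
    Module.basisUnique Unit (Module.Invertible.finrank_eq_one _ _)
  obtain ⟨s, x, hs, hx⟩ := exists_smul_eq_one_tmul p (b ())
  have hu : ∀ _ : Unit, IsUnit (algebraMap R p.ResidueField s) := fun _ => IsUnit.mk0 _ hs
  have := Module.finitePresentation_of_projective R L
  obtain ⟨t, ht, h⟩ := exists_basis_of_fiber.{uR, uS, uL} p (fun _ : Unit => x) (b.isUnitSMul hu)
    fun i => by
      rw [Module.Basis.isUnitSMul_apply, algebraMap_smul]
      exact hx
  refine ⟨t, ht, fun S _ _ hS => ?_⟩
  obtain ⟨b', -⟩ := h S hS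
  exact ⟨b'.equivFun.trans (LinearEquiv.funUnique Unit S S)⟩

variable {O : Type uO} {A : Type uA} [CommRing O] [CommRing A] [Algebra O A] {D : QuadDatum O A}
variable {R : Type uR} [CommRing R] [Algebra O R]

/-- A family which together with its multiples by a basis of `A` is a basis over `R` is a basis
over `R ⊗ A`. -/
theorem exists_basis_of_basis_smul {κ : Type*} [Fintype κ] (a : Module.Basis κ O A) {M : Type uM}
    [AddCommGroup M] [Module R M] [Module (R ⊗[O] A) M] [IsScalarTower R (R ⊗[O] A) M]
    {ι : Type*} [Fintype ι] (z : ι → M) (b : Module.Basis (κ × ι) R M)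
    (hb : ∀ k i, b (k, i) = ((1 : R) ⊗ₜ[O] a k) • z i) :
    ∃ e : Module.Basis ι (R ⊗[O] A) M, ∀ i, e i = z i := by
  obtain ⟨a', ha'⟩ : ∃ a' : Module.Basis κ R (R ⊗[O] A), ∀ k, a' k = 1 ⊗ₜ a k :=
    ⟨Algebra.TensorProduct.basis R a, Algebra.TensorProduct.basis_apply a⟩
  have ha : ∀ (c : R ⊗[O] A) i, c • z i = ∑ k, a'.repr c k • b (k, i) := fun c i => by
    conv_lhs => rw [← a'.sum_repr c]
    rw [Finset.sum_smul]
    refine Finset.sum_congr rfl fun k _ => ?_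
    rw [smul_assoc, hb, ha']
  have hli : LinearIndependent (R ⊗[O] A) z := by
    rw [Fintype.linearIndependent_iff]
    intro g hg i
    have h1 : ∑ ki : κ × ι, a'.repr (g ki.2) ki.1 • b ki = 0 := by
      rw [Fintype.sum_prod_type, Finset.sum_comm, ← hg]
      exact Finset.sum_congr rfl fun i _ => (ha (g i) i).symm
    have h2 := Fintype.linearIndependent_iff.1 b.linearIndependent
      (fun ki : κ × ι => a'.repr (g ki.2) ki.1) h1
    refine a'.ext_elem fun k => ?_
    rw [map_zero, Finsupp.zero_apply]
    exact h2 (k, i)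
  have hsp : ⊤ ≤ Submodule.span (R ⊗[O] A) (Set.range z) := by
    intro x _
    rw [← b.sum_repr x]
    refine Submodule.sum_mem _ fun ki _ => ?_
    rw [← algebraMap_smul (R ⊗[O] A), show b ki = _ from hb ki.1 ki.2]
    exact Submodule.smul_mem _ _ (Submodule.smul_mem _ _ (Submodule.subset_span ⟨_, rfl⟩))
  exact ⟨Module.Basis.mk hli hsp, fun i => Module.Basis.mk_apply _ _ _⟩

namespace FormModule

variable {X : FormModule.{uO, uA, uR, uM, uL} O A R}

/-- The underlying module is free over `R ⊗ A` near a prime `p` of `R`, although `R ⊗ A` is not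
local. -/
theorem IsHermitian.exists_basis {d : ℕ} (hX : X.IsHermitian D d) (p : Ideal R) [p.IsPrime] :
    ∃ t, t ∉ p ∧ ∀ (S : Type uS) [CommRing S] [Algebra R S] [Algebra O S] [IsScalarTower O R S],
      IsUnit (algebraMap R S t) →
        Nonempty (Module.Basis (Fin d) (S ⊗[O] A) (X.baseChange S).M) := by
  let κ := p.ResidueField
  obtain ⟨_, _, hrk⟩ := hX.baseChange_rank κ
  have hA : Module.Finite O A := Module.Finite.of_basis D.basis
  have hA' : Module.Free O A := Module.Free.of_basis D.basis
  have : IsArtinianRing (κ ⊗[O] A) := IsArtinianRing.of_finite κ _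
  -- The fibre is locally free of constant rank over an artinian ring, hence free.
  obtain ⟨y⟩ := nonempty_basis_of_rankAtStalk_eq d hrk
  choose s x hs hx using fun i => exists_smul_eq_one_tmul p ((X.bcM κ).symm (y i))
  have hu : ∀ i, IsUnit (algebraMap κ (κ ⊗[O] A) (algebraMap R κ (s i))) := fun i =>
    (IsUnit.mk0 _ (hs i)).map _
  let b : Module.Basis (Fin 2 × Fin d) κ (κ ⊗[R] X.M) :=
    ((Algebra.TensorProduct.basis κ D.basis).smulTower (y.isUnitSMul hu)).map (X.bcM κ).symm
  have hb : ∀ ki, b ki = 1 ⊗ₜ (((1 : R) ⊗ₜ[O] D.basis ki.1) • x ki.2) := fun ki => by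
    rw [Module.Basis.map_apply, Module.Basis.smulTower_apply, Algebra.TensorProduct.basis_apply,
      Module.Basis.isUnitSMul_apply, LinearEquiv.symm_apply_eq, ← bcM_smul, ← hx, algebraMap_smul,
      ← LinearEquiv.apply_symm_apply (X.bcM κ) (y ki.2), ← map_smul, algebraMap_smul,
      LinearEquiv.apply_symm_apply]
  have := hX.finite
  have := hX.projective
  have : Module.Finite R X.M := Module.Finite.trans (R ⊗[O] A) X.M
  have : Module.Flat R X.M := Module.Flat.trans R (R ⊗[O] A) X.M
  have := Module.finitePresentation_of_projective (R ⊗[O] A) X.M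
  have := Module.finitePresentation_of_projective R (R ⊗[O] A)
  have : Module.FinitePresentation R X.M := Module.FinitePresentation.trans R X.M (R ⊗[O] A)
  obtain ⟨t, ht, h⟩ := exists_basis_of_fiber.{uR, uS, uM} p _ b hb
  refine ⟨t, ht, fun S _ _ _ _ hS => ?_⟩
  obtain ⟨b', hb'⟩ := h S hS
  obtain ⟨e, -⟩ := exists_basis_of_basis_smul D.basis (fun i => X.bcM S (1 ⊗ₜ x i))
    (b'.map (X.bcM S)) fun k i => by
      rw [Module.Basis.map_apply, hb', bcM_smul]
  exact ⟨e⟩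

theorem dividedDisc_eq_matDisc {m : ℕ} (e : Module.Basis (Fin (2 * m + 1)) (R ⊗[O] A) X.M)
    (ℓ : X.L ≃ₗ[R] R) {B : Matrix (Fin (2 * m + 1)) (Fin (2 * m + 1)) (Quad D.π₀ D.τ R)}
    (hq : ∀ i, ℓ (X.q (e i)) = Quad.tr (B i i)) (hφ : ∀ i j, ℓ (X.φ (e i) (e j)) = (herm B i j).im)
    (hφπ : ∀ i j, ℓ (X.φ (e i) (D.piR R • e j)) = Quad.tr (herm B i j)) :
    X.dividedDisc D e ℓ = matDisc D B := by
  rw [dividedDisc, matDisc]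
  have h1 : (fun i => ℓ (X.q (e i))) = fun i => Quad.tr (B i i) := funext hq
  have h2 : (fun ij : Fin (2 * m + 1) × Fin (2 * m + 1) => ℓ (X.φ (e ij.1) (e ij.2)))
      = fun ij => (herm B ij.1 ij.2).im := funext fun ij => hφ ij.1 ij.2
  have h3 : (fun ij : Fin (2 * m + 1) × Fin (2 * m + 1) =>
      ℓ (X.φ (e ij.1) (((1 : R) ⊗ₜ[O] D.π) • e ij.2)))
      = fun ij => Quad.tr (herm B ij.1 ij.2) := funext fun ij => hφπ ij.1 ij.2
  rw [h1, h2, h3]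

/-- Near every geometric point, a module of type `Λ₀` is similar to the standard module. -/
theorem IsTypeLambdaZero.exists_etaleNhd [IsDomain O] (hc : D.c ≠ 0) (hπ : D.π₀ ∣ 2) {k : ℕ}
    (h2 : 2 ∣ D.π₀ ^ k) (hc' : D.c ∣ D.π₀ ^ k) {m : ℕ} {K : Type uK} [Field K] [Algebra O K]
    [IsAlgClosed K] (hX : X.IsTypeLambdaZero D m) (σ : R →ₐ[O] K) :
    ∃ N : EtaleNhd σ, (X.baseChange N.S).Similar (stdModule D N.S m) := by
  have : (RingHom.ker σ).IsPrime := RingHom.ker_isPrime σ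
  obtain ⟨t₁, ht₁, h₁⟩ := IsHermitian.exists_basis.{uO, uA, uR, uR, uM, uL} hX.1 (RingHom.ker σ)
  have := hX.1.invertible
  obtain ⟨t₂, ht₂, h₂⟩ := exists_linearEquiv_of_invertible.{uR, uR, uL} (L := X.L) (RingHom.ker σ)
  have ht : σ (t₁ * t₂) ≠ 0 := by
    rw [map_mul]
    exact mul_ne_zero ht₁ ht₂
  obtain ⟨N, hN⟩ := EtaleNhd.exists_isUnit σ ht
  have hN' : IsUnit (algebraMap R N.S (t₁ * t₂)) := hN
  rw [map_mul] at hN'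
  obtain ⟨e⟩ := h₁ N.S (isUnit_of_mul_isUnit_left hN')
  obtain ⟨ℓ₀⟩ := h₂ N.S (isUnit_of_mul_isUnit_right hN')
  let ℓ : (X.baseChange N.S).L ≃ₗ[N.S] N.S := (X.bcL N.S).symm.trans ℓ₀
  have hH := hX.1.hermAxioms
  obtain ⟨B, hB, hq, hφ, hφπ⟩ := exists_similar_ofMatrix (hH.baseChange N.S) e ℓ
  have hu : IsUnit (matDisc D B) := by
    rw [← dividedDisc_eq_matDisc e ℓ hq hφ hφπ]
    exact hX.2 N.S e ℓ
  obtain ⟨N', u, hu'⟩ := exists_simBy_stdMat D hc hπ h2 hc' m N.point B hu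
  refine ⟨N.comp N', ?_⟩
  let : Algebra R N'.S := (N.comp N').algebraR
  have : IsScalarTower R N.S N'.S := IsScalarTower.of_algebraMap_eq fun _ => rfl
  have : IsScalarTower O R N'.S := (N.comp N').tower
  exact (hH.baseChange_baseChange (S := N.S) (T := N'.S)).trans
    (((Similar.baseChange (S := N'.S) hB (hH.baseChange N.S)).trans
      (ofMatrix_baseChange B N'.S)).trans
        ((similar_of_simBy _ hu').trans (stdModule_similar D m).symm))

end FormModule

end LocalTriviality

/-! ### Gluing over a finite cover -/

section Gluing

variable {O : Type uO} {A : Type uA} [CommRing O] [CommRing A] [Algebra O A] {D : QuadDatum O A}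
variable {R : Type uR} [CommRing R] [Algebra O R]

theorem rTensor_smul {S T : Type*} [CommRing S] [CommRing T] [Algebra R S] [Algebra R T]
    (h : S →ₐ[R] T) (N : Type*) [AddCommGroup N] [Module R N] (s : S) (z : S ⊗[R] N) :
    h.toLinearMap.rTensor N (s • z) = h s • h.toLinearMap.rTensor N z := by
  induction z with
  | zero => simp
  | add x y hx hy => rw [smul_add, map_add, hx, hy, map_add, smul_add]
  | tmul s' x =>
    rw [TensorProduct.smul_tmul', LinearMap.rTensor_tmul, LinearMap.rTensor_tmul,
      TensorProduct.smul_tmul']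
    simp

/-- Tensor products with a finite product of algebras are computed componentwise. -/
noncomputable def piTensor {ι : Type*} [Finite ι] (S : ι → Type*) [∀ i, CommRing (S i)]
    [∀ i, Algebra R (S i)] (N : Type*) [AddCommGroup N] [Module R N] :
    (∀ i, S i) ⊗[R] N ≃ₗ[∀ i, S i] ∀ i, S i ⊗[R] N :=
  LinearEquiv.ofBijective
    { toFun := fun z i => (Pi.evalAlgHom R S i).toLinearMap.rTensor N z
      map_add' := fun x y => by ext i; simp
      map_smul' := fun s z => by ext i; exact rTensor_smul (Pi.evalAlgHom R S i) N s z } (by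
    classical
    cases nonempty_fintype ι
    let E : (∀ i, S i) ⊗[R] N ≃ₗ[R] ∀ i, S i ⊗[R] N :=
      ((TensorProduct.comm R _ _).trans (TensorProduct.piRight R R N S)).trans
        (LinearEquiv.piCongrRight fun i => TensorProduct.comm R _ _)
    convert E.bijective using 1
    funext z
    induction z with
    | zero => funext i; simp
    | add x y hx hy => rw [map_add, map_add, hx, hy]
    | tmul s x =>
      funext i
      simp [E])

namespace FormModule

section

variable (X : FormModule.{uO, uA, uR, uM, uL} O A R)
variable {S : Type uS} [CommRing S] [Algebra R S] [Algebra O S] [IsScalarTower O R S]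
variable {T : Type uT} [CommRing T] [Algebra R T] [Algebra O T] [IsScalarTower O R T]

/-- The map of base changes of `M` induced by a homomorphism of algebras. -/
noncomputable def bcMapM (h : S →ₐ[R] T) : (X.baseChange S).M →+ (X.baseChange T).M :=
  ((X.bcM T : _ →+ _).comp (h.toLinearMap.rTensor X.M).toAddMonoidHom).comp
    ((X.bcM S).symm : _ →+ _)

/-- The map of base changes of `L` induced by a homomorphism of algebras. -/
noncomputable def bcMapL (h : S →ₐ[R] T) : (X.baseChange S).L →+ (X.baseChange T).L :=
  ((X.bcL T : _ →+ _).comp (h.toLinearMap.rTensor X.L).toAddMonoidHom).comp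
    ((X.bcL S).symm : _ →+ _)

theorem bcMapM_bcM (h : S →ₐ[R] T) (z : S ⊗[R] X.M) :
    X.bcMapM h (X.bcM S z) = X.bcM T (h.toLinearMap.rTensor X.M z) := by
  simp [bcMapM]

theorem bcMapL_bcL (h : S →ₐ[R] T) (z : S ⊗[R] X.L) :
    X.bcMapL h (X.bcL S z) = X.bcL T (h.toLinearMap.rTensor X.L z) := by
  simp [bcMapL]

variable {X}

theorem piR_smul_bcMapM (h : S →ₐ[R] T) (z : (X.baseChange S).M) :
    X.bcMapM h (D.piR S • z) = D.piR T • X.bcMapM h z := by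
  induction z using X.bc_induction S with
  | h0 => simp
  | ha x y hx hy => rw [smul_add, map_add, map_add, smul_add, hx, hy]
  | ht s x =>
    have h1 : D.piR S • X.bcM S (s ⊗ₜ x) = X.bcM S (s ⊗ₜ (D.piR R • x)) := X.bcM_smul S _ _ _
    have h2 : D.piR T • X.bcM T (h s ⊗ₜ x) = X.bcM T (h s ⊗ₜ (D.piR R • x)) := X.bcM_smul T _ _ _
    rw [h1, bcMapM_bcM, bcMapM_bcM, LinearMap.rTensor_tmul, LinearMap.rTensor_tmul]
    exact h2.symm

theorem φ_bcMapM (h : S →ₐ[R] T) (x y : (X.baseChange S).M) :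
    (X.baseChange T).φ (X.bcMapM h x) (X.bcMapM h y) = X.bcMapL h ((X.baseChange S).φ x y) := by
  induction x using X.bc_induction S with
  | h0 => simp
  | ha x x' hx hx' => simp only [map_add, LinearMap.add_apply, hx, hx']
  | ht s x =>
    induction y using X.bc_induction S with
    | h0 => simp
    | ha y y' hy hy' => simp only [map_add, hy, hy']
    | ht s' y =>
      rw [bcMapM_bcM, bcMapM_bcM, bc_φ_tmul, bcMapL_bcL, LinearMap.rTensor_tmul,
        LinearMap.rTensor_tmul, LinearMap.rTensor_tmul, bc_φ_tmul]
      simp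

theorem HermAxioms.q_bcMapM (hX : X.HermAxioms D) (h : S →ₐ[R] T) (x : (X.baseChange S).M) :
    (X.baseChange T).q (X.bcMapM h x) = X.bcMapL h ((X.baseChange S).q x) := by
  induction x using X.bc_induction S with
  | h0 => simp
  | ha x y hx hy =>
    rw [map_add, (hX.baseChange T).q_add, (hX.baseChange S).q_add, ← piR_smul_bcMapM, φ_bcMapM,
      hx, hy, map_add, map_add]
  | ht s x =>
    rw [bcMapM_bcM, bc_q_tmul, bcMapL_bcL, LinearMap.rTensor_tmul, LinearMap.rTensor_tmul,
      bc_q_tmul]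
    simp

end

variable {X : FormModule.{uO, uA, uR, uM, uL} O A R} {Y : FormModule.{uO, uA, uR, uM', uL'} O A R}

/-- Similarity can be checked on the factors of a finite product of algebras. -/
theorem HermAxioms.similar_pi (hX : X.HermAxioms D) (hY : Y.HermAxioms D) {ι : Type uT} [Finite ι]
    (S : ι → Type uS) [∀ i, CommRing (S i)] [∀ i, Algebra R (S i)] [∀ i, Algebra O (S i)]
    [∀ i, IsScalarTower O R (S i)]
    (h : ∀ i, (X.baseChange (S i)).Similar (Y.baseChange (S i))) :
    (X.baseChange (∀ i, S i)).Similar (Y.baseChange (∀ i, S i)) := by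
  choose f γ hq hφ using h
  let f' : ∀ i, S i ⊗[R] X.M ≃ₗ[S i] S i ⊗[R] Y.M := fun i =>
    ((X.bcM (S i)).trans ((f i).restrictScalars (S i))).trans (Y.bcM (S i)).symm
  let γ' : ∀ i, S i ⊗[R] X.L ≃ₗ[S i] S i ⊗[R] Y.L := fun i =>
    ((X.bcL (S i)).trans (γ i)).trans (Y.bcL (S i)).symm
  let F : (∀ i, S i ⊗[R] X.M) ≃ₗ[∀ i, S i] ∀ i, S i ⊗[R] Y.M :=
    { toFun := fun w i => f' i (w i)
      invFun := fun w i => (f' i).symm (w i)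
      map_add' := fun x y => funext fun i => map_add (f' i) (x i) (y i)
      map_smul' := fun s x => funext fun i => map_smul (f' i) (s i) (x i)
      left_inv := fun w => funext fun i => (f' i).symm_apply_apply (w i)
      right_inv := fun w => funext fun i => (f' i).apply_symm_apply (w i) }
  let G : (∀ i, S i ⊗[R] X.L) ≃ₗ[∀ i, S i] ∀ i, S i ⊗[R] Y.L :=
    { toFun := fun w i => γ' i (w i)
      invFun := fun w i => (γ' i).symm (w i)
      map_add' := fun x y => funext fun i => map_add (γ' i) (x i) (y i)
      map_smul' := fun s x => funext fun i => map_smul (γ' i) (s i) (x i)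
      left_inv := fun w => funext fun i => (γ' i).symm_apply_apply (w i)
      right_inv := fun w => funext fun i => (γ' i).apply_symm_apply (w i) }
  let P := ∀ i, S i
  let ev := Pi.evalAlgHom R S
  let a : (X.baseChange P).M ≃ₗ[P] (Y.baseChange P).M :=
    (((X.bcM P).symm.trans (piTensor S X.M)).trans F).trans
      ((piTensor S Y.M).symm.trans (Y.bcM P))
  let b : (X.baseChange P).L ≃ₗ[P] (Y.baseChange P).L :=
    (((X.bcL P).symm.trans (piTensor S X.L)).trans G).trans
      ((piTensor S Y.L).symm.trans (Y.bcL P))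
  have hMX : ∀ i z, X.bcMapM (ev i) (X.bcM P z) = X.bcM (S i) (piTensor S X.M z i) :=
    fun i z => X.bcMapM_bcM _ _
  have hMY : ∀ i z, Y.bcMapM (ev i) (Y.bcM P z) = Y.bcM (S i) (piTensor S Y.M z i) :=
    fun i z => Y.bcMapM_bcM _ _
  have hLX : ∀ i z, X.bcMapL (ev i) (X.bcL P z) = X.bcL (S i) (piTensor S X.L z i) :=
    fun i z => X.bcMapL_bcL _ _
  have hLY : ∀ i z, Y.bcMapL (ev i) (Y.bcL P z) = Y.bcL (S i) (piTensor S Y.L z i) :=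
    fun i z => Y.bcMapL_bcL _ _
  have ha : ∀ i z, Y.bcMapM (ev i) (a z) = f i (X.bcMapM (ev i) z) := by
    intro i z
    obtain ⟨z, rfl⟩ := (X.bcM P).surjective z
    simp only [a, LinearEquiv.trans_apply, LinearEquiv.symm_apply_apply]
    rw [hMX, hMY, LinearEquiv.apply_symm_apply]
    exact (Y.bcM (S i)).apply_symm_apply _
  have hb : ∀ i z, Y.bcMapL (ev i) (b z) = γ i (X.bcMapL (ev i) z) := by
    intro i z
    obtain ⟨z, rfl⟩ := (X.bcL P).surjective z
    simp only [b, LinearEquiv.trans_apply, LinearEquiv.symm_apply_apply]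
    rw [hLX, hLY, LinearEquiv.apply_symm_apply]
    exact (Y.bcL (S i)).apply_symm_apply _
  have hM : ∀ z z', (∀ i, Y.bcMapM (ev i) z = Y.bcMapM (ev i) z') → z = z' := by
    intro z z' h
    obtain ⟨z, rfl⟩ := (Y.bcM P).surjective z
    obtain ⟨z', rfl⟩ := (Y.bcM P).surjective z'
    exact congrArg _ ((piTensor S Y.M).injective (funext fun i =>
      (Y.bcM (S i)).injective (((hMY i z).symm.trans (h i)).trans (hMY i z'))))
  have hL : ∀ z z', (∀ i, Y.bcMapL (ev i) z = Y.bcMapL (ev i) z') → z = z' := by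
    intro z z' h
    obtain ⟨z, rfl⟩ := (Y.bcL P).surjective z
    obtain ⟨z', rfl⟩ := (Y.bcL P).surjective z'
    exact congrArg _ ((piTensor S Y.L).injective (funext fun i =>
      (Y.bcL (S i)).injective (((hLY i z).symm.trans (h i)).trans (hLY i z'))))
  refine Similar.of_linear D a b (fun x => hM _ _ fun i => ?_) (fun x => hL _ _ fun i => ?_)
    (fun x y => hL _ _ fun i => ?_)
  · rw [ha, piR_smul_bcMapM, piR_smul_bcMapM, ha, map_smul]
  · rw [← hY.q_bcMapM, ha, hq, hX.q_bcMapM, hb]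
  · rw [← φ_bcMapM, ha, ha, hφ, φ_bcMapM, hb]

/-- Similarity over étale algebras whose spectra cover `Spec R` is étale local similarity. -/
theorem HermAxioms.etaleLocallySimilar_of_cover (hX : X.HermAxioms D) (hY : Y.HermAxioms D)
    (S : PrimeSpectrum R → Type uR) [∀ i, CommRing (S i)] [∀ i, Algebra R (S i)]
    [∀ i, Algebra O (S i)] [∀ i, IsScalarTower O R (S i)] [∀ i, Algebra.Etale R (S i)]
    (hS : ∀ i, i ∈ Set.range (PrimeSpectrum.comap (algebraMap R (S i))))
    (h : ∀ i, (X.baseChange (S i)).Similar (Y.baseChange (S i))) : X.EtaleLocallySimilar Y := by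
  have hopen : ∀ i, IsOpen (Set.range (PrimeSpectrum.comap (algebraMap R (S i)))) := fun i =>
    (PrimeSpectrum.isOpenMap_comap_of_hasGoingDown_of_finitePresentation
      (R := R) (S := S i)).isOpen_range
  obtain ⟨t, ht⟩ := isCompact_univ.elim_finite_subcover _ hopen
    fun i _ => Set.mem_iUnion.2 ⟨i, hS i⟩
  let T : t → Type uR := fun i => S i
  have hff : Module.FaithfullyFlat R (∀ i, T i) := by
    refine Module.FaithfullyFlat.of_comap_surjective fun p => ?_
    obtain ⟨i, hi, P, rfl⟩ : ∃ i ∈ t, p ∈ Set.range (PrimeSpectrum.comap (algebraMap R (S i))) := by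
      simpa using ht (Set.mem_univ p)
    refine ⟨PrimeSpectrum.comap (Pi.evalRingHom T ⟨i, hi⟩) P, ?_⟩
    rw [← PrimeSpectrum.comap_comp_apply]
    rfl
  exact ⟨∀ i, T i, inferInstance, inferInstance, inferInstance, inferInstance, inferInstance, hff,
    hX.similar_pi hY T fun i => h i⟩

end FormModule

/-- The image of an étale neighbourhood contains the point that it is a neighbourhood of. -/
theorem EtaleNhd.ker_mem_range {K : Type uK} [Field K] [Algebra O K] {σ : R →ₐ[O] K}
    (N : EtaleNhd σ) (p : PrimeSpectrum R) (hp : p.asIdeal = RingHom.ker σ) :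
    p ∈ Set.range (PrimeSpectrum.comap (algebraMap R N.S)) := by
  refine ⟨⟨RingHom.ker N.point, RingHom.ker_isPrime N.point⟩, PrimeSpectrum.ext ?_⟩
  rw [hp]
  ext r
  change N.point (N.hom r) = 0 ↔ σ r = 0
  rw [N.point_hom]

open FormModule in
/-- Modules of type `Λ₀` are étale locally similar to the standard module. -/
theorem FormModule.IsTypeLambdaZero.etaleLocallySimilar_stdModule [IsDomain O] (hc : D.c ≠ 0)
    (hπ : D.π₀ ∣ 2) {k : ℕ} (h2 : 2 ∣ D.π₀ ^ k) (hc' : D.c ∣ D.π₀ ^ k) {m : ℕ}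
    {X : FormModule.{uO, uA, uR, uM, uL} O A R} (hX : X.IsTypeLambdaZero D m) :
    X.EtaleLocallySimilar (stdModule D R m) := by
  let σ : ∀ p : PrimeSpectrum R, R →ₐ[O] AlgebraicClosure p.asIdeal.ResidueField := fun p =>
    IsScalarTower.toAlgHom O R _
  have hσ : ∀ p : PrimeSpectrum R, p.asIdeal = RingHom.ker (σ p) := fun p => by
    ext r
    change _ ↔ algebraMap R (AlgebraicClosure p.asIdeal.ResidueField) r = 0
    rw [IsScalarTower.algebraMap_apply R p.asIdeal.ResidueField, map_eq_zero_iff _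
      (algebraMap p.asIdeal.ResidueField (AlgebraicClosure _)).injective,
      Ideal.algebraMap_residueField_eq_zero]
  choose N hN using fun p => hX.exists_etaleNhd hc hπ h2 hc' (σ p)
  exact hX.1.hermAxioms.etaleLocallySimilar_of_cover (stdModule_hermAxioms D m)
    (fun p => (N p).S) (fun p => (N p).ker_mem_range p (hσ p))
    fun p => (hN p).trans (stdModule_baseChange D (N p).S m).symm

end Gluing

/-! ### The quadratic extension of local fields -/

section IntegerRing

variable {F₀ : Type u} {F : Type v} [Field F₀] [Field F] [Algebra ℤ_[2] F₀] [Algebra F₀ F]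

namespace UniformizerDatum

variable (U : UniformizerDatum F₀ F)

theorem not_isUnit_of_π₀_dvd {x : IntBase F₀} (h : U.π₀ ∣ x) : ¬ IsUnit x :=
  (U.isUniformizer_π₀.2 x).1 h

theorem isUnit_one_sub_π₀_mul (x : IntBase F₀) : IsUnit (1 - U.π₀ * x) := by
  by_contra h
  have h1 : U.π₀ ∣ 1 := by
    have := dvd_add ((U.isUniformizer_π₀.2 _).2 h) (dvd_mul_right U.π₀ x)
    rwa [sub_add_cancel] at this
  exact U.not_isUnit_of_π₀_dvd h1 isUnit_one

theorem π_sub_conj_ne_zero (hF : Module.finrank F₀ F = 2) : (U.π : F) - U.σ U.π ≠ 0 := by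
  intro h
  apply U.σ_ne_one
  ext x
  obtain ⟨a, b, rfl⟩ := U.exists_field_coords hF x
  rw [map_add, map_mul, AlgEquiv.commutes, AlgEquiv.commutes, ← sub_eq_zero.1 h]
  rfl

variable [Algebra ℚ_[2] F₀] [IsScalarTower ℤ_[2] ℚ_[2] F₀] [FiniteDimensional ℚ_[2] F₀]

/-- Two is not invertible in the integers, because it is not invertible in `ℤ₂`. -/
theorem π₀_dvd_two : U.π₀ ∣ 2 := by
  rw [U.isUniformizer_π₀.2]
  intro h
  have hinj : Function.Injective (algebraMap ℤ_[2] (IntBase F₀)) := by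
    intro x y hxy
    have h1 : algebraMap ℤ_[2] F₀ x = algebraMap ℤ_[2] F₀ y := congrArg Subtype.val hxy
    rw [IsScalarTower.algebraMap_apply ℤ_[2] ℚ_[2] F₀,
      IsScalarTower.algebraMap_apply ℤ_[2] ℚ_[2] F₀] at h1
    exact IsFractionRing.injective ℤ_[2] ℚ_[2] ((algebraMap ℚ_[2] F₀).injective h1)
  have hint : (algebraMap ℤ_[2] (IntBase F₀)).IsIntegral :=
    algebraMap_isIntegral_iff.2 integralClosure.AlgebraIsIntegral
  have hloc := hint.isLocalHom hinj
  have h2 : IsUnit (algebraMap ℤ_[2] (IntBase F₀) 2) := by rwa [map_ofNat]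
  exact (PadicInt.prime_p (p := 2)).not_isUnit (hloc.map_nonunit _ h2)

/-- Every nonzero integer divides a power of the uniformizer. -/
theorem exists_dvd_pow {x : IntBase F₀} (hx : x ≠ 0) : ∃ k, x ∣ U.π₀ ^ k := by
  have : IsNoetherianRing (IntBase F₀) := integralClosure.isNoetherianRing (K := ℚ_[2]) F₀
  induction x using (wellFounded_dvdNotUnit (α := IntBase F₀)).induction with
  | _ x ih =>
    by_cases hu : IsUnit x
    · exact ⟨0, hu.dvd⟩
    · obtain ⟨y, rfl⟩ := (U.isUniformizer_π₀.2 x).2 hu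
      have hy : y ≠ 0 := right_ne_zero_of_mul hx
      obtain ⟨k, hk⟩ := ih y ⟨hy, U.π₀, U.not_isUnit_of_π₀_dvd dvd_rfl, mul_comm _ _⟩ hy
      exact ⟨k + 1, by rw [pow_succ']; exact mul_dvd_mul_left _ hk⟩

theorem c_ne_zero (hF : Module.finrank F₀ F = 2) : (U.toQuadDatum hF).c ≠ 0 := by
  intro hc
  have h1 := (U.toQuadDatum hF).π₀_mul_c
  rw [hc, mul_zero] at h1
  have h2 := congrArg (algebraMap (IntBase F₀) F) h1
  have h3 : (U.toQuadDatum hF).t = U.t := U.t_eq.symm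
  have h4 : (U.toQuadDatum hF).π₀ = U.π₀ := rfl
  rw [map_zero, map_sub, map_mul, map_pow, map_ofNat, h3, h4] at h2
  apply U.π_sub_conj_ne_zero hF
  rw [← pow_eq_zero_iff two_ne_zero]
  linear_combination h2 + ((U.π : F) + U.σ U.π + algebraMap (IntBase F₀) F U.t) * U.add_conj
    - 4 * U.mul_conj

theorem exists_two_dvd_and_c_dvd (hF : Module.finrank F₀ F = 2) :
    ∃ k, 2 ∣ U.π₀ ^ k ∧ (U.toQuadDatum hF).c ∣ U.π₀ ^ k := by
  have h2 : (2 : IntBase F₀) ≠ 0 := fun h =>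
    two_ne_zero_ext F₀ F₀ (congrArg (algebraMap (IntBase F₀) F₀) h)
  obtain ⟨k, hk⟩ := U.exists_dvd_pow (mul_ne_zero h2 (U.c_ne_zero hF))
  exact ⟨k, (dvd_mul_right _ _).trans hk, (dvd_mul_left _ _).trans hk⟩

end UniformizerDatum

end IntegerRing

section Lattice

variable {F₀ : Type u} {F : Type v} [Field F₀] [Field F] [Algebra ℤ_[2] F₀] [Algebra F₀ F]

namespace UniformizerDatum

variable (U : UniformizerDatum F₀ F)

/-- The coefficient `π / (π - σ π)`, an element of trace `1` whose quotient by `π` has trace `0`. -/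
noncomputable def hypCoeff : F := U.π / (U.π - U.σ U.π)

variable [Algebra ℚ_[2] F₀] [IsScalarTower ℤ_[2] ℚ_[2] F₀] [FiniteDimensional ℚ_[2] F₀]

/-- The constant `λ` and `π / (π - σ π)` differ by a unit of the ring of integers. -/
theorem exists_hypCoeff_eq (hF : Module.finrank F₀ F = 2) :
    ∃ a b : IntExt F₀ F, U.hypCoeff = a * U.lam ∧ U.lam = b * U.hypCoeff := by
  have hne := U.π_sub_conj_ne_zero hF
  have hp := U.π_ne_zero
  have hσp := U.σπ_ne_zero
  have h2 := two_ne_zero_ext F₀ F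
  by_cases ht : U.t = 0
  · have hσ : U.σ U.π = - U.π := by rw [U.σ_π, ht, map_zero, zero_sub]
    have h : U.hypCoeff = U.lam := by
      rw [hypCoeff, lam, if_pos ht, hσ, sub_neg_eq_add, ← two_mul,
        div_eq_div_iff (mul_ne_zero h2 hp) h2]
      ring
    exact ⟨1, 1, by rw [h]; simp, by rw [h]; simp⟩
  · have ht' := U.t_ne_zero_F ht
    obtain ⟨k, hk⟩ := (U.type.resolve_left ht).2
    obtain ⟨y, hy⟩ := (U.isUnit_one_sub_π₀_mul (k ^ 2)).exists_right_inv
    have hk' : (2 : F) = algebraMap (IntBase F₀) F U.t * algebraMap (IntBase F₀) F k := by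
      rw [← map_mul, ← hk, map_ofNat]
    have hy' : (1 - algebraMap (IntBase F₀) F U.π₀ * algebraMap (IntBase F₀) F k ^ 2)
        * algebraMap (IntBase F₀) F y = 1 := by
      have := congrArg (algebraMap (IntBase F₀) F) hy
      simpa only [map_mul, map_sub, map_one, map_pow] using this
    have hτ : algebraMap (IntBase F₀) F U.t
        = algebraMap (IntBase F₀) F U.π₀ * algebraMap (IntBase F₀) F U.τ := by
      rw [← map_mul, ← U.t_eq]
    have hm := U.mul_conj
    have ha := U.add_conj
    -- `π - σ π = t (k π - 1)` where `2 = t k`, and `k π - 1` has norm `-(1 - k² π₀)`.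
    have h1 : (U.π : F) - U.σ U.π
        = algebraMap (IntBase F₀) F U.t * (algebraMap (IntBase F₀) F k * U.π - 1) := by
      linear_combination (U.π : F) * hk' - ha
    have h2 : algebraMap (IntBase F₀) F k * U.π - 1 ≠ 0 := by
      intro h0
      rw [h0, mul_zero] at h1
      exact hne h1
    have h3 : (algebraMap (IntBase F₀) F k * U.π - 1) * (algebraMap (IntBase F₀) F k * U.σ U.π - 1)
        = -(1 - algebraMap (IntBase F₀) F U.π₀ * algebraMap (IntBase F₀) F k ^ 2) := by
      linear_combination algebraMap (IntBase F₀) F k ^ 2 * hm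
        - algebraMap (IntBase F₀) F k * ha + hk'
    -- `π / σ π = τ π - 1` and `σ π / π = τ σ π - 1`.
    have h4 : (algebraMap (IntBase F₀) F U.τ * U.π - 1) * U.σ U.π = U.π := by
      linear_combination algebraMap (IntBase F₀) F U.τ * hm - hτ - ha
    have h5 : (algebraMap (IntBase F₀) F U.τ * U.σ U.π - 1) * U.π = U.σ U.π := by
      linear_combination algebraMap (IntBase F₀) F U.τ * hm - hτ - ha
    have hw : U.hypCoeff
        = U.π / (algebraMap (IntBase F₀) F U.t * (algebraMap (IntBase F₀) F k * U.π - 1)) := by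
      rw [hypCoeff, h1]
    let ι := algebraMap (IntBase F₀) (IntExt F₀ F)
    refine ⟨(ι U.τ * U.π - 1) * (-(ι y * (ι k * U.conj U.π - 1))),
      (ι U.τ * U.conj U.π - 1) * (ι k * U.π - 1), ?_, ?_⟩
    · have e : (((ι U.τ * U.π - 1) * (-(ι y * (ι k * U.conj U.π - 1))) : IntExt F₀ F) : F)
          = (algebraMap (IntBase F₀) F U.τ * U.π - 1) * (-(algebraMap (IntBase F₀) F y
            * (algebraMap (IntBase F₀) F k * U.σ U.π - 1))) := rfl
      rw [e, hw, lam, if_neg ht, div_eq_iff (mul_ne_zero ht' h2)]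
      field_simp
      linear_combination (-(U.π : F)) * hy' + (algebraMap (IntBase F₀) F y) * (U.π : F) * h3
        + (algebraMap (IntBase F₀) F y) * (algebraMap (IntBase F₀) F k * U.π - 1) *
          (algebraMap (IntBase F₀) F k * U.σ U.π - 1) * h4
    · have e : (((ι U.τ * U.conj U.π - 1) * (ι k * U.π - 1) : IntExt F₀ F) : F)
          = (algebraMap (IntBase F₀) F U.τ * U.σ U.π - 1)
            * (algebraMap (IntBase F₀) F k * U.π - 1) := rfl
      rw [e, hw, lam, if_neg ht]
      field_simp
      linear_combination -h5

end UniformizerDatum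

end Lattice

/-! ### The identities of the lattice module -/

section LatticeModule

variable {F₀ : Type u} {F : Type v} [Field F₀] [Field F] [Algebra ℤ_[2] F₀] [Algebra F₀ F]

namespace UniformizerDatum

variable {U : UniformizerDatum F₀ F}

theorem trace_eq_of_add_conj (hF : Module.finrank F₀ F = 2) {z : F} {a : F₀}
    (h : z + U.σ z = algebraMap F₀ F a) : Algebra.trace F₀ F z = a :=
  (algebraMap F₀ F).injective ((U.algebraMap_trace hF z).trans h)

theorem trace_conj (hF : Module.finrank F₀ F = 2) (z : F) :
    Algebra.trace F₀ F (U.σ z) = Algebra.trace F₀ F z := by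
  apply U.trace_eq_of_add_conj hF
  rw [U.algebraMap_trace hF, U.σ_σ hF, add_comm]

theorem ε_ne_zero [Algebra ℚ_[2] F₀] : U.ε ≠ 0 := by
  rw [ε]
  split_ifs with h
  · exact two_ne_zero_ext F₀ F₀
  · exact fun h' => h (Subtype.ext h')

theorem t_eq_F : algebraMap (IntBase F₀) F U.t
    = algebraMap (IntBase F₀) F U.π₀ * algebraMap (IntBase F₀) F U.τ := by
  rw [← map_mul, ← U.t_eq]

theorem inv_π_add_inv_conj :
    (U.π : F)⁻¹ + (U.σ U.π)⁻¹ = algebraMap (IntBase F₀) F U.τ := by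
  have hp := U.π_ne_zero
  have hσp := U.σπ_ne_zero
  field_simp
  linear_combination U.add_conj + U.t_eq_F - algebraMap (IntBase F₀) F U.τ * U.mul_conj

theorem σ_hypCoeff (hF : Module.finrank F₀ F = 2) :
    U.σ U.hypCoeff = -(U.σ U.π / (U.π - U.σ U.π)) := by
  rw [hypCoeff, map_div₀, map_sub, U.σ_σ hF, ← div_neg, neg_sub]

theorem trace_one_eq_two (hF : Module.finrank F₀ F = 2) : Algebra.trace F₀ F 1 = 2 := by
  have h := Algebra.trace_algebraMap (S := F) (1 : F₀)
  rw [map_one, hF] at h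
  rw [h]
  simp

theorem trace_hypCoeff (hF : Module.finrank F₀ F = 2) :
    Algebra.trace F₀ F U.hypCoeff = 1 := by
  apply U.trace_eq_of_add_conj hF
  rw [σ_hypCoeff hF, hypCoeff, map_one, ← sub_eq_add_neg, ← sub_div,
    div_self (U.π_sub_conj_ne_zero hF)]

theorem trace_σ_hypCoeff_mul_inv (hF : Module.finrank F₀ F = 2) :
    Algebra.trace F₀ F (U.σ U.hypCoeff * (U.σ U.π)⁻¹) = 0 := by
  apply U.trace_eq_of_add_conj hF
  have hne := U.π_sub_conj_ne_zero hF
  have hp := U.π_ne_zero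
  have hσp := U.σπ_ne_zero
  rw [map_mul, U.σ_σ hF, map_inv₀, U.σ_σ hF, σ_hypCoeff hF, hypCoeff, map_zero]
  field_simp
  ring

theorem trace_hypCoeff_mul_inv (hF : Module.finrank F₀ F = 2) :
    Algebra.trace F₀ F (U.hypCoeff * (U.σ U.π)⁻¹) = U.τ := by
  apply U.trace_eq_of_add_conj hF
  have hne := U.π_sub_conj_ne_zero hF
  have hp := U.π_ne_zero
  have hσp := U.σπ_ne_zero
  change _ = algebraMap (IntBase F₀) F U.τ
  rw [map_mul, map_inv₀, U.σ_σ hF, σ_hypCoeff hF, hypCoeff, ← inv_π_add_inv_conj]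
  field_simp
  ring

theorem trace_inv_conj (hF : Module.finrank F₀ F = 2) :
    Algebra.trace F₀ F (U.σ U.π)⁻¹ = U.τ := by
  apply U.trace_eq_of_add_conj hF
  rw [map_inv₀, U.σ_σ hF, add_comm]
  exact inv_π_add_inv_conj

namespace SplitHermitianSpace

variable {m : ℕ} {V : Type w} [AddCommGroup V] [Module F V] (W : U.SplitHermitianSpace m V)

theorem qV_π_smul (x : V) : W.qV ((U.π : F) • x) = U.π₀ * W.qV x := by
  have h1 : W.h ((U.π : F) • x) ((U.π : F) • x) = algebraMap (IntBase F₀) F U.π₀ * W.h x x := by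
    rw [h_smul_left, h_smul_right, ← mul_assoc, U.mul_conj]
  rw [qV, h1, trace_base_mul, qV]
  ring

theorem φV_π_smul_left (hF : Module.finrank F₀ F = 2) (x y : V) :
    W.φV ((U.π : F) • x) y = W.φV x (U.σ U.π • y) := by
  rw [φV, φV, smul_comm _ (U.σ U.π), h_smul_left, W.h_smul_right (U.σ U.π), U.σ_σ hF]

theorem φV_swap (hF : Module.finrank F₀ F = 2) (x y : V) :
    W.φV x y = W.φV ((U.σ U.π / U.π) • y) x := by
  have hp := U.π_ne_zero
  have hσp := U.σπ_ne_zero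
  rw [φV, φV, h_smul_right, h_smul_left, h_smul_right, map_inv₀, W.h_conj x y,
    ← U.trace_conj hF ((U.σ U.π)⁻¹ * _), map_mul, map_inv₀, U.σ_σ hF]
  congr 2
  field_simp

theorem φV_self [Algebra ℚ_[2] F₀] (hF : Module.finrank F₀ F = 2) (x : V) :
    W.φV x x = U.τ * W.qV x := by
  have h2 : Algebra.trace F₀ F ((U.σ U.π)⁻¹ * W.h x x)
      = U.τ * (1 / 2 * Algebra.trace F₀ F (W.h x x)) := by
    apply U.trace_eq_of_add_conj hF
    have h3 := U.algebraMap_trace hF (W.h x x)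
    rw [← W.h_conj] at h3
    have h4 : (2 : F₀) ≠ 0 := two_ne_zero_ext F₀ F₀
    have h5 : algebraMap F₀ F (1 / 2 * Algebra.trace F₀ F (W.h x x)) = W.h x x := by
      have h6 := two_ne_zero_ext F₀ F
      rw [map_mul, h3, map_div₀, map_one, map_ofNat]
      field_simp
      ring
    rw [map_mul, ← W.h_conj, map_inv₀, U.σ_σ hF, map_mul, h5, ← add_mul, add_comm]
    exact congrArg (· * W.h x x) inv_π_add_inv_conj
  rw [φV, h_smul_right, map_inv₀, h2, qV]
  ring

variable [Algebra ℚ_[2] F₀] [IsScalarTower ℤ_[2] ℚ_[2] F₀] [FiniteDimensional ℚ_[2] F₀]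

variable (hF : Module.finrank F₀ F = 2)

theorem ratio_eq :
    (((U.toQuadDatum hF).ratio : IntExt F₀ F) : F) = U.σ U.π / U.π := by
  rw [eq_div_iff U.π_ne_zero]
  exact congrArg Subtype.val (U.toQuadDatum hF).ratio_mul_π

/-- The vectors underlying the module of the lattice. -/
noncomputable def latM : W.lattice ≃+ (W.latticeModule hF).M := AddEquiv.refl W.lattice

/-- The values of the forms of the lattice. -/
noncomputable def latL : U.lineL ≃ₗ[IntBase F₀] (W.latticeModule hF).L :=
  LinearEquiv.refl (IntBase F₀) U.lineL

/-- The lattice as a module over the ring of integers of `F`. -/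
noncomputable instance : Module (IntExt F₀ F) W.lattice := Submodule.module W.lattice

/-- The scalar multiplication, found without searching through the module structure. -/
noncomputable instance : SMul (IntExt F₀ F) W.lattice :=
  (inferInstance : Module (IntExt F₀ F) W.lattice).toSMul

theorem coe_smul_lattice (a : IntExt F₀ F) (x : W.lattice) :
    ((a • x : W.lattice) : V) = (a : F) • (x : V) := rfl

theorem smul_latM (a : IntBase F₀ ⊗[IntBase F₀] IntExt F₀ F) (x : W.lattice) :
    a • W.latM hF x = W.latM hF (Algebra.TensorProduct.lid (IntBase F₀) (IntExt F₀ F) a • x) := rfl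

theorem one_tmul_smul_latM (a : IntExt F₀ F) (x : W.lattice) :
    ((1 : IntBase F₀) ⊗ₜ[IntBase F₀] a) • W.latM hF x = W.latM hF (a • x) := by
  rw [smul_latM, Algebra.TensorProduct.lid_tmul, one_smul]

theorem q_latM (x : W.lattice) :
    (W.latticeModule hF).q (W.latM hF x) = W.latL hF ⟨W.qV x, W.qV_mem hF x.2⟩ := rfl

theorem φ_latM (x y : W.lattice) :
    (W.latticeModule hF).φ (W.latM hF x) (W.latM hF y)
      = W.latL hF ⟨W.φV x y, W.φV_mem hF x.2 y.2⟩ := rfl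

set_option maxHeartbeats 1000000 in
theorem latticeModule_hermAxioms : (W.latticeModule hF).HermAxioms (U.toQuadDatum hF) := by
  refine ⟨fun x => ?_, fun x y => ?_, fun x y => ?_, fun x y => ?_, fun x => ?_⟩
  · obtain ⟨x, rfl⟩ := (W.latM hF).surjective x
    rw [QuadDatum.piR, one_tmul_smul_latM, q_latM, q_latM, ← map_smul]
    exact congrArg (W.latL hF) (Subtype.ext (W.qV_π_smul x))
  · obtain ⟨x, rfl⟩ := (W.latM hF).surjective x
    obtain ⟨y, rfl⟩ := (W.latM hF).surjective y
    rw [QuadDatum.piR, one_tmul_smul_latM, φ_latM, QuadraticMap.polar, ← map_add, q_latM, q_latM,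
      q_latM, ← map_sub, ← map_sub]
    refine congrArg (W.latL hF) (Subtype.ext ?_)
    have h := W.qV_add hF (x : V) y
    change W.φV x ((U.π : F) • (y : V)) = W.qV ((x : V) + y) - W.qV x - W.qV y
    rw [h]
    ring
  · obtain ⟨x, rfl⟩ := (W.latM hF).surjective x
    obtain ⟨y, rfl⟩ := (W.latM hF).surjective y
    rw [QuadDatum.piR, one_tmul_smul_latM, one_tmul_smul_latM, φ_latM, φ_latM]
    exact congrArg (W.latL hF) (Subtype.ext (W.φV_π_smul_left hF x y))
  · obtain ⟨x, rfl⟩ := (W.latM hF).surjective x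
    obtain ⟨y, rfl⟩ := (W.latM hF).surjective y
    rw [one_tmul_smul_latM, φ_latM, φ_latM]
    have h : W.φV x y = W.φV (((U.toQuadDatum hF).ratio • y : W.lattice) : V) x := by
      rw [coe_smul_lattice, ratio_eq hF]
      exact W.φV_swap hF x y
    exact congrArg (W.latL hF) (Subtype.ext h)
  · obtain ⟨x, rfl⟩ := (W.latM hF).surjective x
    rw [q_latM, φ_latM, ← map_smul]
    exact congrArg (W.latL hF) (Subtype.ext (W.φV_self hF x))

end SplitHermitianSpace

end UniformizerDatum

end LatticeModule

/-! ### A basis of the lattice adapted to the standard module -/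

section LatticeBasis

variable {F₀ : Type u} {F : Type v} [Field F₀] [Field F] [Algebra ℤ_[2] F₀] [Algebra F₀ F]

/-- The indices of the standard module in the order of the basis of the split hermitian space: the
two vectors of a hyperbolic plane are exchanged by `Fin.rev`. -/
noncomputable def splitIndex (m : ℕ) : (Fin m ⊕ Fin m) ⊕ Unit ≃ Fin (2 * m + 1) :=
  Equiv.ofBijective
    (Sum.elim (Sum.elim (fun i => ⟨i, by omega⟩) fun i => ⟨2 * m - i, by omega⟩)
      fun _ => ⟨m, by omega⟩) (by
    rw [Fintype.bijective_iff_injective_and_card]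
    refine ⟨?_, by simp; omega⟩
    rintro ((⟨i, hi⟩ | ⟨i, hi⟩) | i) ((⟨j, hj⟩ | ⟨j, hj⟩) | j) h <;>
      simp only [Sum.elim_inl, Sum.elim_inr, Fin.mk.injEq] at h <;>
      first
        | (exfalso; omega)
        | rfl
        | (obtain rfl : i = j := by omega
           rfl))

/-- The index of the basis vector that pairs nontrivially with the given one under the hermitian
form. -/
def swapIndex {m : ℕ} : (Fin m ⊕ Fin m) ⊕ Unit → (Fin m ⊕ Fin m) ⊕ Unit :=
  Sum.map Sum.swap id

theorem rev_splitIndex {m : ℕ} (i : (Fin m ⊕ Fin m) ⊕ Unit) :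
    Fin.rev (splitIndex m i) = splitIndex m (swapIndex i) := by
  apply Fin.ext
  rw [Fin.val_rev]
  rcases i with (⟨i, hi⟩ | ⟨i, hi⟩) | i <;> simp [splitIndex, swapIndex] <;> omega

namespace UniformizerDatum

variable (U : UniformizerDatum F₀ F)

/-- The coefficients of the hyperbolic vectors with respect to the basis of the split hermitian
space: `π / (π - π̄)` on the second vector of each hyperbolic plane, and `1` elsewhere. -/
noncomputable def hypCoeffs (m : ℕ) : (Fin m ⊕ Fin m) ⊕ Unit → F :=
  Sum.elim (Sum.elim (fun _ => 1) fun _ => U.hypCoeff) fun _ => 1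

theorem hypCoeffs_ne_zero (hF : Module.finrank F₀ F = 2) {m : ℕ} (i : (Fin m ⊕ Fin m) ⊕ Unit) :
    U.hypCoeffs m i ≠ 0 := by
  rcases i with (i | i) | i
  · exact one_ne_zero
  · exact div_ne_zero U.π_ne_zero (U.π_sub_conj_ne_zero hF)
  · exact one_ne_zero

theorem coeff_splitIndex {m : ℕ} (i : (Fin m ⊕ Fin m) ⊕ Unit) : U.coeff m (splitIndex m i)
    = Sum.elim (Sum.elim (fun _ => 1) fun _ => U.lam) (fun _ => 1) i := by
  rcases i with (⟨i, hi⟩ | ⟨i, hi⟩) | i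
  · exact if_pos hi.le
  · exact if_neg (by simp [splitIndex]; omega)
  · exact if_pos le_rfl

variable {U}

namespace SplitHermitianSpace

variable {m : ℕ} {V : Type w} [AddCommGroup V] [Module F V] (W : U.SplitHermitianSpace m V)

/-- The hyperbolic vectors, which form a basis of the lattice `Λ₀`. -/
noncomputable def hypVec (i : (Fin m ⊕ Fin m) ⊕ Unit) : V :=
  U.hypCoeffs m i • W.e (splitIndex m i)

theorem linearIndependent_hypVec (hF : Module.finrank F₀ F = 2) :
    LinearIndependent (IntExt F₀ F) W.hypVec := by
  have h := ((W.e.reindex (splitIndex m).symm).isUnitSMul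
    fun i => (U.hypCoeffs_ne_zero hF i).isUnit).linearIndependent
  have h2 := h.restrict_scalars (R := IntExt F₀ F) (by
    intro a b hab
    have hab' : (a : F) * 1 = b * 1 := hab
    rw [mul_one, mul_one] at hab'
    exact Subtype.ext hab')
  convert h2 using 1
  funext i
  rw [Module.Basis.isUnitSMul_apply, Module.Basis.reindex_apply, Equiv.symm_symm, hypVec]

theorem h_smul_e (a b : F) (i j : (Fin m ⊕ Fin m) ⊕ Unit) :
    W.h (a • W.e (splitIndex m i)) (b • W.e (splitIndex m j))
      = if j = swapIndex i then a * U.σ b else 0 := by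
  simp only [h_smul_left, h_smul_right, W.h_e, rev_splitIndex, (splitIndex m).injective.eq_iff]
  split_ifs <;> simp [mul_comm]

theorem φV_hypVec (i j : (Fin m ⊕ Fin m) ⊕ Unit) : W.φV (W.hypVec i) (W.hypVec j)
    = U.ε⁻¹ * Algebra.trace F₀ F (if j = swapIndex i then
        U.hypCoeffs m i * U.σ (U.hypCoeffs m j) * (U.σ U.π)⁻¹ else 0) := by
  rw [φV, hypVec, hypVec, smul_smul, h_smul_e, map_mul, map_inv₀]
  congr 3
  ring

theorem φV_π_hypVec (i j : (Fin m ⊕ Fin m) ⊕ Unit) :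
    W.φV (W.hypVec i) ((U.π : F) • W.hypVec j)
      = U.ε⁻¹ * Algebra.trace F₀ F (if j = swapIndex i then
        U.hypCoeffs m i * U.σ (U.hypCoeffs m j) else 0) := by
  rw [φV, smul_smul, inv_mul_cancel₀ U.π_ne_zero, one_smul, hypVec, hypVec, h_smul_e]

theorem qV_hypVec (i : (Fin m ⊕ Fin m) ⊕ Unit) : W.qV (W.hypVec i)
    = 1 / 2 * (U.ε⁻¹ * Algebra.trace F₀ F (if i = swapIndex i then
        U.hypCoeffs m i * U.σ (U.hypCoeffs m i) else 0)) := by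
  rw [qV, hypVec, h_smul_e]

/-- On the hyperbolic vectors `φ` takes `ε⁻¹` times the values of the standard form. -/
theorem φV_hypVec_eq (hF : Module.finrank F₀ F = 2) (i j : (Fin m ⊕ Fin m) ⊕ Unit) :
    W.φV (W.hypVec i) (W.hypVec j)
      = U.ε⁻¹ * ((herm (stdMat U.π₀ U.τ (IntBase F₀) (Fin m)) i j).im : IntBase F₀) := by
  rw [φV_hypVec]
  congr 1
  rcases i with (i | i) | i <;> rcases j with (j | j) | j <;>
    by_cases hij : i = j <;>
    simp [swapIndex, hypCoeffs, stdMat, hypMat, herm_apply, hij, Quad.ratio,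
      trace_σ_hypCoeff_mul_inv hF, trace_hypCoeff_mul_inv hF, trace_inv_conj hF, eq_comm]

theorem φV_π_hypVec_eq (hF : Module.finrank F₀ F = 2) (i j : (Fin m ⊕ Fin m) ⊕ Unit) :
    W.φV (W.hypVec i) ((U.π : F) • W.hypVec j)
      = U.ε⁻¹ * (Quad.tr (herm (stdMat U.π₀ U.τ (IntBase F₀) (Fin m)) i j) : IntBase F₀) := by
  rw [φV_π_hypVec]
  congr 1
  rcases i with (i | i) | i <;> rcases j with (j | j) | j <;>
    by_cases hij : i = j <;>
    simp [swapIndex, hypCoeffs, stdMat, hypMat, herm_apply, hij, Quad.ratio,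
      trace_hypCoeff hF, trace_conj hF, Quad.tr_apply, trace_one_eq_two hF, eq_comm] <;>
    ring

theorem qV_hypVec_eq [Algebra ℚ_[2] F₀] (hF : Module.finrank F₀ F = 2)
    (i : (Fin m ⊕ Fin m) ⊕ Unit) :
    W.qV (W.hypVec i)
      = U.ε⁻¹ * (Quad.tr (stdMat U.π₀ U.τ (IntBase F₀) (Fin m) i i) : IntBase F₀) := by
  have h2 : (2 : F₀) ≠ 0 := two_ne_zero_ext F₀ F₀
  rw [qV_hypVec]
  rcases i with (i | i) | i <;>
    simp [swapIndex, hypCoeffs, stdMat, hypMat, Quad.tr_apply, trace_one_eq_two hF]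
  field_simp

variable [Algebra ℚ_[2] F₀] [IsScalarTower ℤ_[2] ℚ_[2] F₀] [FiniteDimensional ℚ_[2] F₀]

/-- The hyperbolic vectors span `Λ₀`, because `λ` and `π / (π - π̄)` differ by a unit. -/
theorem span_hypVec (hF : Module.finrank F₀ F = 2) :
    Submodule.span (IntExt F₀ F) (Set.range W.hypVec) = W.lattice := by
  obtain ⟨a, b, ha, hb⟩ := U.exists_hypCoeff_eq hF
  have hsm : ∀ (c : IntExt F₀ F) (x : V), c • x = (c : F) • x := fun _ _ => rfl
  apply le_antisymm
  · rw [Submodule.span_le]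
    rintro _ ⟨i, rfl⟩
    have hi : U.coeff m (splitIndex m i) • W.e (splitIndex m i) ∈ W.lattice :=
      Submodule.subset_span ⟨_, rfl⟩
    rw [coeff_splitIndex] at hi
    rcases i with (i | i) | i
    · exact hi
    · have h := W.lattice.smul_mem a hi
      rw [hsm, smul_smul] at h
      change _ • _ ∈ W.lattice
      rwa [show U.hypCoeffs m (.inl (.inr i)) = _ from ha]
    · exact hi
  · refine Submodule.span_le.2 ?_
    rintro _ ⟨j, rfl⟩
    obtain ⟨i, rfl⟩ := (splitIndex m).surjective j
    have hi : W.hypVec i ∈ Submodule.span (IntExt F₀ F) (Set.range W.hypVec) :=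
      Submodule.subset_span ⟨_, rfl⟩
    simp only [coeff_splitIndex]
    rcases i with (i | i) | i
    · exact hi
    · have h := Submodule.smul_mem _ b hi
      rw [hsm, hypVec, smul_smul] at h
      rw [Sum.elim_inl, Sum.elim_inr, hb]
      exact h
    · exact hi

variable (hF : Module.finrank F₀ F = 2)

/-- The hyperbolic basis of the lattice over the ring of integers of `F`. -/
noncomputable def hypBasis : Module.Basis ((Fin m ⊕ Fin m) ⊕ Unit) (IntExt F₀ F) W.lattice :=
  (Module.Basis.span (W.linearIndependent_hypVec hF)).map (LinearEquiv.ofEq _ _ (W.span_hypVec hF))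

theorem coe_hypBasis (i : (Fin m ⊕ Fin m) ⊕ Unit) : (W.hypBasis hF i : V) = W.hypVec i := by
  rw [hypBasis, Module.Basis.map_apply, LinearEquiv.coe_ofEq_apply, Module.Basis.span_apply]

/-- The hyperbolic basis of the module of the lattice. -/
noncomputable def latBasis : Module.Basis ((Fin m ⊕ Fin m) ⊕ Unit)
    (IntBase F₀ ⊗[IntBase F₀] IntExt F₀ F) (W.latticeModule hF).M :=
  letI : Module (IntBase F₀ ⊗[IntBase F₀] IntExt F₀ F) W.lattice := (W.latticeModule hF).moduleAM
  (W.hypBasis hF).mapCoeffs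
    (Algebra.TensorProduct.lid (IntBase F₀) (IntExt F₀ F)).symm.toRingEquiv fun c x => by
      change (Algebra.TensorProduct.lid (IntBase F₀) (IntExt F₀ F)
        ((Algebra.TensorProduct.lid (IntBase F₀) (IntExt F₀ F)).symm c)) • x = c • x
      rw [AlgEquiv.apply_symm_apply]

theorem latBasis_apply (i : (Fin m ⊕ Fin m) ⊕ Unit) :
    W.latBasis hF i = W.latM hF (W.hypBasis hF i) := by
  let : Module (IntBase F₀ ⊗[IntBase F₀] IntExt F₀ F) W.lattice := (W.latticeModule hF).moduleAM
  exact Module.Basis.mapCoeffs_apply (W.hypBasis hF)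
    (Algebra.TensorProduct.lid (IntBase F₀) (IntExt F₀ F)).symm.toRingEquiv _ i

set_option maxHeartbeats 1000000 in
/-- The lattice `Λ₀` is similar to the standard module. -/
theorem latticeModule_similar :
    (W.latticeModule hF).Similar (stdModule (U.toQuadDatum hF) (IntBase F₀) m) := by
  refine FormModule.Similar.trans ?_ (stdModule_similar (U.toQuadDatum hF) m).symm
  have : Module.IsTorsionFree (IntBase F₀) F₀ := inferInstance
  let γ₀ : U.lineL ≃ₗ[IntBase F₀] IntBase F₀ :=
    (LinearEquiv.toSpanNonzeroSingleton (IntBase F₀) F₀ U.ε⁻¹ (inv_ne_zero U.ε_ne_zero)).symm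
  have hγ₀ : ∀ (x : U.lineL) (r : IntBase F₀), (x : F₀) = U.ε⁻¹ * r → γ₀ x = r := by
    intro x r h
    rw [LinearEquiv.symm_apply_eq]
    apply Subtype.ext
    rw [h, LinearEquiv.toSpanNonzeroSingleton_apply, mul_comm]
    rfl
  let B := stdMat (U.toQuadDatum hF).π₀ (U.toQuadDatum hF).τ (IntBase F₀) (Fin m)
  let γ : (W.latticeModule hF).L ≃ₗ[IntBase F₀] (FormModule.ofMatrix (U.toQuadDatum hF) B).L :=
    ((W.latL hF).symm.trans γ₀).trans (FormModule.omL B)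
  have hγ : ∀ (x : U.lineL) (r : IntBase F₀), (x : F₀) = U.ε⁻¹ * r →
      γ (W.latL hF x) = FormModule.omL B r := by
    intro x r h
    simp only [γ, LinearEquiv.trans_apply, LinearEquiv.symm_apply_apply, hγ₀ x r h]
  refine (W.latticeModule_hermAxioms hF).similar_of_basis (FormModule.ofMatrix_hermAxioms B)
    (W.latBasis hF) (FormModule.omBasis B) γ (fun i => ?_) (fun i j => ?_) (fun i j => ?_)
  · rw [FormModule.omBasis_apply, FormModule.q_omM, matForm_single, latBasis_apply, q_latM]
    refine (hγ _ _ ?_).symm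
    change W.qV (W.hypBasis hF i : V) = _
    rw [coe_hypBasis]
    exact W.qV_hypVec_eq hF i
  · rw [FormModule.omBasis_apply, FormModule.omBasis_apply, FormModule.φ_omM, matForm_single,
      latBasis_apply, latBasis_apply, φ_latM]
    refine (hγ _ _ ?_).symm
    change W.φV (W.hypBasis hF i : V) (W.hypBasis hF j : V) = _
    rw [coe_hypBasis, coe_hypBasis]
    exact W.φV_hypVec_eq hF i j
  · rw [FormModule.omBasis_apply, FormModule.omBasis_apply, FormModule.φ_piR_omM, matForm_single,
      latBasis_apply, latBasis_apply, QuadDatum.piR, one_tmul_smul_latM, φ_latM]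
    refine (hγ _ _ ?_).symm
    change W.φV (W.hypBasis hF i : V) ((U.π : F) • (W.hypBasis hF j : V)) = _
    rw [coe_hypBasis, coe_hypBasis]
    exact W.φV_π_hypVec_eq hF i j

end SplitHermitianSpace

end UniformizerDatum

end LatticeBasis

end HermQuad

theorem mainTheorem7
    (F₀ : Type*) (F : Type*) [Field F₀] [Field F]
    [Algebra ℤ_[2] F₀] [Algebra ℚ_[2] F₀] [IsScalarTower ℤ_[2] ℚ_[2] F₀]
    [FiniteDimensional ℚ_[2] F₀]
    [Algebra F₀ F] (hF : Module.finrank F₀ F = 2)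
    (U : HermQuad.UniformizerDatum F₀ F) (m : ℕ)
    (V : Type*) [AddCommGroup V] [Module F V] (W : U.SplitHermitianSpace m V)
    (R : Type*) [CommRing R] [Algebra (HermQuad.IntBase F₀) R]
    (X : HermQuad.FormModule (HermQuad.IntBase F₀) (HermQuad.IntExt F₀ F) R)
    (hX : X.IsTypeLambdaZero (U.toQuadDatum hF) m) :
    X.EtaleLocallySimilar (HermQuad.stdModule (U.toQuadDatum hF) R m) ∧
      X.EtaleLocallySimilar ((W.latticeModule hF).baseChange R) := by
  obtain ⟨k, h2, hc⟩ := U.exists_two_dvd_and_c_dvd hF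
  have h := hX.etaleLocallySimilar_stdModule (U.c_ne_zero hF) U.π₀_dvd_two h2 hc
  refine ⟨h, ?_⟩
  have hlat : (HermQuad.stdModule (U.toQuadDatum hF) R m).Similar
      ((W.latticeModule hF).baseChange R) :=
    (((W.latticeModule_similar hF).baseChange (S := R) (W.latticeModule_hermAxioms hF)).trans
      (HermQuad.stdModule_baseChange (U.toQuadDatum hF) R m)).symm
  obtain ⟨S, _, _, _, _, het, hff, hS⟩ := h
  exact ⟨S, _, _, _, _, het, hff,
    hS.trans (hlat.baseChange (HermQuad.stdModule_hermAxioms (U.toQuadDatum hF) m))⟩
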